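/- Let $\Pi$ be a finite projective plane of order $q\ge 23$. A set $S$ of points and lines of $\Pi$ is a resolving set if it is a resolving set of the incidence graph of $\Pi$, that is, if no two distinct vertices (points or lines) have the same distance to every element of $S$. Write $\mathcal P_S$ and $\mathcal L_S$ for the sets of points and of lines in $S$. A *frame* consists of two distinct lines $e,f$ with $e\cap f=P$, two distinct points $R,R'$ of $e$ other than $P$, a point $Q\ne P$ of $f$, a line $\ell_0$ through $P$ other than $e,f$, and a line $\ell_1$ through $R$ other than $e$. The structure $S^*$ of the frame consists of all points of $e$ and $f$ except $P,Q,R,R'$ and all lines through $P$ or $R$ except $e,f,\ell_0,\ell_1$. Put $T=f\cap\ell_1$, $A=\ell_0\cap\ell_1$, $B=\ell_0\cap RQ$. Below, $U$ denotes a point of $e$ other than $P,R,R'$. Then $|S^*|=4q-6$ for every frame, and every resolving set of size $4q-4$ contains the structure $S^*$ of some frame. A set $S$ of points and lines is a resolving set of size $4q-4$ with $|\mathcal P_S|\le|\mathcal L_S|$ if and only if, for some frame, $S$ is obtained from $S^*$ by adding two objects in one of the following 32 ways. With no condition on $Q$ and $\ell_1$: (C1) $\ell_0,\ \ell_1$;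 (C2) $R'Q,\ \ell_1$; (C3) $\ell_1,\ Q$; (C4) $\ell_1,\ B$. If $Q\in\ell_1$: (C5) $R'Q,\ Q$; (C6) $\ell_0,\ R'$. If $Q\notin\ell_1$: (C7) $\ell_0,\ R'T$; (C8) $R'Q,\ R'T$; (C9) $f,\ R'$; (C10) $UQ,\ R'$; (C11) $\ell_0,\ R'$; (C12) $UB,\ R'$; (C13) $e,\ B$, where $B\in R'T$; (C14) $f,\ A$, where $A\notin R'Q$; (C15) $\ell_0,\ Z$, where $Z\in\ell_1\setminus\{T\}$; (C16) $\ell_0,\ Z$, where $Z\in R'T\setminus\{T,R'\}$; (C17) $UV,\ B$, where $V\in f\setminus\{P,Q\}$, $A\in UV$, $B\in R'T$; (C18) $UV,\ A$, where $V\in f\setminus\{P,Q\}$, $B\in UV$, $A\notin R'Q$; (C19) $UQ,\ A$, where $A\notin UQ$, $A\notin R'Q$; (C20) $UQ,\ A$, where $A\in UQ$; (C21) $UQ,\ \ell_0\cap R'T$, where $A\in UQ$; (C22) $UQ,\ \ell_1\cap R'Q$, where $A\in UQ$; (C23) $R'Q,\ A$, where $A\in R'Q$; (C24) $R'V,\ B$,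 where $V\in f\setminus\{P,T,Q\}$, $A\notin R'V$, $B\in R'T$; (C25) $R'V,\ \ell_0\cap R'T$, where $V\in f\setminus\{P,T,Q\}$, $B\in R'V$; (C26) $R'V,\ A$, where $V\in f\setminus\{P,T,Q\}$, $B\in R'V$, $A\notin R'Q$; (C27) $R'V,\ \ell_1\cap R'Q$, where $V\in f\setminus\{P,T,Q\}$, $B\in R'V$, $A\notin R'Q$; (C28) $R'T,\ B$, where $B\notin R'T$; (C29) $R'T,\ Z$, where $B\in R'T$, $Z\in\ell_0$, $Z\ne\ell_0\cap R'Q$; (C30) $R'T,\ Z$, where $B\in R'T$, $Z\in R'Q\setminus\{R',Q\}$, $Z\ne\ell_0\cap R'Q$; (C31) $R'Q,\ Z$, where $A\notin R'Q$, $Z\in\ell_1\setminus\{T\}$; (C32) $R'Q,\ Z$, where $A\notin R'Q$, $Z\in R'T\setminus\{T,R'\}$. A set $S$ of points and lines is a resolving set of size $4q-4$ with $|\mathcal P_S|>|\mathcal L_S|$ if and only if $S$, regarded as a set of lines and points of the dual plane, is obtained in that plane by one of the constructions (C1), (C2), (C7), (C8). -/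

import Mathlib

open Configuration Configuration.HasPoints Configuration.HasLines

/-- `S` is a resolving set of the graph `G`: the distance lists to the elements of `S` are
pairwise different. -/
def IsResolvingSet {V : Type*} (G : SimpleGraph V) (S : Set V) : Prop :=
  ∀ x y : V, (∀ s ∈ S, G.dist x s = G.dist y s) → x = y

/-- The incidence graph of a point-line configuration. -/
def incidenceGraph (Pt Ln : Type*) [Membership Pt Ln] : SimpleGraph (Pt ⊕ Ln) where
  Adj x y := match x, y with
    | Sum.inl p, Sum.inr l => p ∈ l
    | Sum.inr l, Sum.inl p => p ∈ l
    | _, _ => False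
  symm := ⟨fun x y h => by
    rcases x with p | l <;> rcases y with p' | l' <;> exact h⟩
  loopless := ⟨fun x h => by rcases x with p | l <;> exact h⟩

/-- The points of `S`. -/
def pointPart {Pt Ln : Type*} (S : Set (Pt ⊕ Ln)) : Set Pt := {p | Sum.inl p ∈ S}

/-- The lines of `S`. -/
def linePart {Pt Ln : Type*} (S : Set (Pt ⊕ Ln)) : Set Ln := {l | Sum.inr l ∈ S}

/-- The same set of points and lines, seen in the dual plane. -/
def dualSet {Pt Ln : Type*} (S : Set (Pt ⊕ Ln)) : Set (Dual Ln ⊕ Dual Pt) :=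
  {x | Sum.swap (α := Ln) (β := Pt) x ∈ S}

/-- The data that determine a copy of the structure `S*`: two lines `e`, `f` meeting in `P`,
further points `R ≠ R'` of `e` and `Q` of `f`, a line `l0` through `P` other than `e` and `f`,
and a line `l1` through `R` other than `e`. -/
structure Frame (Pt Ln : Type*) [Membership Pt Ln] where
  (P Q R R' : Pt)
  (e f l0 l1 : Ln)
  e_ne_f : e ≠ f
  P_mem_e : P ∈ e
  P_mem_f : P ∈ f
  R_mem_e : R ∈ e
  R_ne_P : R ≠ P
  R'_mem_e : R' ∈ e
  R'_ne_P : R' ≠ P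
  R'_ne_R : R' ≠ R
  Q_mem_f : Q ∈ f
  Q_ne_P : Q ≠ P
  P_mem_l0 : P ∈ l0
  l0_ne_e : l0 ≠ e
  l0_ne_f : l0 ≠ f
  R_mem_l1 : R ∈ l1
  l1_ne_e : l1 ≠ e

namespace Frame

variable {Pt Ln : Type*} [Membership Pt Ln]

/-- The structure `S*`: the points of `e` and `f` other than `P`, `Q`, `R`, `R'`, and the lines
through `P` or `R` other than `e`, `f`, `l0`, `l1`. -/
def star (F : Frame Pt Ln) : Set (Pt ⊕ Ln) :=
  Sum.inl '' {X | (X ∈ F.e ∨ X ∈ F.f) ∧ X ≠ F.P ∧ X ≠ F.Q ∧ X ≠ F.R ∧ X ≠ F.R'} ∪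
  Sum.inr '' {m | (F.P ∈ m ∨ F.R ∈ m) ∧ m ≠ F.e ∧ m ≠ F.f ∧ m ≠ F.l0 ∧ m ≠ F.l1}

variable [ProjectivePlane Pt Ln]

theorem R_notMem_f (F : Frame Pt Ln) : F.R ∉ F.f := fun h =>
  (Nondegenerate.eq_or_eq F.R_mem_e F.P_mem_e h F.P_mem_f).elim F.R_ne_P F.e_ne_f

theorem R'_notMem_f (F : Frame Pt Ln) : F.R' ∉ F.f := fun h =>
  (Nondegenerate.eq_or_eq F.R'_mem_e F.P_mem_e h F.P_mem_f).elim F.R'_ne_P F.e_ne_f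

theorem R_notMem_l0 (F : Frame Pt Ln) : F.R ∉ F.l0 := fun h =>
  (Nondegenerate.eq_or_eq h F.P_mem_l0 F.R_mem_e F.P_mem_e).elim F.R_ne_P F.l0_ne_e

theorem R'_notMem_l0 (F : Frame Pt Ln) : F.R' ∉ F.l0 := fun h =>
  (Nondegenerate.eq_or_eq h F.P_mem_l0 F.R'_mem_e F.P_mem_e).elim F.R'_ne_P F.l0_ne_e

theorem R'_notMem_l1 (F : Frame Pt Ln) : F.R' ∉ F.l1 := fun h =>
  (Nondegenerate.eq_or_eq h F.R_mem_l1 F.R'_mem_e F.R_mem_e).elim F.R'_ne_R F.l1_ne_e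

theorem R_ne_Q (F : Frame Pt Ln) : F.R ≠ F.Q := fun h => F.R_notMem_f (h ▸ F.Q_mem_f)

theorem R'_ne_Q (F : Frame Pt Ln) : F.R' ≠ F.Q := fun h => F.R'_notMem_f (h ▸ F.Q_mem_f)

theorem f_ne_l1 (F : Frame Pt Ln) : F.f ≠ F.l1 := fun h => F.R_notMem_f (h ▸ F.R_mem_l1)

theorem l0_ne_l1 (F : Frame Pt Ln) : F.l0 ≠ F.l1 := fun h => F.R_notMem_l0 (h ▸ F.R_mem_l1)

/-- The point `T = f ∩ l1`. -/
noncomputable def T (F : Frame Pt Ln) : Pt := mkPoint F.f_ne_l1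

/-- The line `RQ`. -/
noncomputable def RQ (F : Frame Pt Ln) : Ln := mkLine F.R_ne_Q

/-- The line `R'Q`. -/
noncomputable def R'Q (F : Frame Pt Ln) : Ln := mkLine F.R'_ne_Q

theorem R'_ne_T (F : Frame Pt Ln) : F.R' ≠ F.T := fun h =>
  F.R'_notMem_f (h ▸ (mkPoint_ax F.f_ne_l1).1)

/-- The line `R'T`. -/
noncomputable def R'T (F : Frame Pt Ln) : Ln := mkLine F.R'_ne_T

theorem l0_ne_RQ (F : Frame Pt Ln) : F.l0 ≠ F.RQ := fun h =>
  F.R_notMem_l0 (h ▸ (mkLine_ax F.R_ne_Q).1)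

theorem l0_ne_R'Q (F : Frame Pt Ln) : F.l0 ≠ F.R'Q := fun h =>
  F.R'_notMem_l0 (h ▸ (mkLine_ax F.R'_ne_Q).1)

theorem l0_ne_R'T (F : Frame Pt Ln) : F.l0 ≠ F.R'T := fun h =>
  F.R'_notMem_l0 (h ▸ (mkLine_ax F.R'_ne_T).1)

theorem l1_ne_R'Q (F : Frame Pt Ln) : F.l1 ≠ F.R'Q := fun h =>
  F.R'_notMem_l1 (h ▸ (mkLine_ax F.R'_ne_Q).1)

/-- The point `l0 ∩ l1`. -/
noncomputable def l0l1 (F : Frame Pt Ln) : Pt := mkPoint F.l0_ne_l1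

/-- The point `l0 ∩ RQ`. -/
noncomputable def l0RQ (F : Frame Pt Ln) : Pt := mkPoint F.l0_ne_RQ

/-- The point `l0 ∩ R'Q`. -/
noncomputable def l0R'Q (F : Frame Pt Ln) : Pt := mkPoint F.l0_ne_R'Q

/-- The point `l0 ∩ R'T`. -/
noncomputable def l0R'T (F : Frame Pt Ln) : Pt := mkPoint F.l0_ne_R'T

/-- The point `l1 ∩ R'Q`. -/
noncomputable def l1R'Q (F : Frame Pt Ln) : Pt := mkPoint F.l1_ne_R'Q

/-- `U` is a point of `e` other than `P`, `R`, `R'`. -/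
def IsU (F : Frame Pt Ln) (U : Pt) : Prop := U ∈ F.e ∧ U ≠ F.P ∧ U ≠ F.R ∧ U ≠ F.R'

/-- `F.Adds i x y`: the objects `x` and `y` may be added to `F.star` according to the `i`-th
construction, `1 ≤ i ≤ 32`. -/
inductive Adds (F : Frame Pt Ln) : ℕ → Pt ⊕ Ln → Pt ⊕ Ln → Prop
  | C1 : Adds F 1 (Sum.inr F.l0) (Sum.inr F.l1)
  | C2 : Adds F 2 (Sum.inr F.R'Q) (Sum.inr F.l1)
  | C3 : Adds F 3 (Sum.inr F.l1) (Sum.inl F.Q)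
  | C4 : Adds F 4 (Sum.inr F.l1) (Sum.inl F.l0RQ)
  | C5 (h : F.Q ∈ F.l1) : Adds F 5 (Sum.inr F.R'Q) (Sum.inl F.Q)
  | C6 (h : F.Q ∈ F.l1) : Adds F 6 (Sum.inr F.l0) (Sum.inl F.R')
  | C7 (h : F.Q ∉ F.l1) : Adds F 7 (Sum.inr F.l0) (Sum.inr F.R'T)
  | C8 (h : F.Q ∉ F.l1) : Adds F 8 (Sum.inr F.R'Q) (Sum.inr F.R'T)
  | C9 (h : F.Q ∉ F.l1) : Adds F 9 (Sum.inr F.f) (Sum.inl F.R')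
  | C10 (h : F.Q ∉ F.l1) (U : Pt) (m : Ln) (hU : F.IsU U) (hUm : U ∈ m) (hQm : F.Q ∈ m) :
      Adds F 10 (Sum.inr m) (Sum.inl F.R')
  | C11 (h : F.Q ∉ F.l1) : Adds F 11 (Sum.inr F.l0) (Sum.inl F.R')
  | C12 (h : F.Q ∉ F.l1) (U : Pt) (m : Ln) (hU : F.IsU U) (hUm : U ∈ m) (hm : F.l0RQ ∈ m) :
      Adds F 12 (Sum.inr m) (Sum.inl F.R')
  | C13 (h : F.Q ∉ F.l1) (h1 : F.l0RQ ∈ F.R'T) : Adds F 13 (Sum.inr F.e) (Sum.inl F.l0RQ)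
  | C14 (h : F.Q ∉ F.l1) (h1 : F.l0l1 ∉ F.R'Q) : Adds F 14 (Sum.inr F.f) (Sum.inl F.l0l1)
  | C15 (h : F.Q ∉ F.l1) (Z : Pt) (hZ : Z ∈ F.l1) (hZT : Z ≠ F.T) :
      Adds F 15 (Sum.inr F.l0) (Sum.inl Z)
  | C16 (h : F.Q ∉ F.l1) (Z : Pt) (hZ : Z ∈ F.R'T) (hZT : Z ≠ F.T) (hZR' : Z ≠ F.R') :
      Adds F 16 (Sum.inr F.l0) (Sum.inl Z)
  | C17 (h : F.Q ∉ F.l1) (U V : Pt) (m : Ln) (hU : F.IsU U)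
      (hV : V ∈ F.f ∧ V ≠ F.P ∧ V ≠ F.Q) (hUm : U ∈ m) (hVm : V ∈ m)
      (h1 : F.l0l1 ∈ m) (h2 : F.l0RQ ∈ F.R'T) : Adds F 17 (Sum.inr m) (Sum.inl F.l0RQ)
  | C18 (h : F.Q ∉ F.l1) (U V : Pt) (m : Ln) (hU : F.IsU U)
      (hV : V ∈ F.f ∧ V ≠ F.P ∧ V ≠ F.Q) (hUm : U ∈ m) (hVm : V ∈ m)
      (h1 : F.l0RQ ∈ m) (h2 : F.l0l1 ∉ F.R'Q) : Adds F 18 (Sum.inr m) (Sum.inl F.l0l1)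
  | C19 (h : F.Q ∉ F.l1) (U : Pt) (m : Ln) (hU : F.IsU U) (hUm : U ∈ m) (hQm : F.Q ∈ m)
      (h1 : F.l0l1 ∉ m) (h2 : F.l0l1 ∉ F.R'Q) : Adds F 19 (Sum.inr m) (Sum.inl F.l0l1)
  | C20 (h : F.Q ∉ F.l1) (U : Pt) (m : Ln) (hU : F.IsU U) (hUm : U ∈ m) (hQm : F.Q ∈ m)
      (h1 : F.l0l1 ∈ m) : Adds F 20 (Sum.inr m) (Sum.inl F.l0l1)
  | C21 (h : F.Q ∉ F.l1) (U : Pt) (m : Ln) (hU : F.IsU U) (hUm : U ∈ m) (hQm : F.Q ∈ m)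
      (h1 : F.l0l1 ∈ m) : Adds F 21 (Sum.inr m) (Sum.inl F.l0R'T)
  | C22 (h : F.Q ∉ F.l1) (U : Pt) (m : Ln) (hU : F.IsU U) (hUm : U ∈ m) (hQm : F.Q ∈ m)
      (h1 : F.l0l1 ∈ m) : Adds F 22 (Sum.inr m) (Sum.inl F.l1R'Q)
  | C23 (h : F.Q ∉ F.l1) (h1 : F.l0l1 ∈ F.R'Q) : Adds F 23 (Sum.inr F.R'Q) (Sum.inl F.l0l1)
  | C24 (h : F.Q ∉ F.l1) (V : Pt) (m : Ln) (hV : V ∈ F.f ∧ V ≠ F.P ∧ V ≠ F.T ∧ V ≠ F.Q)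
      (hR'm : F.R' ∈ m) (hVm : V ∈ m) (h1 : F.l0l1 ∉ m) (h2 : F.l0RQ ∈ F.R'T) :
      Adds F 24 (Sum.inr m) (Sum.inl F.l0RQ)
  | C25 (h : F.Q ∉ F.l1) (V : Pt) (m : Ln) (hV : V ∈ F.f ∧ V ≠ F.P ∧ V ≠ F.T ∧ V ≠ F.Q)
      (hR'm : F.R' ∈ m) (hVm : V ∈ m) (h1 : F.l0RQ ∈ m) :
      Adds F 25 (Sum.inr m) (Sum.inl F.l0R'T)
  | C26 (h : F.Q ∉ F.l1) (V : Pt) (m : Ln) (hV : V ∈ F.f ∧ V ≠ F.P ∧ V ≠ F.T ∧ V ≠ F.Q)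
      (hR'm : F.R' ∈ m) (hVm : V ∈ m) (h1 : F.l0RQ ∈ m) (h2 : F.l0l1 ∉ F.R'Q) :
      Adds F 26 (Sum.inr m) (Sum.inl F.l0l1)
  | C27 (h : F.Q ∉ F.l1) (V : Pt) (m : Ln) (hV : V ∈ F.f ∧ V ≠ F.P ∧ V ≠ F.T ∧ V ≠ F.Q)
      (hR'm : F.R' ∈ m) (hVm : V ∈ m) (h1 : F.l0RQ ∈ m) (h2 : F.l0l1 ∉ F.R'Q) :
      Adds F 27 (Sum.inr m) (Sum.inl F.l1R'Q)
  | C28 (h : F.Q ∉ F.l1) (h1 : F.l0RQ ∉ F.R'T) : Adds F 28 (Sum.inr F.R'T) (Sum.inl F.l0RQ)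
  | C29 (h : F.Q ∉ F.l1) (h1 : F.l0RQ ∈ F.R'T) (Z : Pt) (hZ : Z ∈ F.l0) (hZ0 : Z ≠ F.l0R'Q) :
      Adds F 29 (Sum.inr F.R'T) (Sum.inl Z)
  | C30 (h : F.Q ∉ F.l1) (h1 : F.l0RQ ∈ F.R'T) (Z : Pt) (hZ : Z ∈ F.R'Q) (hZ0 : Z ≠ F.l0R'Q)
      (hZR' : Z ≠ F.R') (hZQ : Z ≠ F.Q) : Adds F 30 (Sum.inr F.R'T) (Sum.inl Z)
  | C31 (h : F.Q ∉ F.l1) (h1 : F.l0l1 ∉ F.R'Q) (Z : Pt) (hZ : Z ∈ F.l1) (hZT : Z ≠ F.T) :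
      Adds F 31 (Sum.inr F.R'Q) (Sum.inl Z)
  | C32 (h : F.Q ∉ F.l1) (h1 : F.l0l1 ∉ F.R'Q) (Z : Pt) (hZ : Z ∈ F.R'T) (hZT : Z ≠ F.T)
      (hZR' : Z ≠ F.R') : Adds F 32 (Sum.inr F.R'Q) (Sum.inl Z)

end Frame

/-- `S` arises from a copy of `S*` by the `i`-th construction. -/
def HasType {Pt Ln : Type*} [Membership Pt Ln] [ProjectivePlane Pt Ln] (i : ℕ)
    (S : Set (Pt ⊕ Ln)) : Prop :=
  ∃ (F : Frame Pt Ln) (x y : Pt ⊕ Ln), F.Adds i x y ∧ S = F.star ∪ {x, y}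

/-!
A set `S` with points `A` and lines `B` resolves the incidence graph exactly when any two points
outside `A` are separated by a line of `B` and any two lines outside `B` are separated by a point
of `A` (`isResolvingSet_iff`). This condition is self-dual, so one may assume that `A` is the
smaller part, with at most `2q - 2` points.

Outside `B` there is at most one line without points of `A` and at most one tangent at each point
of `A`. Hence a weight that is positive only on such lines and on lines of `B` has a small sum
over any set of lines (`SeparatesLines.sum_le`). With suitable weights this shows that each line
has at most four or at least `q - 4` points of `A` (`SeparatesLines.short_or_long`), and that
there are two long lines `e` and `f`. Let `P` be their intersection. The same estimate on the
lines through `P` or through a point of the long lines missing from `A`, a hole, shows that the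
holes number one on each line, or two on one and at most one on the other
(`SeparatesLines.hole_inequality`, `hole_numbers`).

It remains to find the point `R` of the frame, such that, besides `e` and `f`, at most one line
through each of `P` and `R` is missing from `B`. If `e` has two holes `R` and `R'`, a missing line
through `R` and one through `R'` meet in a point that few lines of `B` can separate, so one of the
two holes is on at most one missing line (`Separates.card_missingDirections_le_one_of_le`). If
each long line has one hole, then `B` has at most `2q - 2` lines, and the existence of long lines
in the dual plane gives a second point `G` on almost `q` lines of `B`; it lies on `e` or `f` and
serves as `R` (`Separates.exists_frame_of_one_hole`). So `S` contains the structure of a frame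
(`Separates.exists_frame`).

The structure itself separates all pairs but two or three pairs of lines, the conflicts, and
dually two or three pairs of points (`Frame.separates_iff`). It has `4q - 6` elements, so `S` is
obtained by adding two objects that resolve all conflicts. Going through the possible positions of
these objects gives the 32 constructions; in a few positions the points `R'` or `Q` of the frame
have to be changed first (`Frame.exists_adds_of_separates_lines`,
`Frame.exists_hasType_of_separates`). Conversely, every construction resolves the conflicts
(`Frame.Adds.separates`). The constructions that add two lines are those with different numbers of
points and lines, and their duals are the resolving sets with more points than lines.
-/

/-! ### Separation of points and of lines -/

section Separation

variable {Pt Ln : Type*} [Membership Pt Ln]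

/-- Two lines outside `B` that have the same points of `A` on them are equal. -/
def SeparatesLines (A : Set Pt) (B : Set Ln) : Prop :=
  ∀ l m : Ln, l ∉ B → m ∉ B → (∀ x ∈ A, x ∈ l ↔ x ∈ m) → l = m

/-- Two points outside `A` that have the same lines of `B` through them are equal. -/
def SeparatesPoints (A : Set Pt) (B : Set Ln) : Prop :=
  ∀ x y : Pt, x ∉ A → y ∉ A → (∀ l ∈ B, x ∈ l ↔ y ∈ l) → x = y

/-- The points `A` and the lines `B` together separate all points and all lines. -/
def Separates (A : Set Pt) (B : Set Ln) : Prop := SeparatesLines A B ∧ SeparatesPoints A B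

theorem Separates.dual {A : Set Pt} {B : Set Ln} (h : Separates A B) :
    Separates (Pt := Dual Ln) (Ln := Dual Pt) B A := ⟨h.2, h.1⟩

variable [ProjectivePlane Pt Ln]

theorem line_unique {x y : Pt} {l m : Ln} (hxy : x ≠ y) (hxl : x ∈ l) (hyl : y ∈ l)
    (hxm : x ∈ m) (hym : y ∈ m) : l = m :=
  (Nondegenerate.eq_or_eq hxl hyl hxm hym).resolve_left hxy

theorem point_unique {x y : Pt} {l m : Ln} (hlm : l ≠ m) (hxl : x ∈ l) (hxm : x ∈ m)
    (hyl : y ∈ l) (hym : y ∈ m) : x = y :=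
  (Nondegenerate.eq_or_eq hxl hyl hxm hym).resolve_right hlm

variable (Ln) in
theorem exists_line_through (x y : Pt) : ∃ l : Ln, x ∈ l ∧ y ∈ l := by
  by_cases h : x = y
  · subst h
    obtain ⟨-, z, -, -, l, -, -, -, -, hz, -⟩ := @ProjectivePlane.exists_config Pt Ln _ _
    by_cases hx : x = z
    · exact ⟨l, hx ▸ hz, hx ▸ hz⟩
    · exact ⟨mkLine hx, (mkLine_ax hx).1, (mkLine_ax hx).1⟩
  · exact ⟨mkLine h, mkLine_ax h⟩

variable (Pt) in
theorem exists_point_on (l m : Ln) : ∃ x : Pt, x ∈ l ∧ x ∈ m :=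
  exists_line_through (Dual Pt) (Pt := Dual Ln) l m

end Separation

/-! ### Distances in the incidence graph -/

section Distance

variable {Pt Ln : Type*} [Membership Pt Ln]

/-- The incidence graphs of a plane and of its dual are isomorphic. -/
def incidenceGraphDual : incidenceGraph Pt Ln ≃g incidenceGraph (Dual Ln) (Dual Pt) where
  toEquiv := Equiv.sumComm Pt Ln
  map_rel_iff' := by
    rintro (p | l) (p' | l') <;> exact Iff.rfl

theorem SimpleGraph.Iso.dist_apply {V W : Type*} {G : SimpleGraph V} {H : SimpleGraph W}
    (φ : G ≃g H) (hG : G.Connected) (x y : V) : H.dist (φ x) (φ y) = G.dist x y := by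
  have hH : H.Connected := φ.connected_iff.1 hG
  apply le_antisymm
  · obtain ⟨w, hw⟩ := hG.exists_walk_length_eq_dist x y
    rw [← hw, ← w.length_map φ.toHom]
    exact SimpleGraph.dist_le _
  · obtain ⟨w, hw⟩ := hH.exists_walk_length_eq_dist (φ x) (φ y)
    rw [← hw, ← w.length_map φ.symm.toHom]
    have := SimpleGraph.dist_le (w.map φ.symm.toHom)
    simpa using this

theorem dist_line_point (x : Pt) (l : Ln) :
    (incidenceGraph Pt Ln).dist (Sum.inr l) (Sum.inl x) =
      (incidenceGraph Pt Ln).dist (Sum.inl x) (Sum.inr l) := SimpleGraph.dist_comm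

variable [ProjectivePlane Pt Ln]

theorem exists_walk_point_point (x y : Pt) :
    ∃ w : (incidenceGraph Pt Ln).Walk (Sum.inl x) (Sum.inl y), w.length = 2 := by
  obtain ⟨l, hx, hy⟩ := exists_line_through Ln x y
  have h1 : (incidenceGraph Pt Ln).Adj (Sum.inl x) (Sum.inr l) := hx
  have h2 : (incidenceGraph Pt Ln).Adj (Sum.inr l) (Sum.inl y) := hy
  exact ⟨.cons h1 (.cons h2 .nil), rfl⟩

theorem exists_walk_point_line (x : Pt) (l : Ln) :
    ∃ w : (incidenceGraph Pt Ln).Walk (Sum.inl x) (Sum.inr l), w.length = 3 := by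
  obtain ⟨y, hy, -⟩ := exists_point_on Pt l l
  obtain ⟨w, hw⟩ := exists_walk_point_point (Ln := Ln) x y
  have h1 : (incidenceGraph Pt Ln).Adj (Sum.inl y) (Sum.inr l) := hy
  exact ⟨w.concat h1, by simp [hw]⟩

theorem incidenceGraph_connected : (incidenceGraph Pt Ln).Connected := by
  have h1 : ∀ (x : Pt) (v : Pt ⊕ Ln), (incidenceGraph Pt Ln).Reachable (Sum.inl x) v := by
    rintro x (y | l)
    · exact ⟨(exists_walk_point_point x y).choose⟩
    · exact ⟨(exists_walk_point_line x l).choose⟩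
  obtain ⟨x, -⟩ := @ProjectivePlane.exists_config Pt Ln _ _
  exact { preconnected := fun u v => (h1 x u).symm.trans (h1 x v), nonempty := ⟨Sum.inl x⟩ }

theorem dist_point_point {x y : Pt} (h : x ≠ y) :
    (incidenceGraph Pt Ln).dist (Sum.inl x) (Sum.inl y) = 2 := by
  obtain ⟨w, hw⟩ := exists_walk_point_point (Ln := Ln) x y
  have h2 := hw ▸ SimpleGraph.dist_le w
  have h0 : (incidenceGraph Pt Ln).dist (Sum.inl x) (Sum.inl y) ≠ 0 := fun h0 =>
    h (Sum.inl_injective ((incidenceGraph_connected.dist_eq_zero_iff).1 h0))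
  have h1 : (incidenceGraph Pt Ln).dist (Sum.inl x) (Sum.inl y) ≠ 1 := fun h1 =>
    (SimpleGraph.dist_eq_one_iff_adj.1 h1 : False)
  omega

open scoped Classical in
theorem dist_point_line (x : Pt) (l : Ln) :
    (incidenceGraph Pt Ln).dist (Sum.inl x) (Sum.inr l) = if x ∈ l then 1 else 3 := by
  split_ifs with h
  · exact SimpleGraph.dist_eq_one_iff_adj.2 h
  obtain ⟨w, hw⟩ := exists_walk_point_line x l
  have h3 := hw ▸ SimpleGraph.dist_le w
  obtain ⟨w, hw⟩ := incidenceGraph_connected.exists_walk_length_eq_dist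
    (Sum.inl x : Pt ⊕ Ln) (Sum.inr l)
  rw [← hw] at h3 ⊢
  -- a walk from a point to a line has odd length, and length one means incidence
  match w with
  | .cons h1 .nil => exact absurd h1 h
  | .cons (v := Sum.inl _) h1 (.cons h2 .nil) => exact absurd h1 id
  | .cons (v := Sum.inr _) h1 (.cons h2 .nil) => exact absurd h2 id
  | .cons h1 (.cons h2 (.cons h5 .nil)) => rfl
  | .cons h1 (.cons h2 (.cons h5 (.cons h4 w))) =>
    have : (SimpleGraph.Walk.cons h1 (.cons h2 (.cons h5 (.cons h4 w)))).length =
      w.length + 4 := rfl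
    omega

theorem dist_line_line {l m : Ln} (h : l ≠ m) :
    (incidenceGraph Pt Ln).dist (Sum.inr l) (Sum.inr m) = 2 := by
  rw [← incidenceGraphDual.dist_apply incidenceGraph_connected]
  exact dist_point_point (Pt := Dual Ln) (Ln := Dual Pt) h

/-- Points and lines are told apart by the parity of their distances, so only pairs of points and
pairs of lines have to be considered. -/
theorem isResolvingSet_iff (S : Set (Pt ⊕ Ln)) :
    IsResolvingSet (incidenceGraph Pt Ln) S ↔ Separates (pointPart S) (linePart S) := by
  classical
  have hpp : ∀ x : Pt, (incidenceGraph Pt Ln).dist (Sum.inl x) (Sum.inl x) = 0 := fun x =>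
    SimpleGraph.dist_self
  have hll : ∀ l : Ln, (incidenceGraph Pt Ln).dist (Sum.inr l) (Sum.inr l) = 0 := fun x =>
    SimpleGraph.dist_self
  constructor
  · refine fun h => ⟨fun l m hl hm hlm => Sum.inr_injective (h _ _ ?_),
      fun x y hx hy hxy => Sum.inl_injective (h _ _ ?_)⟩
    · rintro (z | n) hs
      · simp only [dist_line_point, dist_point_line, hlm z hs]
      · rw [dist_line_line (by rintro rfl; exact hl hs),
          dist_line_line (by rintro rfl; exact hm hs)]
    · rintro (z | n) hs
      · rw [dist_point_point (by rintro rfl; exact hx hs),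
          dist_point_point (by rintro rfl; exact hy hs)]
      · simp only [dist_point_line, hxy n hs]
  · rintro ⟨hL, hP⟩
    have key : ∀ (x : Pt) (l : Ln),
        ¬ ∀ s ∈ S, (incidenceGraph Pt Ln).dist (Sum.inl x) s =
          (incidenceGraph Pt Ln).dist (Sum.inr l) s := by
      intro x l h
      have hS : ∀ s, s ∉ S := by
        rintro (z | n) hs
        · have := h _ hs
          rw [dist_line_point, dist_point_line] at this
          by_cases hxz : x = z
          · subst hxz
            rw [hpp] at this
            split_ifs at this
          · rw [dist_point_point hxz] at this
            split_ifs at this <;> omega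
        · have := h _ hs
          rw [dist_point_line] at this
          by_cases hln : l = n
          · subst hln
            rw [hll] at this
            split_ifs at this
          · rw [dist_line_line hln] at this
            split_ifs at this <;> omega
      -- if `S` is empty then all points coincide
      obtain ⟨p₁, p₂, -, l₁, l₂, -, h₁, -, -, h₂, -⟩ := @ProjectivePlane.exists_config Pt Ln _ _
      have := hP p₁ p₂ (hS _) (hS _) fun n hn => (hS _ hn).elim
      exact h₁ (this ▸ h₂)
    rintro (x | l) (y | m) h
    · congr 1
      by_contra hxy
      refine hxy (hP x y ?_ ?_ ?_)
      · intro hx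
        have := h _ hx
        rw [hpp, dist_point_point (Ne.symm hxy)] at this
        omega
      · intro hy
        have := h _ hy
        rw [hpp, dist_point_point hxy] at this
        omega
      · intro n hn
        have := h _ hn
        rw [dist_point_line, dist_point_line] at this
        split_ifs at this <;> simp_all
    · exact (key x m h).elim
    · exact (key y l fun s hs => (h s hs).symm).elim
    · congr 1
      by_contra hlm
      refine hlm (hL l m ?_ ?_ ?_)
      · intro hl
        have := h _ hl
        rw [hll, dist_line_line (Ne.symm hlm)] at this
        omega
      · intro hm
        have := h _ hm
        rw [hll, dist_line_line hlm] at this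
        omega
      · intro z hz
        have := h _ hz
        rw [dist_line_point, dist_line_point, dist_point_line, dist_point_line] at this
        split_ifs at this <;> simp_all

end Distance

/-! ### Counting incidences -/

section Counting

open Finset
open scoped Classical

variable {Pt Ln : Type*} [Membership Pt Ln]

/-- The lines through a point. -/
noncomputable def pencil (Ln : Type*) [Membership Pt Ln] [Fintype Ln] (x : Pt) : Finset Ln :=
  {l | x ∈ l}

/-- The points of a line. -/
noncomputable def pointsOn (Pt : Type*) [Membership Pt Ln] [Fintype Pt] (l : Ln) : Finset Pt :=
  {x | x ∈ l}

/-- The number of points of `A` on the line `l`. -/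
noncomputable def deg (A : Finset Pt) (l : Ln) : ℕ := #{x ∈ A | x ∈ l}

@[simp] theorem mem_pencil [Fintype Ln] {x : Pt} {l : Ln} : l ∈ pencil Ln x ↔ x ∈ l := by
  simp [pencil]

@[simp] theorem mem_pointsOn [Fintype Pt] {x : Pt} {l : Ln} : x ∈ pointsOn Pt l ↔ x ∈ l := by
  simp [pointsOn]

theorem deg_eq_zero {A : Finset Pt} {l : Ln} : deg A l = 0 ↔ ∀ x ∈ A, x ∉ l := by
  simp [deg, Finset.filter_eq_empty_iff]

theorem deg_eq_one {A : Finset Pt} {l : Ln} :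
    deg A l = 1 ↔ ∃ x ∈ A, x ∈ l ∧ ∀ y ∈ A, y ∈ l → y = x := by
  rw [deg, Finset.card_eq_one]
  constructor
  · rintro ⟨x, hx⟩
    have h1 : x ∈ ({x ∈ A | x ∈ l} : Finset Pt) := by simp [hx]
    simp only [Finset.mem_filter] at h1
    refine ⟨x, h1.1, h1.2, fun y hy hyl => ?_⟩
    have h2 : y ∈ ({x ∈ A | x ∈ l} : Finset Pt) := by simp [hy, hyl]
    simpa [hx] using h2
  · rintro ⟨x, hx, hxl, h⟩
    refine ⟨x, ?_⟩
    ext y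
    simp only [Finset.mem_filter, Finset.mem_singleton]
    exact ⟨fun hy => h y hy.1 hy.2, fun hy => hy ▸ ⟨hx, hxl⟩⟩

/-- Lines outside `B` that are tangent to `A` have different points of contact. -/
theorem SeparatesLines.card_tangents_le {A : Finset Pt} {B : Finset Ln}
    (h : SeparatesLines (A : Set Pt) (B : Set Ln)) (A₀ : Finset Pt) (N : Finset Ln)
    (hN : ∀ m ∈ N, m ∉ B ∧ deg A m = 1 ∧ ∃ x ∈ A₀, x ∈ A ∧ x ∈ m) : #N ≤ #A₀ := by
  refine card_le_card_of_forall_subsingleton (fun m x => x ∈ A ∧ x ∈ m) (fun m hm => ?_) ?_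
  · obtain ⟨-, -, x, h1, h2⟩ := hN m hm
    exact ⟨x, h1, h2⟩
  · rintro x - m ⟨hm, hxA, hxm⟩ m' ⟨hm', -, hxm'⟩
    obtain ⟨hB, h1, -⟩ := hN m hm
    obtain ⟨hB', h1', -⟩ := hN m' hm'
    obtain ⟨y, hy, hym, hu⟩ := deg_eq_one.1 h1
    obtain ⟨y', hy', hym', hu'⟩ := deg_eq_one.1 h1'
    refine h m m' (by simpa using hB) (by simpa using hB') fun z hz => ?_
    have e1 := hu x hxA hxm
    have e2 := hu' x hxA hxm'
    exact ⟨fun hzm => by rw [hu z hz hzm, ← e1]; exact hxm',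
      fun hzm => by rw [hu' z hz hzm, ← e2]; exact hxm⟩

/-- The basic estimate for a separating pair. Outside `B` there is at most one line without points
of `A`, and at most one tangent at each point of `A`. So a function that is positive only on
lines of `B`, on lines without points of `A` and on tangents at points of `A₀` has a small sum. -/
theorem SeparatesLines.sum_le {A : Finset Pt} {B : Finset Ln}
    (h : SeparatesLines (A : Set Pt) (B : Set Ln)) (A₀ : Finset Pt) (N : Finset Ln) (f : Ln → ℤ)
    (b s t : ℤ) (hs : 0 ≤ s) (ht : 0 ≤ t)
    (hB : ∀ m ∈ N, m ∈ B → f m ≤ b) (h0 : ∀ m ∈ N, m ∉ B → deg A m = 0 → f m ≤ s)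
    (h1 : ∀ m ∈ N, m ∉ B → deg A m = 1 → ∀ x ∈ A, x ∈ m → f m ≤ if x ∈ A₀ then t else 0)
    (h2 : ∀ m ∈ N, m ∉ B → 2 ≤ deg A m → f m ≤ 0) :
    ∑ m ∈ N, f m ≤ b * #{m ∈ N | m ∈ B} + s + t * #A₀ := by
  have hsk : #{m ∈ N | m ∉ B ∧ deg A m = 0} ≤ 1 := by
    rw [card_le_one]
    simp only [mem_filter, deg_eq_zero]
    rintro m ⟨-, hm, hmA⟩ m' ⟨-, hm', hmA'⟩
    exact h m m' (by simpa using hm) (by simpa using hm') fun x hx =>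
      ⟨fun hh => (hmA x hx hh).elim, fun hh => (hmA' x hx hh).elim⟩
  have htg : #{m ∈ N | m ∉ B ∧ deg A m = 1 ∧ ∃ x ∈ A₀, x ∈ A ∧ x ∈ m} ≤ #A₀ :=
    h.card_tangents_le A₀ _ fun m hm => (mem_filter.1 hm).2
  have hpt : ∀ m ∈ N, f m ≤ (if m ∈ B then b else 0) + (if m ∉ B ∧ deg A m = 0 then s else 0) +
      (if m ∉ B ∧ deg A m = 1 ∧ ∃ x ∈ A₀, x ∈ A ∧ x ∈ m then t else 0) := by
    intro m hm
    have hs' : 0 ≤ (if m ∉ B ∧ deg A m = 0 then s else 0) := by split_ifs <;> simp [hs]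
    have ht' : 0 ≤ (if m ∉ B ∧ deg A m = 1 ∧ ∃ x ∈ A₀, x ∈ A ∧ x ∈ m then t else 0) := by
      split_ifs <;> simp [ht]
    by_cases hmB : m ∈ B
    · have := hB m hm hmB
      rw [if_pos hmB]
      linarith
    rw [if_neg hmB]
    rcases Nat.lt_or_ge (deg A m) 2 with hd | hd
    · interval_cases hd' : deg A m
      · rw [if_pos ⟨hmB, rfl⟩]
        have := h0 m hm hmB hd'
        linarith
      · obtain ⟨x, hxA, hxm, -⟩ := deg_eq_one.1 hd'
        have := h1 m hm hmB hd' x hxA hxm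
        split_ifs at this with hx
        · rw [if_neg (by simp), if_pos ⟨hmB, rfl, x, hx, hxA, hxm⟩]
          linarith
        · linarith
    · have := h2 m hm hmB hd
      linarith
  refine (sum_le_sum hpt).trans ?_
  rw [sum_add_distrib, sum_add_distrib, ← sum_filter, ← sum_filter, ← sum_filter]
  simp only [sum_const, nsmul_eq_mul]
  have a1 : (#{m ∈ N | m ∉ B ∧ deg A m = 0} : ℤ) ≤ 1 := by exact_mod_cast hsk
  have a2 : (#{m ∈ N | m ∉ B ∧ deg A m = 1 ∧ ∃ x ∈ A₀, x ∈ A ∧ x ∈ m} : ℤ) ≤ #A₀ := by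
    exact_mod_cast htg
  nlinarith [mul_le_mul_of_nonneg_right a1 hs, mul_le_mul_of_nonneg_right a2 ht]

variable [Fintype Pt] [Fintype Ln] [ProjectivePlane Pt Ln]

local notation "q" => ProjectivePlane.order Pt Ln

theorem card_pencil (x : Pt) : #(pencil Ln x) = q + 1 := by
  rw [← ProjectivePlane.lineCount_eq Ln x, lineCount, Nat.card_eq_fintype_card,
    Fintype.card_subtype, pencil]

theorem card_pointsOn (l : Ln) : #(pointsOn Pt l) = q + 1 := by
  rw [← ProjectivePlane.pointCount_eq Pt l, pointCount, Nat.card_eq_fintype_card,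
    Fintype.card_subtype, pointsOn]

omit [Fintype Pt] in
theorem card_pencil_filter {x y : Pt} (h : x ≠ y) : #{l ∈ pencil Ln x | y ∈ l} = 1 := by
  rw [card_eq_one]
  refine ⟨mkLine h, ?_⟩
  ext l
  simp only [mem_filter, mem_pencil, mem_singleton]
  refine ⟨fun hl => line_unique h hl.1 hl.2 (mkLine_ax h).1 (mkLine_ax h).2, ?_⟩
  rintro rfl
  exact mkLine_ax h

/-- Every point of `A` other than `x` lies on exactly one line through `x`. -/
theorem sum_deg_pencil (A : Finset Pt) (x : Pt) :
    ∑ l ∈ pencil Ln x, deg A l = #A + if x ∈ A then q else 0 := by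
  simp only [deg, card_filter]
  rw [sum_comm]
  simp only [← card_filter]
  by_cases hx : x ∈ A
  · rw [← add_sum_erase A _ hx, if_pos hx, sum_congr rfl (g := fun _ => 1)
      (fun y hy => card_pencil_filter (ne_of_mem_erase hy).symm)]
    have h1 : ({l ∈ pencil Ln x | x ∈ l} : Finset Ln) = pencil Ln x := by ext; simp
    rw [h1, card_pencil, sum_const, card_erase_of_mem hx]
    have := card_pos.2 ⟨x, hx⟩
    simp only [smul_eq_mul, mul_one]
    omega
  · rw [if_neg hx, sum_congr rfl (g := fun _ => 1) (fun y hy => card_pencil_filter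
      (by rintro rfl; exact hx hy))]
    simp

theorem sum_deg (A : Finset Pt) : ∑ l : Ln, deg A l = #A * (q + 1) := by
  simp only [deg, card_filter]
  rw [sum_comm]
  simp only [← card_filter]
  exact (sum_congr rfl (fun x _ => card_pencil (Ln := Ln) x)).trans (by simp)

theorem sum_deg_mul_deg (A : Finset Pt) : ∑ l : Ln, deg A l * deg A l = #A * (#A + q) := by
  have h : ∀ l : Ln, deg A l * deg A l = ∑ x ∈ A, if x ∈ l then deg A l else 0 := fun l => by
    rw [← sum_filter, sum_const, smul_eq_mul, deg]
  simp only [h]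
  rw [sum_comm]
  have h2 : ∀ x ∈ A, ∑ l : Ln, (if x ∈ l then deg A l else 0) = #A + q := fun x hx => by
    rw [← sum_filter]
    have := sum_deg_pencil (Ln := Ln) A x
    rwa [if_pos hx] at this
  rw [sum_congr rfl h2, sum_const, smul_eq_mul]

theorem card_lines' : Fintype.card Ln = q ^ 2 + q + 1 := ProjectivePlane.card_lines Pt Ln

end Counting

/-! ### Long lines -/

section LongLines

open Finset
open scoped Classical

variable {Pt Ln : Type*} [Membership Pt Ln] [Fintype Pt] [Fintype Ln] [ProjectivePlane Pt Ln]

local notation "q" => ProjectivePlane.order Pt Ln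

variable {A : Finset Pt} {B : Finset Ln}

/-- Counting the points of `A` on the lines that meet `l` outside `A`. -/
theorem SeparatesLines.deg_inequality (h : SeparatesLines (A : Set Pt) (B : Set Ln)) (l : Ln) :
    2 * (q : ℤ) * (q + 1 - deg A l) ≤
      (q + 1 - deg A l) * (#A - deg A l) + 2 * #B + (#A - deg A l) + 2 := by
  -- `sum_le` is applied to the weight `2 - d` on the lines `M`, other than `l`, through the
  -- points `Y` of `l` outside `A`
  set Y : Finset Pt := {x ∈ pointsOn Pt l | x ∉ A} with hY
  have hdegl : deg A l = #{x ∈ pointsOn Pt l | x ∈ A} := by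
    rw [deg]; congr 1; ext x; simp [and_comm]
  have hYc : (#Y : ℤ) = q + 1 - deg A l := by
    have h2 : #{x ∈ pointsOn Pt l | x ∈ A} + #Y = #(pointsOn Pt l) := by
      convert card_filter_add_card_filter_not (s := pointsOn Pt l) (fun x => x ∈ A)
    rw [card_pointsOn, ← hdegl] at h2
    omega
  have hdisj : (Y : Set Pt).PairwiseDisjoint (fun Z => (pencil Ln Z).erase l) := by
    intro x hx y hy hxy
    rw [Function.onFun, Finset.disjoint_left]
    intro m hm hm'
    simp only [mem_erase, mem_pencil, hY, coe_filter, Set.mem_ofPred_eq, mem_pointsOn] at *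
    exact hm.1 (line_unique hxy hm.2 hm'.2 hx.1 hy.1)
  set M := Y.biUnion (fun Z => (pencil Ln Z).erase l) with hM
  have hMc : (#M : ℤ) = (q + 1 - deg A l) * q := by
    rw [hM, card_biUnion hdisj, sum_congr rfl (g := fun _ => q), sum_const, smul_eq_mul, ← hYc]
    · push_cast; ring
    · intro x hx
      rw [card_erase_of_mem, card_pencil]
      · rfl
      · simp only [hY, mem_filter, mem_pointsOn] at hx
        simpa using hx.1
  have hMs : ∑ m ∈ M, (deg A m : ℤ) = (q + 1 - deg A l) * (#A - deg A l) := by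
    rw [hM, sum_biUnion hdisj, sum_congr rfl (g := fun _ => (#A - deg A l : ℤ)), sum_const,
      ← hYc, nsmul_eq_mul]
    intro x hx
    simp only [hY, mem_filter, mem_pointsOn] at hx
    have h1 := sum_deg_pencil (Ln := Ln) A x
    rw [if_neg hx.2, ← add_sum_erase (pencil Ln x) _ (mem_pencil.2 hx.1)] at h1
    zify at h1
    linarith
  have key := h.sum_le {x ∈ A | x ∉ l} M (fun m => 2 - deg A m) 2 2 1 (by norm_num) (by norm_num)
    (fun m _ _ => by simp) (fun m _ _ hm => by simp [hm]) ?_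
    (fun m _ _ hm => by omega)
  · have hc : (#({x ∈ A | x ∉ l} : Finset Pt) : ℤ) = #A - deg A l := by
      have := card_filter_add_card_filter_not (s := A) (fun x => x ∈ l)
      rw [deg]
      push_cast [← this]
      ring
    have hMB : (#{m ∈ M | m ∈ B} : ℤ) ≤ #B := by
      exact_mod_cast card_le_card fun m hm => (mem_filter.1 hm).2
    rw [hc, sum_sub_distrib, hMs, sum_const, nsmul_eq_mul, hMc] at key
    linarith
  · intro m hm _ hd x hxA hxm
    rw [if_pos, hd]
    · norm_num
    · refine mem_filter.2 ⟨hxA, fun hxl => ?_⟩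
      obtain ⟨y, hy, hym⟩ := mem_biUnion.1 hm
      simp only [hY, mem_filter, mem_pointsOn, mem_erase, mem_pencil] at hy hym
      exact hy.2 (point_unique hym.1 hxm hxl hym.2 hy.1 ▸ hxA)

/-- If `A` is the smaller part of a separating pair of size at most `4q - 4`, then a line has at
most `4` or at least `q - 4` points of `A`. -/
theorem SeparatesLines.short_or_long (h : SeparatesLines (A : Set Pt) (B : Set Ln))
    (hq : 23 ≤ q) (hA : #A + 2 ≤ 2 * q) (hAB : #A + #B + 4 ≤ 4 * q) (l : Ln) :
    deg A l ≤ 4 ∨ q ≤ deg A l + 4 := by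
  by_contra! hx
  have key := h.deg_inequality l
  obtain ⟨x, hx'⟩ : ∃ x : ℤ, x = deg A l := ⟨_, rfl⟩
  obtain ⟨n, hn⟩ : ∃ n : ℤ, n = q := ⟨_, rfl⟩
  obtain ⟨p, hp⟩ : ∃ p : ℤ, p = #A := ⟨_, rfl⟩
  have h1 : 5 ≤ x := by omega
  have h2 : x + 5 ≤ n := by omega
  have h3 : p + 2 ≤ 2 * n := by omega
  have h4 : p + #B + 4 ≤ 4 * n := by omega
  have h5 : 23 ≤ n := by omega
  rw [← hx', ← hn, ← hp] at key
  nlinarith [mul_nonneg (sub_nonneg.2 h1) (sub_nonneg.2 h2),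
    mul_nonneg (sub_nonneg.2 h3) (sub_nonneg.2 h2)]

theorem SeparatesLines.exists_long (h : SeparatesLines (A : Set Pt) (B : Set Ln))
    (hq : 23 ≤ q) (hA : #A + 2 ≤ 2 * q) (hAB : #A + #B + 4 ≤ 4 * q) :
    ∃ e : Ln, q ≤ deg A e + 4 := by
  by_contra! hno
  have hsmall : ∀ l : Ln, deg A l ≤ 4 := fun l =>
    (h.short_or_long hq hA hAB l).resolve_right (by have := hno l; omega)
  -- the weight `(d - 2) * (d - 4)` is nonpositive for `2 ≤ d ≤ 4`, and `8` and `3` for `d = 0, 1`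
  have key := h.sum_le A univ (fun m => ((deg A m : ℤ) - 2) * (deg A m - 4)) 8 8 3
    (by norm_num) (by norm_num)
    (fun m _ _ => by have := hsmall m; nlinarith)
    (fun m _ _ hm => by simp [hm]) (fun m _ _ hm x hx _ => by rw [if_pos hx, hm]; norm_num)
    (fun m _ _ hm => by have := hsmall m; nlinarith)
  have e1 : ∑ m : Ln, ((deg A m : ℤ) - 2) * (deg A m - 4) =
      ∑ m : Ln, ((deg A m * deg A m : ℕ) : ℤ) - 6 * ∑ m : Ln, (deg A m : ℤ) +
        8 * (Fintype.card Ln : ℤ) := by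
    rw [mul_sum, ← sum_sub_distrib, ← card_univ, card_eq_sum_ones, Nat.cast_sum, mul_sum,
      ← sum_add_distrib]
    refine sum_congr rfl fun m _ => ?_
    push_cast
    ring
  have hMB : (#{m ∈ (univ : Finset Ln) | m ∈ B} : ℤ) ≤ #B := by
    exact_mod_cast card_le_card fun m hm => (mem_filter.1 hm).2
  rw [e1, ← Nat.cast_sum, ← Nat.cast_sum, sum_deg, sum_deg_mul_deg, card_lines' (Pt := Pt)] at key
  obtain ⟨n, hn⟩ : ∃ n : ℤ, n = q := ⟨_, rfl⟩
  obtain ⟨p, hp⟩ : ∃ p : ℤ, p = #A := ⟨_, rfl⟩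
  have h3 : p + 2 ≤ 2 * n := by omega
  have h4 : p + #B + 4 ≤ 4 * n := by omega
  have h5 : 23 ≤ n := by omega
  push_cast at key
  rw [← hn, ← hp] at key
  have h6 : 0 ≤ p := by omega
  nlinarith [mul_nonneg (sub_nonneg.2 h3) (sub_nonneg.2 h5), mul_nonneg (sub_nonneg.2 h3) h6,
    mul_nonneg (sub_nonneg.2 h3) (sub_nonneg.2 h3)]

omit [Fintype Pt] [Fintype Ln] in
theorem deg_le_deg_filter (A : Finset Pt) {e l : Ln} (hl : l ≠ e) :
    deg A l ≤ deg {x ∈ A | x ∉ e} l + 1 := by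
  have h1 := card_filter_add_card_filter_not (s := ({x ∈ A | x ∈ l} : Finset Pt)) (fun x => x ∈ e)
  have h2 : #{x ∈ ({x ∈ A | x ∈ l} : Finset Pt) | x ∈ e} ≤ 1 := by
    rw [card_le_one]
    simp only [mem_filter]
    exact fun x hx y hy => point_unique hl hx.1.2 hx.2 hy.1.2 hy.2
  have h3 : ({x ∈ ({x ∈ A | x ∈ l} : Finset Pt) | x ∉ e} : Finset Pt) =
      {x ∈ ({x ∈ A | x ∉ e} : Finset Pt) | x ∈ l} := by
    ext x; simp only [mem_filter]; tauto
  rw [h3] at h1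
  unfold deg
  omega

omit [Fintype Pt] [ProjectivePlane Pt Ln] in
theorem sum_erase_deg {C : Finset Pt} {e : Ln} (hCe : deg C e = 0) :
    ∑ m ∈ univ.erase e, ((deg C m : ℤ) - 1) * (deg C m - 4) =
      ∑ m : Ln, ((deg C m * deg C m : ℕ) : ℤ) - 5 * ∑ m : Ln, (deg C m : ℤ) +
        4 * (Fintype.card Ln : ℤ) - 4 := by
  have := add_sum_erase univ (fun m : Ln => ((deg C m : ℤ) - 1) * (deg C m - 4)) (mem_univ e)
  simp only [hCe] at this
  rw [mul_sum, ← sum_sub_distrib, ← card_univ, card_eq_sum_ones, Nat.cast_sum, mul_sum,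
    ← sum_add_distrib, eq_sub_iff_add_eq, ← sub_eq_zero]
  have e2 : ∀ m : Ln, ((deg C m * deg C m : ℕ) : ℤ) - 5 * (deg C m : ℤ) + 4 * ((1 : ℕ) : ℤ) =
      ((deg C m : ℤ) - 1) * (deg C m - 4) := fun m => by push_cast; ring
  rw [sum_congr rfl fun m _ => e2 m]
  push_cast at this
  linarith

theorem sub_one_mul_sub_four_le_four {d : ℕ} (h : d ≤ 4) : ((d : ℤ) - 1) * (d - 4) ≤ 4 := by
  interval_cases d <;> norm_num

theorem sub_one_mul_sub_four_nonpos {d : ℕ} (h : d ≤ 4) (h1 : 1 ≤ d) :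
    ((d : ℤ) - 1) * (d - 4) ≤ 0 := by
  interval_cases d <;> norm_num

/-- Once `e` is long, the points of `A` off `e` are about `q` in number and have to meet almost all
lines, which forces a second long line. -/
theorem SeparatesLines.exists_long_ne (h : SeparatesLines (A : Set Pt) (B : Set Ln))
    (hq : 23 ≤ q) (hA : #A + 2 ≤ 2 * q) (hAB : #A + #B + 4 ≤ 4 * q) {e : Ln}
    (he : q ≤ deg A e + 4) : ∃ f : Ln, f ≠ e ∧ q ≤ deg A f + 4 := by
  by_contra! hno
  have hsmall : ∀ l : Ln, l ≠ e → deg A l ≤ 4 := fun l hl =>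
    (h.short_or_long hq hA hAB l).resolve_right (by have := hno l hl; omega)
  set C : Finset Pt := {x ∈ A | x ∉ e} with hC
  have hCA : ∀ l : Ln, deg C l ≤ deg A l := fun l =>
    card_le_card (filter_subset_filter _ (filter_subset _ _))
  have hCe : deg C e = 0 := by
    rw [deg_eq_zero]
    exact fun x hx => (mem_filter.1 hx).2
  have hCc : #C + deg A e = #A := by
    have := card_filter_add_card_filter_not (s := A) (fun x => x ∈ e)
    rw [deg, hC]
    omega
  have hlow : ∀ l : Ln, l ≠ e → deg A l ≤ deg C l + 1 := fun l hl => deg_le_deg_filter A hl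
  -- a tangent at a point off `e` has one point of `C`, so its weight `(d - 1) * (d - 4)` is zero
  have key := h.sum_le {x ∈ A | x ∈ e} (univ.erase e)
    (fun m => ((deg C m : ℤ) - 1) * (deg C m - 4)) 4 4 4
    (by norm_num) (by norm_num)
    (fun m hm _ =>
      sub_one_mul_sub_four_le_four ((hCA m).trans (hsmall m (ne_of_mem_erase hm))))
    (fun m _ _ hm => by
      have := hCA m
      simp [show deg C m = 0 by omega])
    (fun m hm _ hd x hx hxm => by
      by_cases hxe : x ∈ e
      · rw [if_pos (mem_filter.2 ⟨hx, hxe⟩)]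
        exact sub_one_mul_sub_four_le_four ((hCA m).trans (by omega))
      · rw [if_neg (by simp [hxe])]
        have h1 : deg C m ≠ 0 := fun h0 => deg_eq_zero.1 h0 x (mem_filter.2 ⟨hx, hxe⟩) hxm
        have := hCA m
        simp [show deg C m = 1 by omega])
    (fun m hm _ hd => by
      have h2 := hlow m (ne_of_mem_erase hm)
      exact sub_one_mul_sub_four_nonpos ((hCA m).trans (hsmall m (ne_of_mem_erase hm)))
        (by omega))
  have e1 := sum_erase_deg hCe
  have hMB : (#{m ∈ univ.erase e | m ∈ B} : ℤ) ≤ #B := by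
    exact_mod_cast card_le_card fun m hm => (mem_filter.1 hm).2
  rw [e1, ← Nat.cast_sum, ← Nat.cast_sum, sum_deg, sum_deg_mul_deg, card_lines' (Pt := Pt)] at key
  have hde : #{x ∈ A | x ∈ e} = deg A e := rfl
  rw [hde] at key
  obtain ⟨n, hn⟩ : ∃ n : ℤ, n = q := ⟨_, rfl⟩
  obtain ⟨y, hy⟩ : ∃ y : ℤ, y = #C := ⟨_, rfl⟩
  obtain ⟨x, hx⟩ : ∃ x : ℤ, x = deg A e := ⟨_, rfl⟩
  have h3 : y ≤ n + 2 := by omega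
  have h4 : x + y + #B + 4 ≤ 4 * n := by omega
  have h5 : 23 ≤ n := by omega
  push_cast at key
  rw [← hn, ← hx, ← hy] at key
  have a1 : 0 ≤ (n + 2 - y) * (3 * n - 1 - y) := mul_nonneg (by omega) (by omega)
  have a2 : 0 ≤ (n - 23) * n := mul_nonneg (by omega) (by omega)
  linarith

end LongLines

/-! ### The holes of two long lines -/

section Holes

open Finset
open scoped Classical

variable {Pt Ln : Type*} [Membership Pt Ln] [Fintype Pt] [Fintype Ln]

/-- The points of `l` other than `P` that are missing from `A`. -/
noncomputable def holes (A : Finset Pt) (l : Ln) (P : Pt) : Finset Pt :=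
  {x ∈ pointsOn Pt l | x ∉ A ∧ x ≠ P}

/-- The points of `A` on neither of the lines `e` and `f`. -/
noncomputable def offPoints (A : Finset Pt) (e f : Ln) : Finset Pt := {x ∈ A | x ∉ e ∧ x ∉ f}

omit [Fintype Ln] in
theorem mem_holes {A : Finset Pt} {l : Ln} {P x : Pt} :
    x ∈ holes A l P ↔ x ∈ l ∧ x ∉ A ∧ x ≠ P := by simp [holes]

omit [Fintype Pt] [Fintype Ln] in
theorem mem_offPoints {A : Finset Pt} {e f : Ln} {x : Pt} :
    x ∈ offPoints A e f ↔ x ∈ A ∧ x ∉ e ∧ x ∉ f := by simp [offPoints]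

omit [Fintype Pt] [Fintype Ln] in
theorem offPoints_comm (A : Finset Pt) (e f : Ln) : offPoints A e f = offPoints A f e := by
  ext x; simp only [mem_offPoints]; tauto

variable [ProjectivePlane Pt Ln]

local notation "q" => ProjectivePlane.order Pt Ln

variable {A : Finset Pt} {B : Finset Ln} {e f : Ln} {P : Pt}

theorem card_erase_pointsOn {l : Ln} (h : P ∈ l) : #((pointsOn Pt l).erase P) = q := by
  rw [card_erase_of_mem (mem_pointsOn.2 h), card_pointsOn]; rfl

theorem card_holes (A : Finset Pt) {l : Ln} (h : P ∈ l) :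
    #{x ∈ A | x ∈ l ∧ x ≠ P} + #(holes A l P) = q := by
  rw [← card_erase_pointsOn h, ← card_union_of_disjoint]
  · congr 1
    ext x
    simp only [mem_union, mem_filter, mem_holes, mem_erase, mem_pointsOn]
    tauto
  · rw [Finset.disjoint_left]
    intro x hx hx'
    exact (mem_holes.1 hx').2.1 (mem_filter.1 hx).1

omit [Fintype Pt] [Fintype Ln] [ProjectivePlane Pt Ln] in
theorem deg_eq_add (A : Finset Pt) {l : Ln} (h : P ∈ l) :
    deg A l = #{x ∈ A | x ∈ l ∧ x ≠ P} + if P ∈ A then 1 else 0 := by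
  rw [deg]
  split_ifs with hP
  · rw [← card_erase_add_one (a := P) (by simp [hP, h])]
    congr 2
    ext x
    simp only [mem_erase, mem_filter]
    tauto
  · congr 1
    ext x
    simp only [mem_filter]
    refine ⟨fun hx => ⟨hx.1, hx.2, ?_⟩, by tauto⟩
    rintro rfl
    exact hP hx.1

theorem card_add_holes (A : Finset Pt) (hef : e ≠ f) (he : P ∈ e) (hf : P ∈ f) :
    #A + #(holes A e P) + #(holes A f P) =
      2 * q + (if P ∈ A then 1 else 0) + #(offPoints A e f) := by
  have h1 := card_holes A he
  have h2 := card_holes A hf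
  have h3 : #A = deg A e + #{x ∈ A | x ∉ e} := by
    rw [deg, card_filter_add_card_filter_not]
  have h4 : #{x ∈ A | x ∉ e} = #{x ∈ A | x ∈ f ∧ x ≠ P} + #(offPoints A e f) := by
    rw [← card_union_of_disjoint]
    · congr 1
      ext x
      simp only [mem_union, mem_filter, mem_offPoints]
      constructor
      · rintro ⟨hA, hxe⟩
        by_cases hxf : x ∈ f
        · exact Or.inl ⟨hA, hxf, by rintro rfl; exact hxe he⟩
        · exact Or.inr ⟨hA, hxe, hxf⟩
      · rintro (⟨hA, hxf, hxP⟩ | ⟨hA, hxe, -⟩)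
        · exact ⟨hA, fun hxe => hxP (point_unique hef hxe hxf he hf)⟩
        · exact ⟨hA, hxe⟩
    · rw [Finset.disjoint_left]
      intro x hx hx'
      exact (mem_offPoints.1 hx').2.2 (mem_filter.1 hx).2.1
  rw [deg_eq_add A he] at h3
  omega

/-- A line joining two points; it is unique unless they are equal. -/
noncomputable def joinLine (Ln : Type*) [Membership Pt Ln] [ProjectivePlane Pt Ln]
    (x y : Pt) : Ln :=
  (exists_line_through Ln x y).choose

omit [Fintype Pt] [Fintype Ln] in
theorem left_mem_joinLine (x y : Pt) : x ∈ joinLine Ln x y :=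
  (exists_line_through Ln x y).choose_spec.1

omit [Fintype Pt] [Fintype Ln] in
theorem right_mem_joinLine (x y : Pt) : y ∈ joinLine Ln x y :=
  (exists_line_through Ln x y).choose_spec.2

omit [Fintype Pt] [Fintype Ln] in
theorem eq_joinLine {x y : Pt} (h : x ≠ y) {l : Ln} (hx : x ∈ l) (hy : y ∈ l) :
    l = joinLine Ln x y :=
  line_unique h hx hy (left_mem_joinLine x y) (right_mem_joinLine x y)

/-- The lines other than `e` and `f` that go through `P` or a hole. -/
noncomputable def holeLines (A : Finset Pt) (e f : Ln) (P : Pt) : Finset Ln :=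
  {m | m ≠ e ∧ m ≠ f ∧ (P ∈ m ∨ ∃ x ∈ holes A e P ∪ holes A f P, x ∈ m)}

/-- Each hole is on `q` lines other than the long ones, and a line that does not go through `P`
joins at most one hole of `e` to at most one hole of `f`. -/
theorem card_holeLines (A : Finset Pt) (hef : e ≠ f) (he : P ∈ e) (hf : P ∈ f) :
    q + (#(holes A e P) + #(holes A f P)) * q ≤
      #(holeLines A e f P) + 1 + #(holes A e P) * #(holes A f P) := by
  set K := holes A e P
  set M := holes A f P
  set E := (pointsOn Pt e).erase P with hE
  set F := (pointsOn Pt f).erase P with hF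
  have hKE : K ⊆ E := fun x hx =>
    mem_erase.2 ⟨(mem_holes.1 hx).2.2, mem_pointsOn.2 (mem_holes.1 hx).1⟩
  have hMF : M ⊆ F := fun x hx =>
    mem_erase.2 ⟨(mem_holes.1 hx).2.2, mem_pointsOn.2 (mem_holes.1 hx).1⟩
  have hEc : #E = q := card_erase_pointsOn he
  have hFc : #F = q := card_erase_pointsOn hf
  have hEF : ∀ x ∈ E, ∀ y ∈ F, x ∈ e ∧ x ∉ f ∧ y ∈ f ∧ y ∉ e ∧ x ≠ y ∧ P ∉ joinLine Ln x y := by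
    intro x hx y hy
    simp only [hE, hF, mem_erase, mem_pointsOn] at hx hy
    have hxf : x ∉ f := fun h => hx.1 (point_unique hef hx.2 h he hf)
    have hye : y ∉ e := fun h => hy.1 (point_unique hef h hy.2 he hf)
    refine ⟨hx.2, hxf, hy.2, hye, by rintro rfl; exact hxf hy.2, fun hP => hye ?_⟩
    rw [line_unique hx.1 hx.2 he (left_mem_joinLine x y) hP]
    exact right_mem_joinLine x y
  -- a line not through `P` is determined by its points on `e` and on `f`
  have hinj : Set.InjOn (fun z : Pt × Pt => joinLine Ln z.1 z.2) (E ×ˢ F : Finset (Pt × Pt)) := by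
    rintro ⟨x, y⟩ h ⟨x', y'⟩ h' hxy
    simp only [coe_product, Set.mem_prod, mem_coe] at h h'
    obtain ⟨a1, a2, a3, a4, a5, a6⟩ := hEF x h.1 y h.2
    obtain ⟨b1, b2, b3, b4, b5, b6⟩ := hEF x' h'.1 y' h'.2
    simp only at hxy
    have hne : joinLine Ln x y ≠ e := fun h => a4 (h ▸ right_mem_joinLine x y)
    have hnf : joinLine Ln x y ≠ f := fun h => a2 (h ▸ left_mem_joinLine x y)
    refine Prod.ext (point_unique hne (left_mem_joinLine x y) a1 ?_ b1)
      (point_unique hnf (right_mem_joinLine x y) a3 ?_ b3)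
    · rw [hxy]; exact left_mem_joinLine x' y'
    · rw [hxy]; exact right_mem_joinLine x' y'
  set D : Finset (Pt × Pt) := (E ×ˢ F) \ ((E \ K) ×ˢ (F \ M)) with hD
  have hDEF : D ⊆ E ×ˢ F := sdiff_subset
  have hDc : (#D : ℤ) = (#K + #M) * q - #K * #M := by
    rw [hD, card_sdiff_of_subset (product_subset_product sdiff_subset sdiff_subset),
      card_product, card_product, card_sdiff_of_subset hKE, card_sdiff_of_subset hMF, hEc, hFc]
    have h1 : #K ≤ q := hEc ▸ card_le_card hKE
    have h2 : #M ≤ q := hFc ▸ card_le_card hMF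
    rw [Nat.cast_sub (Nat.mul_le_mul (by omega) (by omega))]
    push_cast [h1, h2]
    ring
  have hI : #(D.image (fun z : Pt × Pt => joinLine Ln z.1 z.2)) = #D :=
    card_image_of_injOn (hinj.mono (by exact_mod_cast hDEF))
  have hPc : #(((pencil Ln P).erase e).erase f) + 1 = q := by
    rw [card_erase_of_mem, card_erase_of_mem, card_pencil]
    · have := ProjectivePlane.one_lt_order Pt Ln
      omega
    · simpa using he
    · simpa [hef.symm] using hf
  have hsub : ((pencil Ln P).erase e).erase f ∪
      D.image (fun z : Pt × Pt => joinLine Ln z.1 z.2) ⊆ holeLines A e f P := by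
    intro m hm
    simp only [holeLines, mem_filter, mem_univ, true_and]
    rcases mem_union.1 hm with hm | hm
    · simp only [mem_erase, mem_pencil] at hm
      exact ⟨hm.2.1, hm.1, Or.inl hm.2.2⟩
    · obtain ⟨⟨x, y⟩, hz, rfl⟩ := mem_image.1 hm
      have hz' := mem_product.1 (hDEF hz)
      obtain ⟨a1, a2, a3, a4, a5, a6⟩ := hEF x hz'.1 y hz'.2
      refine ⟨fun h => a4 (h ▸ right_mem_joinLine x y), fun h => a2 (h ▸ left_mem_joinLine x y),
        Or.inr ?_⟩
      simp only [hD, mem_sdiff, mem_product] at hz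
      by_cases hx : x ∈ K
      · exact ⟨x, mem_union_left _ hx, left_mem_joinLine x y⟩
      · refine ⟨y, mem_union_right _ ?_, right_mem_joinLine x y⟩
        tauto
  have hdisj : Disjoint (((pencil Ln P).erase e).erase f)
      (D.image (fun z : Pt × Pt => joinLine Ln z.1 z.2)) := by
    rw [Finset.disjoint_left]
    intro m hm hm'
    obtain ⟨⟨x, y⟩, hz, rfl⟩ := mem_image.1 hm'
    have hz' := mem_product.1 (hDEF hz)
    simp only [mem_erase, mem_pencil] at hm
    exact (hEF x hz'.1 y hz'.2).2.2.2.2.2 hm.2.2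
  have := card_le_card hsub
  rw [card_union_of_disjoint hdisj, hI] at this
  zify at this hPc ⊢
  linarith

/-- A point of `A` off `e` and `f` is on at most one line to each hole and to `P`. -/
theorem sum_deg_offPoints_le (A : Finset Pt) (he : P ∈ e) (hf : P ∈ f) :
    ∑ m ∈ holeLines A e f P, deg (offPoints A e f) m ≤
      #(offPoints A e f) * (#(holes A e P) + #(holes A f P) + 1) := by
  simp only [deg, card_filter]
  rw [sum_comm]
  simp only [← card_filter]
  refine (sum_le_card_nsmul _ _ (#(holes A e P) + #(holes A f P) + 1) fun z hz => ?_).trans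
    (by simp)
  have hz' := mem_offPoints.1 hz
  refine (card_le_card_of_forall_subsingleton (t := insert P (holes A e P ∪ holes A f P))
    (fun m x => x ∈ m) ?_ ?_).trans ((card_insert_le _ _).trans
      (Nat.add_le_add_right (card_union_le _ _) 1))
  · intro m hm
    simp only [holeLines, mem_filter, mem_univ, true_and] at hm
    rcases hm.1.2.2 with h | ⟨x, hx, hxm⟩
    · exact ⟨P, mem_insert_self _ _, h⟩
    · exact ⟨x, mem_insert_of_mem hx, hxm⟩
  · rintro x hx m ⟨hm, hxm⟩ m' ⟨hm', hxm'⟩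
    refine line_unique (x := x) (y := z) ?_ hxm (mem_filter.1 hm).2 hxm' (mem_filter.1 hm').2
    rintro rfl
    simp only [mem_insert, mem_union, mem_holes] at hx
    rcases hx with rfl | hx | hx
    · exact hz'.2.1 he
    · exact hz'.2.1 hx.1
    · exact hz'.2.2 hx.1

/-- Lines through `P` or a hole have few points of `A`, so most of them belong to `B`. -/
theorem SeparatesLines.hole_inequality (h : SeparatesLines (A : Set Pt) (B : Set Ln))
    (hef : e ≠ f) (he : P ∈ e) (hf : P ∈ f) :
    q + (#(holes A e P) + #(holes A f P)) * q ≤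
      #B + 2 + (if P ∈ A then 1 else 0) + #(holes A e P) * #(holes A f P) +
      (if #(holes A f P) = 0 then 0 else q - #(holes A e P)) +
      (if #(holes A e P) = 0 then 0 else q - #(holes A f P)) +
      #(offPoints A e f) * (#(holes A e P) + #(holes A f P) + 1) := by
  have h1 := card_holeLines A hef he hf
  have h2 := sum_deg_offPoints_le (Ln := Ln) A he hf
  have h3 := card_holes A he
  have h4 := card_holes A hf
  set W := offPoints A e f with hW
  set A₁ : Finset Pt := if P ∈ A then {P} else ∅ with hA₁
  set A₂ : Finset Pt := if #(holes A f P) = 0 then ∅ else {x ∈ A | x ∈ e ∧ x ≠ P} with hA₂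
  set A₃ : Finset Pt := if #(holes A e P) = 0 then ∅ else {x ∈ A | x ∈ f ∧ x ≠ P} with hA₃
  have c1 : #A₁ = if P ∈ A then 1 else 0 := by rw [hA₁]; split_ifs <;> simp
  have c2 : #A₂ = if #(holes A f P) = 0 then 0 else q - #(holes A e P) := by
    rw [hA₂]; split_ifs
    · simp
    · omega
  have c3 : #A₃ = if #(holes A e P) = 0 then 0 else q - #(holes A f P) := by
    rw [hA₃]; split_ifs
    · simp
    · omega
  have c4 : #(A₁ ∪ A₂ ∪ A₃) ≤ #A₁ + #A₂ + #A₃ :=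
    (card_union_le _ _).trans (Nat.add_le_add_right (card_union_le _ _) _)
  have key := h.sum_le (A₁ ∪ A₂ ∪ A₃) (holeLines A e f P) (fun m => 1 - (deg W m : ℤ)) 1 1 1
    (by norm_num) (by norm_num) (fun m _ _ => by simp) (fun m _ _ _ => by simp) ?_ ?_
  · have hMB : (#{m ∈ holeLines A e f P | m ∈ B} : ℤ) ≤ #B := by
      exact_mod_cast card_le_card fun m hm => (mem_filter.1 hm).2
    rw [sum_sub_distrib, sum_const, nsmul_eq_mul, ← Nat.cast_sum] at key
    rw [← c1, ← c2, ← c3]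
    zify at *
    linarith
  · intro m hm hmB hd x hxA hxm
    split_ifs with hx
    · simp
    by_cases hxW : x ∈ W
    · have : deg W m ≠ 0 := fun h0 => deg_eq_zero.1 h0 x hxW hxm
      omega
    · exfalso
      simp only [holeLines, mem_filter, mem_univ, true_and] at hm
      have hxef : x ∈ e ∨ x ∈ f := by
        by_contra! hh
        exact hxW (mem_offPoints.2 ⟨hxA, hh.1, hh.2⟩)
      simp only [mem_union, not_or] at hx
      have hxP : x ≠ P := by
        rintro rfl
        exact hx.1.1 (by simp [hA₁, hxA])
      rcases hxef with hxe | hxf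
      · have h0 : #(holes A f P) = 0 := by
          by_contra h0
          exact hx.1.2 (by simp [hA₂, h0, hxA, hxe, hxP])
        rw [card_eq_zero] at h0
        rw [h0, union_empty] at hm
        rcases hm.2.2 with hP | ⟨y, hy, hym⟩
        · exact hm.1 (line_unique hxP hxm hP hxe he)
        · have := mem_holes.1 hy
          exact hm.1 (line_unique (by rintro rfl; exact this.2.1 hxA) hxm hym hxe this.1)
      · have h0 : #(holes A e P) = 0 := by
          by_contra h0
          exact hx.2 (by simp [hA₃, h0, hxA, hxf, hxP])
        rw [card_eq_zero] at h0
        rw [h0, empty_union] at hm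
        rcases hm.2.2 with hP | ⟨y, hy, hym⟩
        · exact hm.2.1 (line_unique hxP hxm hP hxf hf)
        · have := mem_holes.1 hy
          exact hm.2.1 (line_unique (by rintro rfl; exact this.2.1 hxA) hxm hym hxf this.1)
  · intro m hm hmB hd
    -- such a line has at most one point of `A` on `e` and `f` together
    have : deg W m ≠ 0 := by
      intro h0
      rw [deg_eq_zero] at h0
      simp only [holeLines, mem_filter, mem_univ, true_and] at hm
      obtain ⟨x, hx, y, hy, hxy⟩ := one_lt_card.1 (show 1 < #{x ∈ A | x ∈ m} from hd)
      rw [mem_filter] at hx hy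
      have hef' : ∀ z ∈ A, z ∈ m → z ∈ e ∨ z ∈ f := fun z hz hzm => by
        by_contra! hh
        exact h0 z (mem_offPoints.2 ⟨hz, hh.1, hh.2⟩) hzm
      have hx' := hef' x hx.1 hx.2
      have hy' := hef' y hy.1 hy.2
      have ue : ∀ z w, z ∈ m → w ∈ m → z ∈ e → w ∈ e → z = w := fun z w a b c d =>
        point_unique hm.1 a c b d
      have uf : ∀ z w, z ∈ m → w ∈ m → z ∈ f → w ∈ f → z = w := fun z w a b c d =>
        point_unique hm.2.1 a c b d
      rcases hm.2.2 with hP | ⟨z, hz, hzm⟩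
      · have hx2 : x = P := hx'.elim (fun h => ue _ _ hx.2 hP h he) (fun h => uf _ _ hx.2 hP h hf)
        have hy2 : y = P := hy'.elim (fun h => ue _ _ hy.2 hP h he) (fun h => uf _ _ hy.2 hP h hf)
        exact hxy (hx2.trans hy2.symm)
      · have hzx : z ∉ A := by
          rcases mem_union.1 hz with h | h <;> exact (mem_holes.1 h).2.1
        rcases mem_union.1 hz with h | h
        · have hze := (mem_holes.1 h).1
          have hx2 : x ∈ f := hx'.resolve_left fun h => hzx (ue _ _ hx.2 hzm h hze ▸ hx.1)
          have hy2 : y ∈ f := hy'.resolve_left fun h => hzx (ue _ _ hy.2 hzm h hze ▸ hy.1)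
          exact hxy (uf _ _ hx.2 hy.2 hx2 hy2)
        · have hzf := (mem_holes.1 h).1
          have hx2 : x ∈ e := hx'.resolve_right fun h => hzx (uf _ _ hx.2 hzm h hzf ▸ hx.1)
          have hy2 : y ∈ e := hy'.resolve_right fun h => hzx (uf _ _ hy.2 hzm h hzf ▸ hy.1)
          exact hxy (ue _ _ hx.2 hy.2 hx2 hy2)
    omega

/-- The arithmetic behind the classification of the numbers `k`, `m` of holes on two long lines;
`c` tells whether their common point belongs to `A`, and `w` counts the points of `A` off them. -/
theorem hole_numbers {n p b k m c w : ℕ} (hn : 23 ≤ n) (hc : c ≤ 1) (hk : k ≤ 4 + c)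
    (hm : m ≤ 4 + c) (hsum : p + k + m = 2 * n + c + w) (hp : p + 2 ≤ 2 * n)
    (hpb : p + b + 4 ≤ 4 * n)
    (hmain : n + (k + m) * n ≤ b + 2 + c + k * m + (if m = 0 then 0 else n - k) +
      (if k = 0 then 0 else n - m) + w * (k + m + 1)) :
    w + c + 2 ≤ k + m ∧ (k = 1 ∧ m = 1 ∨ k = 2 ∧ m ≤ 1 ∨ k ≤ 1 ∧ m = 2) := by
  have hw : w + c + 2 ≤ k + m := by omega
  refine ⟨hw, ?_⟩
  have hk5 : k ≤ 5 := by omega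
  have hm5 : m ≤ 5 := by omega
  interval_cases k <;> interval_cases m <;> simp at hmain <;> omega

end Holes

/-! ### Finding the lines of the frame -/

section FindFrame

open Finset
open scoped Classical

variable {Pt Ln : Type*} [Membership Pt Ln] [Fintype Pt] [Fintype Ln] [ProjectivePlane Pt Ln]

local notation "q" => ProjectivePlane.order Pt Ln

variable {A : Finset Pt} {B : Finset Ln} {e f : Ln} {P : Pt}

/-- The number of lines of `B` through the point `x`. -/
noncomputable def codeg (B : Finset Ln) (x : Pt) : ℕ := #{l ∈ B | x ∈ l}

omit [Fintype Pt] [Fintype Ln] [ProjectivePlane Pt Ln] in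
/-- The dual of `SeparatesLines.sum_le`. -/
theorem SeparatesPoints.sum_le
    (h : SeparatesPoints (A : Set Pt) (B : Set Ln)) (B₀ : Finset Ln) (N : Finset Pt) (f : Pt → ℤ)
    (b s t : ℤ) (hs : 0 ≤ s) (ht : 0 ≤ t)
    (hB : ∀ m ∈ N, m ∈ A → f m ≤ b) (h0 : ∀ m ∈ N, m ∉ A → codeg B m = 0 → f m ≤ s)
    (h1 : ∀ m ∈ N, m ∉ A → codeg B m = 1 → ∀ x ∈ B, m ∈ x → f m ≤ if x ∈ B₀ then t else 0)
    (h2 : ∀ m ∈ N, m ∉ A → 2 ≤ codeg B m → f m ≤ 0) :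
    ∑ m ∈ N, f m ≤ b * #{m ∈ N | m ∈ A} + s + t * #B₀ :=
  SeparatesLines.sum_le (Pt := Dual Ln) (Ln := Dual Pt) (A := B) (B := A) h B₀ N f b s t hs ht
    hB h0 h1 h2

/-- The lines through `P`, other than `e` and `f`, that are missing from `B`. -/
noncomputable def missingLines (B : Finset Ln) (e f : Ln) (P : Pt) : Finset Ln :=
  {m ∈ pencil Ln P | m ≠ e ∧ m ≠ f ∧ m ∉ B}

/-- The lines of `B` through `P` other than `e` and `f`. -/
noncomputable def centralLines (B : Finset Ln) (e f : Ln) (P : Pt) : Finset Ln :=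
  {m ∈ pencil Ln P | m ≠ e ∧ m ≠ f ∧ m ∈ B}

omit [Fintype Pt] [ProjectivePlane Pt Ln] in
theorem mem_missingLines {m : Ln} :
    m ∈ missingLines B e f P ↔ P ∈ m ∧ m ≠ e ∧ m ≠ f ∧ m ∉ B := by simp [missingLines]

omit [Fintype Pt] [ProjectivePlane Pt Ln] in
theorem mem_centralLines {m : Ln} :
    m ∈ centralLines B e f P ↔ P ∈ m ∧ m ≠ e ∧ m ≠ f ∧ m ∈ B := by simp [centralLines]

theorem card_centralLines_add (B : Finset Ln) (hef : e ≠ f) (he : P ∈ e) (hf : P ∈ f) :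
    #(centralLines B e f P) + #(missingLines B e f P) + 1 = q := by
  have h1 : #(((pencil Ln P).erase e).erase f) + 1 = q := by
    rw [card_erase_of_mem, card_erase_of_mem, card_pencil]
    · have := ProjectivePlane.one_lt_order Pt Ln
      omega
    · simpa using he
    · simpa [hef.symm] using hf
  rw [← h1, ← card_union_of_disjoint]
  · congr 2
    ext m
    simp only [mem_union, mem_centralLines, mem_missingLines, mem_erase, mem_pencil]
    tauto
  · rw [Finset.disjoint_left]
    intro m hm hm'
    exact (mem_missingLines.1 hm').2.2.2 (mem_centralLines.1 hm).2.2.2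

omit [Fintype Pt] in
/-- A line of `missingLines B e f P` has no points of `A`, except `P` and the points off `e`
and `f`. -/
theorem SeparatesLines.card_missingLines_le (h : SeparatesLines (A : Set Pt) (B : Set Ln))
    (he : P ∈ e) (hf : P ∈ f) :
    #(missingLines B e f P) ≤ #(offPoints A e f) + 1 := by
  set D := missingLines B e f P
  have h1 : #{m ∈ D | ∃ z ∈ offPoints A e f, z ∈ m} ≤ #(offPoints A e f) := by
    refine card_le_card_of_forall_subsingleton (fun m z => z ∈ m) (fun m hm => ?_) ?_
    · exact (mem_filter.1 hm).2
    · rintro z hz m ⟨hm, hzm⟩ m' ⟨hm', hzm'⟩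
      have hm2 := mem_missingLines.1 (mem_filter.1 hm).1
      have hm2' := mem_missingLines.1 (mem_filter.1 hm').1
      refine line_unique (x := P) (y := z) ?_ hm2.1 hzm hm2'.1 hzm'
      rintro rfl
      exact (mem_offPoints.1 hz).2.1 he
  have h2 : #{m ∈ D | ¬ ∃ z ∈ offPoints A e f, z ∈ m} ≤ 1 := by
    rw [card_le_one]
    intro m hm m' hm'
    rw [mem_filter] at hm hm'
    have hm2 := mem_missingLines.1 hm.1
    have hm2' := mem_missingLines.1 hm'.1
    have key : ∀ l : Ln, P ∈ l → l ≠ e → l ≠ f → (¬ ∃ z ∈ offPoints A e f, z ∈ l) →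
        ∀ x ∈ A, x ∈ l → x = P := by
      intro l hl hle hlf hno x hxA hxl
      by_contra hxP
      refine hno ⟨x, mem_offPoints.2 ⟨hxA, ?_, ?_⟩, hxl⟩
      · exact fun hxe => hxP (point_unique hle hxl hxe hl he)
      · exact fun hxf => hxP (point_unique hlf hxl hxf hl hf)
    refine h m m' (by simpa using hm2.2.2.2) (by simpa using hm2'.2.2.2) fun x hx => ⟨?_, ?_⟩
    · intro hxm
      rw [key m hm2.1 hm2.2.1 hm2.2.2.1 hm.2 x hx hxm]
      exact hm2'.1
    · intro hxm
      rw [key m' hm2'.1 hm2'.2.1 hm2'.2.2.1 hm'.2 x hx hxm]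
      exact hm2.1
  have := card_filter_add_card_filter_not (s := D) (fun m => ∃ z ∈ offPoints A e f, z ∈ m)
  omega

/-- If two lines through `P` were missing from `B`, too few lines would be left to separate the
points of these two lines. -/
theorem Separates.card_missingLines_le_one (h : Separates (A : Set Pt) (B : Set Ln))
    (hq : 23 ≤ q) (hef : e ≠ f) (he : P ∈ e) (hf : P ∈ f) (hw : #(offPoints A e f) ≤ 1)
    (hB : #B + #(offPoints A e f) + 1 ≤ 2 * q) : #(missingLines B e f P) ≤ 1 := by
  by_contra! hD
  have hD2 := h.1.card_missingLines_le (A := A) he hf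
  have hc := card_centralLines_add B hef he hf
  obtain ⟨l, hl, l', hl', hll⟩ := one_lt_card.1 hD
  rw [mem_missingLines] at hl hl'
  set C : Finset Ln := {m ∈ B | P ∉ m} with hC
  have hCc : #C + #(centralLines B e f P) ≤ #B := by
    rw [← card_union_of_disjoint]
    · refine card_le_card fun m hm => ?_
      rcases mem_union.1 hm with hm | hm
      · exact (mem_filter.1 hm).1
      · exact (mem_centralLines.1 hm).2.2.2
    · rw [Finset.disjoint_left]
      exact fun m hm hm' => (mem_filter.1 hm).2 (mem_centralLines.1 hm').1
  set E := (pointsOn Pt l).erase P with hE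
  set E' := (pointsOn Pt l').erase P with hE'
  have hEE : Disjoint E E' := by
    rw [Finset.disjoint_left]
    intro x hx hx'
    simp only [hE, hE', mem_erase, mem_pointsOn] at hx hx'
    exact hx.1 (point_unique hll hx.2 hx'.2 hl.1 hl'.1)
  have hEc : #E = q := card_erase_pointsOn hl.1
  have hEc' : #E' = q := card_erase_pointsOn hl'.1
  have hN : ∀ x ∈ E ∪ E', x ≠ P ∧ ∃ g : Ln, (g = l ∨ g = l') ∧ x ∈ g := by
    intro x hx
    simp only [hE, hE', mem_erase, mem_pointsOn, mem_union] at hx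
    rcases hx with hx | hx
    · exact ⟨hx.1, l, Or.inl rfl, hx.2⟩
    · exact ⟨hx.1, l', Or.inr rfl, hx.2⟩
  have hline : ∀ x ∈ E ∪ E', ∀ m ∈ B, x ∈ m → m ∈ C := by
    intro x hx m hm hxm
    refine mem_filter.2 ⟨hm, fun hPm => ?_⟩
    obtain ⟨hxP, g, hg, hxg⟩ := hN x hx
    rcases hg with rfl | rfl
    · exact hl.2.2.2 (line_unique hxP hxg hl.1 hxm hPm ▸ hm)
    · exact hl'.2.2.2 (line_unique hxP hxg hl'.1 hxm hPm ▸ hm)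
  have key := h.2.sum_le C (E ∪ E') (fun x => 2 - (codeg B x : ℤ)) 2 2 1 (by norm_num)
    (by norm_num) (fun x _ _ => by simp) (fun x _ _ hx => by simp [hx])
    (fun x hx _ hd m hm hxm => by rw [if_pos (hline x hx m hm hxm), hd]; norm_num)
    (fun x _ _ hx => by omega)
  have hsum : ∑ x ∈ E ∪ E', codeg B x ≤ #C * 2 := by
    have h1 : ∀ x ∈ E ∪ E', codeg B x = #{m ∈ C | x ∈ m} := by
      intro x hx
      rw [codeg]
      congr 1
      ext m
      simp only [mem_filter, hC]
      exact ⟨fun hm => ⟨mem_filter.1 (hline x hx m hm.1 hm.2), hm.2⟩, fun hm => ⟨hm.1.1, hm.2⟩⟩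
    rw [sum_congr rfl h1]
    simp only [card_filter]
    rw [sum_comm]
    simp only [← card_filter]
    refine (sum_le_card_nsmul _ _ 2 fun m hm => ?_).trans (by simp)
    refine (card_le_card_of_forall_subsingleton (t := {l, l'}) (fun x g => x ∈ g) ?_ ?_).trans
      card_le_two
    · intro x hx
      obtain ⟨-, g, hg, hxg⟩ := hN x (mem_filter.1 hx).1
      exact ⟨g, by simpa using hg, hxg⟩
    · rintro g hg x ⟨hx, hxg⟩ y ⟨hy, hyg⟩
      have hgP : P ∈ g := by
        simp only [mem_insert, mem_singleton] at hg
        rcases hg with rfl | rfl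
        · exact hl.1
        · exact hl'.1
      refine point_unique (l := m) (m := g) ?_ (mem_filter.1 hx).2 hxg (mem_filter.1 hy).2 hyg
      rintro rfl
      exact (mem_filter.1 hm).2 hgP
  have hNA : #{x ∈ E ∪ E' | x ∈ A} ≤ #(offPoints A e f) := by
    refine card_le_card fun x hx => ?_
    rw [mem_filter] at hx
    obtain ⟨hxP, g, hg, hxg⟩ := hN x hx.1
    have hg' : P ∈ g ∧ g ≠ e ∧ g ≠ f := by
      rcases hg with rfl | rfl
      · exact ⟨hl.1, hl.2.1, hl.2.2.1⟩
      · exact ⟨hl'.1, hl'.2.1, hl'.2.2.1⟩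
    exact mem_offPoints.2 ⟨hx.2, fun hh => hxP (point_unique hg'.2.1 hxg hh hg'.1 he),
      fun hh => hxP (point_unique hg'.2.2 hxg hh hg'.1 hf)⟩
  rw [sum_sub_distrib, sum_const, nsmul_eq_mul, ← Nat.cast_sum, card_union_of_disjoint hEE, hEc,
    hEc'] at key
  push_cast at key
  zify at *
  linarith

/-- The points `X ≠ P` of `f` for which the line `RX` is missing from `B`. -/
noncomputable def missingDirections (B : Finset Ln) (f : Ln) (P R : Pt) : Finset Pt :=
  {X ∈ (pointsOn Pt f).erase P | joinLine Ln R X ∉ B}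

omit [Fintype Ln] in
theorem mem_missingDirections {R X : Pt} : X ∈ missingDirections B f P R ↔
    X ∈ f ∧ X ≠ P ∧ joinLine Ln R X ∉ B := by
  simp only [missingDirections, mem_filter, mem_erase, mem_pointsOn]
  tauto

omit [Fintype Ln] in
/-- For two holes `R` and `R'` of `e`, at most one of the tangents `RX` and `R'X` is missing. -/
theorem SeparatesLines.card_missingDirections_inter_le
    (h : SeparatesLines (A : Set Pt) (B : Set Ln)) (hef : e ≠ f) (he : P ∈ e) (hf : P ∈ f)
    {R R' : Pt} (hRR : R' ≠ R) (hR : R ∈ holes A e P) (hR' : R' ∈ holes A e P) :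
    #(missingDirections B f P R ∩ missingDirections B f P R') ≤
      #(holes A f P) + #(offPoints A e f) + #(offPoints A e f) := by
  rw [mem_holes] at hR hR'
  set W := offPoints A e f
  have hnf : ∀ x : Pt, x ∈ e → x ≠ P → x ∉ f := fun x hx hxP hxf =>
    hxP (point_unique hef hx hxf he hf)
  have hW : ∀ x : Pt, x ∈ e → x ≠ P →
      #{X ∈ (pointsOn Pt f).erase P | ∃ z ∈ W, z ∈ joinLine Ln x X} ≤ #W := by
    intro x hxe hxP
    refine card_le_card_of_forall_subsingleton (fun X z => z ∈ joinLine Ln x X)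
      (fun X hX => (mem_filter.1 hX).2) ?_
    rintro z hz X ⟨hX, hzX⟩ Y ⟨hY, hzY⟩
    have hX' := (mem_filter.1 hX).1
    have hY' := (mem_filter.1 hY).1
    simp only [mem_erase, mem_pointsOn] at hX' hY'
    have hzx : x ≠ z := by
      rintro rfl
      exact (mem_offPoints.1 hz).2.1 hxe
    have heq : joinLine Ln x X = joinLine Ln x Y :=
      line_unique hzx (left_mem_joinLine _ _) hzX (left_mem_joinLine _ _) hzY
    refine point_unique (l := joinLine Ln x X) (m := f) ?_ (right_mem_joinLine _ _) hX'.2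
      (heq ▸ right_mem_joinLine _ _) hY'.2
    intro hh
    exact hnf x hxe hxP (hh ▸ left_mem_joinLine x X)
  have hsub : missingDirections B f P R ∩ missingDirections B f P R' ⊆
      holes A f P ∪ {X ∈ (pointsOn Pt f).erase P | ∃ z ∈ W, z ∈ joinLine Ln R X} ∪
        {X ∈ (pointsOn Pt f).erase P | ∃ z ∈ W, z ∈ joinLine Ln R' X} := by
    intro X hX
    simp only [mem_inter, mem_missingDirections] at hX
    simp only [mem_union, mem_filter, mem_erase, mem_pointsOn, mem_holes]
    by_contra! hno
    obtain ⟨⟨h1, h2⟩, h3⟩ := hno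
    have hXA : X ∈ A := by
      by_contra hXA
      exact hX.1.2.1 (h1 hX.1.1 hXA)
    have h2' := h2 ⟨hX.1.2.1, hX.1.1⟩
    have h3' := h3 ⟨hX.1.2.1, hX.1.1⟩
    have hXe : X ∉ e := fun hh => hX.1.2.1 (point_unique hef hh hX.1.1 he hf)
    have key : ∀ x : Pt, x ∈ e → x ∉ A → x ≠ P → (∀ z ∈ W, z ∉ joinLine Ln x X) →
        ∀ y ∈ A, y ∈ joinLine Ln x X → y = X := by
      intro x hxe hxA hxP hno y hyA hyl
      by_cases hye : y ∈ e
      · have hne : joinLine Ln x X ≠ e := fun hh => hXe (hh ▸ right_mem_joinLine x X)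
        exact (hxA (point_unique hne hyl hye (left_mem_joinLine _ _) hxe ▸ hyA)).elim
      · by_cases hyf : y ∈ f
        · have hne : joinLine Ln x X ≠ f := fun hh =>
            hnf x hxe hxP (hh ▸ left_mem_joinLine x X)
          exact point_unique hne hyl hyf (right_mem_joinLine _ _) hX.1.1
        · exact (hno y (mem_offPoints.2 ⟨hyA, hye, hyf⟩) hyl).elim
    have heq := h (joinLine Ln R X) (joinLine Ln R' X) (by simpa using hX.1.2.2)
      (by simpa using hX.2.2.2) fun y hy => by
        constructor
        · intro hyl
          rw [key R hR.1 hR.2.1 hR.2.2 h2' y hy hyl]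
          exact right_mem_joinLine _ _
        · intro hyl
          rw [key R' hR'.1 hR'.2.1 hR'.2.2 h3' y hy hyl]
          exact right_mem_joinLine _ _
    refine hXe ?_
    rw [line_unique hRR hR'.1 hR.1 (heq ▸ left_mem_joinLine _ _) (left_mem_joinLine R X)]
    exact right_mem_joinLine R X
  refine (card_le_card hsub).trans ((card_union_le _ _).trans
    (Nat.add_le_add ((card_union_le _ _).trans (Nat.add_le_add le_rfl ?_)) ?_))
  · exact hW R hR.1 hR.2.2
  · exact hW R' hR'.1 hR'.2.2

/-- The lines of `B` through none of `P`, `R`, `R'`. -/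
noncomputable def stray (B : Finset Ln) (P R R' : Pt) : Finset Ln :=
  {m ∈ B | P ∉ m ∧ R ∉ m ∧ R' ∉ m}

/-- The lines of `B` are split according to the points `P`, `R`, `R'` of `e`. -/
theorem card_stray_add_le (B : Finset Ln) (hef : e ≠ f) (he : P ∈ e) (hf : P ∈ f) {R R' : Pt}
    (hR : R ∈ e) (hRP : R ≠ P) (hR' : R' ∈ e) (hR'P : R' ≠ P) (hRR : R' ≠ R) :
    #(stray B P R R') + #(centralLines B e f P) + 2 * q ≤
      #B + #(missingDirections B f P R) + #(missingDirections B f P R') := by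
  have hdir : ∀ x : Pt, x ∈ e → x ≠ P →
      #{m ∈ B | x ∈ m ∧ m ≠ e} + #(missingDirections B f P x) ≥ q := by
    intro x hxe hxP
    have hxf : x ∉ f := fun hxf => hxP (point_unique hef hxe hxf he hf)
    have h1 : #{X ∈ (pointsOn Pt f).erase P | joinLine Ln x X ∈ B} +
        #(missingDirections B f P x) = q := by
      rw [missingDirections, card_filter_add_card_filter_not, card_erase_pointsOn hf]
    have h2 : #{X ∈ (pointsOn Pt f).erase P | joinLine Ln x X ∈ B} ≤
        #{m ∈ B | x ∈ m ∧ m ≠ e} := by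
      refine card_le_card_of_injOn (fun X => joinLine Ln x X) ?_ ?_
      · intro X hX
        simp only [coe_filter, Set.mem_ofPred_eq, mem_erase, mem_pointsOn] at hX ⊢
        refine ⟨hX.2, left_mem_joinLine _ _, fun hh => ?_⟩
        exact hX.1.1 (point_unique hef (hh ▸ right_mem_joinLine x X) hX.1.2 he hf)
      · intro X hX Y hY hXY
        simp only [coe_filter, Set.mem_ofPred_eq, mem_erase, mem_pointsOn] at hX hY hXY
        refine point_unique (l := joinLine Ln x X) (m := f) ?_ (right_mem_joinLine _ _) hX.1.2
          (hXY ▸ right_mem_joinLine _ _) hY.1.2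
        exact fun hh => hxf (hh ▸ left_mem_joinLine x X)
    omega
  have h1 := hdir R hR hRP
  have h2 := hdir R' hR' hR'P
  have huniq : ∀ m : Ln, ∀ x y : Pt, x ∈ e → y ∈ e → x ≠ y → m ≠ e → x ∈ m → y ∉ m :=
    fun m x y hx hy hxy hm hxm hym => hm (line_unique hxy hxm hym hx hy)
  have hd1 : Disjoint (stray B P R R') (centralLines B e f P) := by
    rw [Finset.disjoint_left]
    exact fun m hm hm' => (mem_filter.1 hm).2.1 (mem_centralLines.1 hm').1
  have hd2 : Disjoint (stray B P R R' ∪ centralLines B e f P) {m ∈ B | R ∈ m ∧ m ≠ e} := by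
    rw [Finset.disjoint_left]
    intro m hm hm'
    rw [mem_filter] at hm'
    rcases mem_union.1 hm with hm | hm
    · exact (mem_filter.1 hm).2.2.1 hm'.2.1
    · exact huniq m R P hR he hRP hm'.2.2 hm'.2.1 (mem_centralLines.1 hm).1
  have hd3 : Disjoint (stray B P R R' ∪ centralLines B e f P ∪ {m ∈ B | R ∈ m ∧ m ≠ e})
      {m ∈ B | R' ∈ m ∧ m ≠ e} := by
    rw [Finset.disjoint_left]
    intro m hm hm'
    rw [mem_filter] at hm'
    rcases mem_union.1 hm with hm | hm
    · rcases mem_union.1 hm with hm | hm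
      · exact (mem_filter.1 hm).2.2.2 hm'.2.1
      · exact huniq m R' P hR' he hR'P hm'.2.2 hm'.2.1 (mem_centralLines.1 hm).1
    · exact huniq m R' R hR' hR hRR hm'.2.2 hm'.2.1 (mem_filter.1 hm).2.1
  have hsub : stray B P R R' ∪ centralLines B e f P ∪ {m ∈ B | R ∈ m ∧ m ≠ e} ∪
      {m ∈ B | R' ∈ m ∧ m ≠ e} ⊆ B := by
    intro m hm
    simp only [mem_union, mem_centralLines, mem_filter, stray] at hm
    tauto
  have := card_le_card hsub
  rw [card_union_of_disjoint hd3, card_union_of_disjoint hd2, card_union_of_disjoint hd1] at this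
  omega

/-- The points off `e` and `f` whose lines to `R` and `R'` are both missing from `B`. -/
noncomputable def blindPoints (B : Finset Ln) (e f : Ln) (R R' : Pt) : Finset Pt :=
  {Z | Z ∉ e ∧ Z ∉ f ∧ joinLine Ln R Z ∉ B ∧ joinLine Ln R' Z ∉ B}

omit [Fintype Ln] in
/-- Two missing lines, one through `R` and one through `R'`, meet in a blind point unless they meet
on `f`. -/
theorem mul_card_missingDirections_le (B : Finset Ln) (hef : e ≠ f) (he : P ∈ e) (hf : P ∈ f)
    {R R' : Pt} (hR : R ∈ e) (hRP : R ≠ P) (hR' : R' ∈ e) (hR'P : R' ≠ P) (hRR : R' ≠ R) :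
    #(missingDirections B f P R) * #(missingDirections B f P R') ≤
      #(blindPoints B e f R R') +
        #(missingDirections B f P R ∩ missingDirections B f P R') := by
  set a := missingDirections B f P R
  set b := missingDirections B f P R'
  have hRf : R ∉ f := fun h => hRP (point_unique hef hR h he hf)
  have hR'f : R' ∉ f := fun h => hR'P (point_unique hef hR' h he hf)
  have h1 : #(a ∩ b) + #{z ∈ a ×ˢ b | z.1 ≠ z.2} = #a * #b := by
    rw [← card_product, ← card_filter_add_card_filter_not (s := a ×ˢ b) (fun z => z.1 = z.2)]
    congr 1
    refine card_bij' (fun x _ => (x, x)) (fun z _ => z.1) ?_ ?_ ?_ ?_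
    · intro x hx; simpa using hx
    · rintro ⟨x, y⟩ hz
      simp only [mem_filter, mem_product] at hz
      obtain ⟨hz, rfl⟩ := hz
      simpa using hz
    · intro x _; rfl
    · rintro ⟨x, y⟩ hz
      simp only [mem_filter, mem_product] at hz
      obtain ⟨hz, rfl⟩ := hz
      rfl
  have h2 : #{z ∈ a ×ˢ b | z.1 ≠ z.2} ≤ #(blindPoints B e f R R') := by
    refine card_le_card_of_forall_subsingleton
      (fun z Z => Z ∈ joinLine Ln R z.1 ∧ Z ∈ joinLine Ln R' z.2) ?_ ?_
    · rintro ⟨X, Y⟩ hz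
      simp only [mem_filter, mem_product, a, b, mem_missingDirections] at hz
      obtain ⟨⟨⟨hX, hXP, hXB⟩, hY, hYP, hYB⟩, hXY⟩ := hz
      obtain ⟨Z, hZ1, hZ2⟩ := exists_point_on Pt (joinLine Ln R X) (joinLine Ln R' Y)
      have hXe : X ∉ e := fun h => hXP (point_unique hef h hX he hf)
      have hYe : Y ∉ e := fun h => hYP (point_unique hef h hY he hf)
      have n1 : joinLine Ln R X ≠ e := fun h => hXe (h ▸ right_mem_joinLine R X)
      have n2 : joinLine Ln R' Y ≠ e := fun h => hYe (h ▸ right_mem_joinLine R' Y)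
      have n3 : joinLine Ln R X ≠ f := fun h => hRf (h ▸ left_mem_joinLine R X)
      have n4 : joinLine Ln R' Y ≠ f := fun h => hR'f (h ▸ left_mem_joinLine R' Y)
      have hZe : Z ∉ e := fun h => hRR
        ((point_unique n2 (left_mem_joinLine _ _) hR' hZ2 h).trans
          (point_unique n1 hZ1 h (left_mem_joinLine _ _) hR))
      have hZf : Z ∉ f := fun h => hXY
        ((point_unique n3 (right_mem_joinLine _ _) hX hZ1 h).trans
          (point_unique n4 hZ2 h (right_mem_joinLine _ _) hY))
      refine ⟨Z, ?_, hZ1, hZ2⟩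
      simp only [blindPoints, mem_filter, mem_univ, true_and]
      refine ⟨hZe, hZf, ?_, ?_⟩
      · rwa [← eq_joinLine (by rintro rfl; exact hZe hR) (left_mem_joinLine _ _) hZ1]
      · rwa [← eq_joinLine (by rintro rfl; exact hZe hR') (left_mem_joinLine _ _) hZ2]
    · rintro Z hZ ⟨X, Y⟩ ⟨hz, hZX, hZY⟩ ⟨X', Y'⟩ ⟨hz', hZX', hZY'⟩
      simp only [mem_filter, mem_product, a, b, mem_missingDirections] at hz hz'
      simp only [blindPoints, mem_filter, mem_univ, true_and] at hZ
      have hRZ : R ≠ Z := by rintro rfl; exact hZ.1 hR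
      have hR'Z : R' ≠ Z := by rintro rfl; exact hZ.1 hR'
      have e1 : joinLine Ln R X = joinLine Ln R X' :=
        line_unique hRZ (left_mem_joinLine _ _) hZX (left_mem_joinLine _ _) hZX'
      have e2 : joinLine Ln R' Y = joinLine Ln R' Y' :=
        line_unique hR'Z (left_mem_joinLine _ _) hZY (left_mem_joinLine _ _) hZY'
      refine Prod.ext
        (point_unique (l := joinLine Ln R X) (m := f) (fun h => hRf (h ▸ left_mem_joinLine R X))
          (right_mem_joinLine _ _) hz.1.1.1 (e1 ▸ right_mem_joinLine _ _) hz'.1.1.1)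
        (point_unique (l := joinLine Ln R' Y) (m := f)
          (fun h => hR'f (h ▸ left_mem_joinLine R' Y))
          (right_mem_joinLine _ _) hz.1.2.1 (e2 ▸ right_mem_joinLine _ _) hz'.1.2.1)
  omega

omit [Fintype Ln] in
/-- A stray line has at most one blind point in each missing direction. -/
theorem sum_stray_le (B : Finset Ln) (hef : e ≠ f) (he : P ∈ e) (hf : P ∈ f) {R : Pt} (R' : Pt)
    (hR : R ∈ e) (hRP : R ≠ P) :
    ∑ Z ∈ blindPoints B e f R R', #{l ∈ stray B P R R' | Z ∈ l} ≤
      #(stray B P R R') * #(missingDirections B f P R) := by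
  simp only [card_filter]
  rw [sum_comm]
  simp only [← card_filter]
  refine (sum_le_card_nsmul _ _ #(missingDirections B f P R) fun m hm => ?_).trans (by simp)
  have hm' := (mem_filter.1 hm).2
  have hRf : R ∉ f := fun h => hRP (point_unique hef hR h he hf)
  refine card_le_card_of_forall_subsingleton (fun Z X => Z ∈ joinLine Ln R X) ?_ ?_
  · intro Z hZ
    simp only [blindPoints, mem_filter, mem_univ, true_and] at hZ
    obtain ⟨X, hX1, hX2⟩ := exists_point_on Pt (joinLine Ln R Z) f
    have hRX : R ≠ X := by rintro rfl; exact hRf hX2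
    have heq : joinLine Ln R Z = joinLine Ln R X := eq_joinLine hRX (left_mem_joinLine _ _) hX1
    refine ⟨X, mem_missingDirections.2 ⟨hX2, ?_, heq ▸ hZ.1.2.2.1⟩, heq ▸ right_mem_joinLine _ _⟩
    rintro rfl
    refine hZ.1.1 ?_
    rw [line_unique hRP hR he (left_mem_joinLine R Z) hX1]
    exact right_mem_joinLine _ _
  · rintro X hX Z ⟨hZ, hZX⟩ Z' ⟨hZ', hZX'⟩
    refine point_unique (l := m) (m := joinLine Ln R X) ?_ (mem_filter.1 hZ).2 hZX
      (mem_filter.1 hZ').2 hZX'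
    exact fun h => hm'.2.1 (h ▸ left_mem_joinLine R X)

/-- Blind points are separated by lines through `P` and by stray lines only. -/
theorem SeparatesPoints.card_blindPoints_le (h : SeparatesPoints (A : Set Pt) (B : Set Ln))
    (hef : e ≠ f) (he : P ∈ e) (hf : P ∈ f) {R R' : Pt} (hR : R ∈ e) (hRP : R ≠ P)
    (hR' : R' ∈ e) :
    #(blindPoints B e f R R') ≤ #(stray B P R R') * #(missingDirections B f P R) +
      #(offPoints A e f) + 1 + #(centralLines B e f P) := by
  have hsum := sum_stray_le B hef he hf R' hR hRP
  have hline : ∀ Z ∈ blindPoints B e f R R', ∀ l ∈ B, Z ∈ l →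
      l ∈ stray B P R R' ∨ l ∈ centralLines B e f P := by
    intro Z hZ l hl hZl
    simp only [blindPoints, mem_filter, mem_univ, true_and] at hZ
    by_cases hPl : P ∈ l
    · right
      refine mem_centralLines.2 ⟨hPl, ?_, ?_, hl⟩
      · rintro rfl; exact hZ.1 hZl
      · rintro rfl; exact hZ.2.1 hZl
    · left
      refine mem_filter.2 ⟨hl, hPl, fun hRl => ?_, fun hRl => ?_⟩
      · exact hZ.2.2.1 (eq_joinLine (by rintro rfl; exact hZ.1 hR) hRl hZl ▸ hl)
      · exact hZ.2.2.2 (eq_joinLine (by rintro rfl; exact hZ.1 hR') hRl hZl ▸ hl)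
  have key := h.sum_le (centralLines B e f P) (blindPoints B e f R R')
    (fun Z => 1 - (#{l ∈ stray B P R R' | Z ∈ l} : ℤ)) 1 1 1 (by norm_num) (by norm_num)
    (fun Z _ _ => by simp) (fun Z _ _ _ => by simp) ?_ ?_
  · have hA : (#{Z ∈ blindPoints B e f R R' | Z ∈ A} : ℤ) ≤ #(offPoints A e f) := by
      refine Nat.cast_le.2 (card_le_card fun Z hZ => ?_)
      simp only [blindPoints, mem_filter, mem_univ, true_and] at hZ
      exact mem_offPoints.2 ⟨hZ.2, hZ.1.1, hZ.1.2.1⟩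
    rw [sum_sub_distrib, sum_const, nsmul_eq_mul, ← Nat.cast_sum] at key
    zify at *
    linarith
  · intro Z hZ _ _ l hl hZl
    split_ifs with hl'
    · simp
    · have : 0 < #{l ∈ stray B P R R' | Z ∈ l} := card_pos.2
        ⟨l, mem_filter.2 ⟨(hline Z hZ l hl hZl).resolve_right hl', hZl⟩⟩
      omega
  · intro Z hZ _ hd
    -- only one of the lines through `Z` goes through `P`
    obtain ⟨l, hl, l', hl', hne⟩ := one_lt_card.1 (show 1 < #{l ∈ B | Z ∈ l} from hd)
    rw [mem_filter] at hl hl'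
    have hZP : Z ≠ P := by
      rintro rfl
      simp only [blindPoints, mem_filter, mem_univ, true_and] at hZ
      exact hZ.1 he
    have hex : ∃ m ∈ stray B P R R', Z ∈ m := by
      by_contra! hno
      have h1 := (hline Z hZ l hl.1 hl.2).resolve_left fun hh => hno l hh hl.2
      have h2 := (hline Z hZ l' hl'.1 hl'.2).resolve_left fun hh => hno l' hh hl'.2
      exact hne (line_unique hZP hl.2 (mem_centralLines.1 h1).1 hl'.2 (mem_centralLines.1 h2).1)
    obtain ⟨m, hm, hZm⟩ := hex
    have : 0 < #{l ∈ stray B P R R' | Z ∈ l} := card_pos.2 ⟨m, mem_filter.2 ⟨hm, hZm⟩⟩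
    omega

/-- Two holes `R` and `R'` cannot both miss many lines: the product of the two numbers of missing
lines counts blind points, of which there are few. -/
theorem Separates.card_missingDirections_le_one_of_le (h : Separates (A : Set Pt) (B : Set Ln))
    (hq : 23 ≤ q) (hef : e ≠ f) (he : P ∈ e) (hf : P ∈ f)
    {R R' : Pt} (hRR : R' ≠ R) (hR : R ∈ holes A e P) (hR' : R' ∈ holes A e P)
    (hm : #(holes A f P) ≤ 1) (hw : #(offPoints A e f) ≤ 1)
    (hB : #B + #(offPoints A e f) + 1 ≤ 2 * q)
    (hle : #(missingDirections B f P R) ≤ #(missingDirections B f P R')) :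
    #(missingDirections B f P R) ≤ 1 := by
  have hR2 := mem_holes.1 hR
  have hR2' := mem_holes.1 hR'
  have h1 := h.card_missingLines_le_one hq hef he hf hw hB
  have h2 := card_centralLines_add B hef he hf
  have h3 := h.1.card_missingDirections_inter_le hef he hf hRR hR hR'
  have h4 := card_stray_add_le B hef he hf hR2.1 hR2.2.2 hR2'.1 hR2'.2.2 hRR
  have h5 := mul_card_missingDirections_le B hef he hf hR2.1 hR2.2.2 hR2'.1 hR2'.2.2 hRR
  have h6 := h.2.card_blindPoints_le hef he hf hR2.1 hR2.2.2 hR2'.1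
  have h7 := card_union_add_card_inter (missingDirections B f P R) (missingDirections B f P R')
  have h8 : #(missingDirections B f P R ∪ missingDirections B f P R') ≤ q := by
    rw [← card_erase_pointsOn hf]
    exact card_le_card (union_subset (filter_subset _ _) (filter_subset _ _))
  by_contra! ha
  generalize #(missingDirections B f P R ∩ missingDirections B f P R') = i at *
  generalize #(missingDirections B f P R ∪ missingDirections B f P R') = u at *
  generalize #(missingDirections B f P R) = a at *
  generalize #(missingDirections B f P R') = b at *
  generalize #(stray B P R R') = s at *
  generalize #(offPoints A e f) = w at *
  generalize #(centralLines B e f P) = c at *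
  generalize q = n at *
  have k1 : a * b ≤ s * a + w + c + 4 + w + w := by omega
  have k2 : s + n + w ≤ a + b + 1 := by omega
  have k3 : 2 * a ≤ n + 3 := by omega
  have k4 : c + 1 ≤ n := by omega
  zify at *
  have k5 : (a : ℤ) * (s + n + w - 1 - a) ≤ a * b := by gcongr; linarith
  have k6 : 0 ≤ (a : ℤ) * w := by positivity
  have k7 : 0 ≤ ((a : ℤ) - 2) * (n + 3 - 2 * a) := mul_nonneg (by linarith) (by linarith)
  nlinarith

end FindFrame

/-! ### Every small separating pair contains the structure of a frame -/

section ExistsFrame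

open Finset
open scoped Classical

variable {Pt Ln : Type*} [Membership Pt Ln] [Fintype Pt] [Fintype Ln] [ProjectivePlane Pt Ln]

local notation "q" => ProjectivePlane.order Pt Ln

variable {A : Finset Pt} {B : Finset Ln} {e f : Ln} {P : Pt}

/-- A frame is determined by the at most two missing points of `e`, the at most one missing point of
`f`, and the at most one missing line through each of `P` and `R`. -/
theorem exists_frame_star_subset (hq : 3 ≤ q) (hef : e ≠ f) (he : P ∈ e) (hf : P ∈ f) {R R' : Pt}
    (hR : R ∈ e) (hRP : R ≠ P) (hR' : R' ∈ e) (hR'P : R' ≠ P) (hRR : R' ≠ R)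
    (heA : ∀ x ∈ e, x ∉ A → x = P ∨ x = R ∨ x = R')
    (hfA : #(holes A f P) ≤ 1) (hP : #(missingLines B e f P) ≤ 1)
    (hRB : ∀ l m : Ln, R ∈ l → R ∈ m → l ≠ e → m ≠ e → l ∉ B → m ∉ B → l = m) :
    ∃ F : Frame Pt Ln, F.star ⊆ Sum.inl '' (A : Set Pt) ∪ Sum.inr '' (B : Set Ln) := by
  -- where no point or line is missing, any point or line will do
  obtain ⟨Q, hQf, hQP, hQ⟩ : ∃ Q : Pt, Q ∈ f ∧ Q ≠ P ∧ ∀ x ∈ f, x ∉ A → x ≠ P → x = Q := by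
    rcases (holes A f P).eq_empty_or_nonempty with h0 | ⟨Q, hQ⟩
    · obtain ⟨Q, hQ⟩ : ((pointsOn Pt f).erase P).Nonempty := by
        rw [← card_pos, card_erase_pointsOn hf]; omega
      simp only [mem_erase, mem_pointsOn] at hQ
      refine ⟨Q, hQ.2, hQ.1, fun x hx hxA hxP => ?_⟩
      exact absurd (mem_holes.2 ⟨hx, hxA, hxP⟩) (h0 ▸ notMem_empty x)
    · have hQ' := mem_holes.1 hQ
      exact ⟨Q, hQ'.1, hQ'.2.2, fun x hx hxA hxP =>
        card_le_one.1 hfA x (mem_holes.2 ⟨hx, hxA, hxP⟩) Q hQ⟩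
  obtain ⟨l0, hl0P, hl0e, hl0f, hl0⟩ : ∃ l0 : Ln, P ∈ l0 ∧ l0 ≠ e ∧ l0 ≠ f ∧
      ∀ m, P ∈ m → m ≠ e → m ≠ f → m ∉ B → m = l0 := by
    rcases (missingLines B e f P).eq_empty_or_nonempty with h0 | ⟨l, hl⟩
    · have hc := card_centralLines_add B hef he hf
      rw [h0, card_empty] at hc
      obtain ⟨l, hl⟩ : (centralLines B e f P).Nonempty := by
        rw [← card_pos]; omega
      rw [mem_centralLines] at hl
      refine ⟨l, hl.1, hl.2.1, hl.2.2.1, fun m h1 h2 h3 h4 => ?_⟩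
      exact absurd (mem_missingLines.2 ⟨h1, h2, h3, h4⟩) (h0 ▸ notMem_empty m)
    · have hl' := mem_missingLines.1 hl
      exact ⟨l, hl'.1, hl'.2.1, hl'.2.2.1, fun m h1 h2 h3 h4 =>
        card_le_one.1 hP m (mem_missingLines.2 ⟨h1, h2, h3, h4⟩) l hl⟩
  obtain ⟨l1, hl1R, hl1e, hl1⟩ : ∃ l1 : Ln, R ∈ l1 ∧ l1 ≠ e ∧
      ∀ m, R ∈ m → m ≠ e → m ∉ B → m = l1 := by
    by_cases hex : ∃ l : Ln, R ∈ l ∧ l ≠ e ∧ l ∉ B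
    · obtain ⟨l, h1, h2, h3⟩ := hex
      exact ⟨l, h1, h2, fun m a b c => hRB m l a h1 b h2 c h3⟩
    · push Not at hex
      refine ⟨joinLine Ln R Q, left_mem_joinLine _ _, fun h => ?_, fun m h1 h2 h3 =>
        (h3 (hex m h1 h2)).elim⟩
      exact hQP (point_unique hef (h ▸ right_mem_joinLine R Q) hQf he hf)
  refine ⟨⟨P, Q, R, R', e, f, l0, l1, hef, he, hf, hR, hRP, hR', hR'P, hRR, hQf, hQP, hl0P, hl0e,
    hl0f, hl1R, hl1e⟩, ?_⟩
  rintro _ (⟨x, ⟨h1, h2, h3, h4, h5⟩, rfl⟩ | ⟨m, ⟨h1, h2, h3, h4, h5⟩, rfl⟩)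
  · refine Or.inl ⟨x, ?_, rfl⟩
    by_contra hx
    have hx : x ∉ A := by simpa using hx
    rcases h1 with h1 | h1
    · have := heA x h1 hx
      tauto
    · exact h3 (hQ x h1 hx h2)
  · refine Or.inr ⟨m, ?_, rfl⟩
    by_contra hm
    have hm : m ∉ B := by simpa using hm
    rcases h1 with h1 | h1
    · exact h4 (hl0 m h1 h2 h3 hm)
    · exact h5 (hl1 m h1 h2 hm)

/-- The case of two holes on `e`. -/
theorem Separates.exists_frame_of_two_holes (h : Separates (A : Set Pt) (B : Set Ln))
    (hq : 23 ≤ q) (hef : e ≠ f) (he : P ∈ e) (hf : P ∈ f)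
    (hk : #(holes A e P) = 2) (hm : #(holes A f P) ≤ 1) (hw : #(offPoints A e f) ≤ 1)
    (hB : #B + #(offPoints A e f) + 1 ≤ 2 * q) :
    ∃ F : Frame Pt Ln, F.star ⊆ Sum.inl '' (A : Set Pt) ∪ Sum.inr '' (B : Set Ln) := by
  obtain ⟨R, R', hRR, hK⟩ : ∃ R R' : Pt, R' ≠ R ∧ holes A e P = {R, R'} ∧
      #(missingDirections B f P R) ≤ #(missingDirections B f P R') := by
    obtain ⟨R, R', hRR, hK⟩ := card_eq_two.1 hk
    rcases le_total #(missingDirections B f P R) #(missingDirections B f P R') with hle | hle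
    · exact ⟨R, R', hRR.symm, hK, hle⟩
    · exact ⟨R', R, hRR, by rw [hK, pair_comm], hle⟩
  obtain ⟨hK, hle⟩ := hK
  have hRh : R ∈ holes A e P := by simp [hK]
  have hRh' : R' ∈ holes A e P := by simp [hK]
  have h1 := h.card_missingDirections_le_one_of_le hq hef he hf hRR hRh hRh' hm hw hB hle
  have hR := mem_holes.1 hRh
  have hR' := mem_holes.1 hRh'
  refine exists_frame_star_subset (by omega) hef he hf hR.1 hR.2.2 hR'.1 hR'.2.2 hRR ?_ hm
    (h.card_missingLines_le_one hq hef he hf hw hB) ?_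
  · intro x hx hxA
    by_cases hxP : x = P
    · exact Or.inl hxP
    · have := mem_holes.2 ⟨hx, hxA, hxP⟩
      rw [hK] at this
      simpa using Or.inr this
  · have hdir : ∀ l : Ln, R ∈ l → l ≠ e → l ∉ B →
        ∃ X ∈ missingDirections B f P R, l = joinLine Ln R X := by
      intro l hRl hl_ne hlB
      obtain ⟨X, hXl, hXf⟩ := exists_point_on Pt l f
      have hRf : R ∉ f := fun hh => hR.2.2 (point_unique hef hR.1 hh he hf)
      have heq : l = joinLine Ln R X := eq_joinLine (by rintro rfl; exact hRf hXf) hRl hXl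
      refine ⟨X, mem_missingDirections.2 ⟨hXf, ?_, heq ▸ hlB⟩, heq⟩
      rintro rfl
      exact hl_ne (line_unique hR.2.2 hRl hXl hR.1 he)
    intro l m hl hm hle hme hlB hmB
    obtain ⟨X, hX, rfl⟩ := hdir l hl hle hlB
    obtain ⟨Y, hY, rfl⟩ := hdir m hm hme hmB
    rw [card_le_one.1 h1 X hX Y hY]

omit [Fintype Pt] in
/-- If two lines `l` and `l'` through a point `G` of `e` are missing from `B`, their intersections
with a line `m` through `P` can be separated only by a line of `B` through neither `P` nor `G`. -/
theorem SeparatesPoints.exists_stray (h : SeparatesPoints (A : Set Pt) (B : Set Ln))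
    (hw : offPoints A e f = ∅) (he : P ∈ e) (hf : P ∈ f) {G : Pt} (hG : G ∈ e) (hGP : G ≠ P)
    {l l' : Ln} (hl : G ∈ l) (hl' : G ∈ l') (hne : l ≠ l') (hle : l ≠ e) (hle' : l' ≠ e)
    (hlB : l ∉ B) (hlB' : l' ∉ B) {m : Ln} (hm : m ∈ centralLines B e f P) :
    ∃ g ∈ ({l, l'} : Finset Ln), ∃ o ∈ stray B P G G, ∃ Z, Z ∈ m ∧ Z ∈ g ∧ Z ∈ o := by
  by_contra! hno
  rw [mem_centralLines] at hm
  have hGm : G ∉ m := fun hh => hm.2.1 (line_unique hGP hh hm.1 hG he)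
  obtain ⟨Z, hZm, hZl⟩ := exists_point_on Pt m l
  obtain ⟨Z', hZm', hZl'⟩ := exists_point_on Pt m l'
  have key : ∀ g : Ln, ∀ Y : Pt, (g = l ∨ g = l') → Y ∈ m → Y ∈ g →
      Y ∉ A ∧ ∀ o ∈ B, Y ∈ o ↔ o = m := by
    intro g Y hg hYm hYg
    have hg' : G ∈ g ∧ g ≠ e ∧ g ∉ B := by rcases hg with rfl | rfl <;> tauto
    have hYG : Y ≠ G := by rintro rfl; exact hGm hYm
    have hYP : Y ≠ P := by
      rintro rfl
      exact hg'.2.1 (line_unique hGP hg'.1 hYg hG he)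
    constructor
    · intro hYA
      have : Y ∈ offPoints A e f := mem_offPoints.2 ⟨hYA,
        fun hh => hYP (point_unique hm.2.1 hYm hh hm.1 he),
        fun hh => hYP (point_unique hm.2.2.1 hYm hh hm.1 hf)⟩
      rw [hw] at this
      simp at this
    · refine fun o ho => ⟨fun hYo => ?_, fun hh => hh ▸ hYm⟩
      by_contra hom
      have hGo : G ∉ o := fun hh => hg'.2.2 (line_unique hYG hYo hh hYg hg'.1 ▸ ho)
      have hPo : P ∉ o := fun hh => hom (line_unique hYP hYo hh hYm hm.1)
      exact hno g (by simpa using hg) o (mem_filter.2 ⟨ho, hPo, hGo, hGo⟩) Y hYm hYg hYo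
  obtain ⟨k1, k2⟩ := key l Z (Or.inl rfl) hZm hZl
  obtain ⟨k1', k2'⟩ := key l' Z' (Or.inr rfl) hZm' hZl'
  have hZZ : Z = Z' := h Z Z' (by simpa using k1) (by simpa using k1') fun o ho =>
    (k2 o ho).trans (k2' o ho).symm
  refine hGm ?_
  rw [point_unique hne hl hl' hZl (hZZ ▸ hZl')]
  exact hZm

/-- The lines of `B` through `G` other than `g`. -/
noncomputable def centralLines' (B : Finset Ln) (g : Ln) (G : Pt) : Finset Ln :=
  {m ∈ pencil Ln G | m ≠ g ∧ m ∈ B}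

omit [Fintype Pt] in
/-- The lines of `B` are split according to the points `P` and `G`. -/
theorem card_stray_add_add (B : Finset Ln) {g : Ln} {G : Pt} (hGP : G ≠ P) (hP : P ∈ g)
    (hG : G ∈ g) :
    #(stray B P G G) + #({m ∈ centralLines B e f P | m ≠ g}) + #(centralLines' B g G) ≤ #B := by
  rw [← card_union_of_disjoint, ← card_union_of_disjoint]
  · refine card_le_card fun m hm => ?_
    simp only [mem_union, mem_centralLines, mem_filter, stray, centralLines'] at hm
    tauto
  · rw [Finset.disjoint_left]
    intro m hm hm'
    simp only [centralLines', mem_filter, mem_pencil] at hm'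
    rcases mem_union.1 hm with hm | hm
    · exact (mem_filter.1 hm).2.2.1 hm'.1
    · exact hm'.2.1 (line_unique hGP hm'.1 (mem_centralLines.1 (mem_filter.1 hm).1).1 hG hP)
  · rw [Finset.disjoint_left]
    exact fun m hm hm' => (mem_filter.1 hm).2.1 (mem_centralLines.1 (mem_filter.1 hm').1).1

omit [Fintype Pt] [ProjectivePlane Pt Ln] in
theorem codeg_le_card_centralLines' (B : Finset Ln) (g : Ln) (G : Pt) :
    codeg B G ≤ #(centralLines' B g G) + 1 := by
  refine (card_le_card (t := insert g (centralLines' B g G)) fun m hm => ?_).trans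
    (card_insert_le _ _)
  simp only [mem_filter] at hm
  simp only [mem_insert, centralLines', mem_filter, mem_pencil]
  tauto

/-- The case of one hole on each of the two long lines, when the second point `G`
with almost `q` lines of `B` lies on `e`. -/
theorem Separates.exists_frame_of_center (h : Separates (A : Set Pt) (B : Set Ln))
    (hq : 23 ≤ q) (hef : e ≠ f) (he : P ∈ e) (hf : P ∈ f)
    (hk : #(holes A e P) = 1) (hm : #(holes A f P) = 1) (hw : #(offPoints A e f) = 0)
    (hB : #B + 2 ≤ 2 * q) {G : Pt} (hGP : G ≠ P) (hG : G ∈ e) (hGB : q ≤ codeg B G + 4) :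
    ∃ F : Frame Pt Ln, F.star ⊆ Sum.inl '' (A : Set Pt) ∪ Sum.inr '' (B : Set Ln) := by
  have hd := h.card_missingLines_le_one hq hef he hf (by omega) (by omega)
  have hc := card_centralLines_add B hef he hf
  have hG1 := codeg_le_card_centralLines' B e G
  have hs := card_stray_add_add (e := e) (f := f) B hGP he hG
  have hce : {m ∈ centralLines B e f P | m ≠ e} = centralLines B e f P :=
    filter_true_of_mem fun m hm => (mem_centralLines.1 hm).2.1
  rw [hce] at hs
  have hn : #(stray B P G G) ≤ 5 := by omega
  have hw' : offPoints A e f = ∅ := card_eq_zero.1 hw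
  have hGB' : ∀ l m : Ln, G ∈ l → G ∈ m → l ≠ e → m ≠ e → l ∉ B → m ∉ B → l = m := by
    intro l l' hl hl' hle hle' hlB hlB'
    by_contra hne
    -- each central line meets a stray line in a point of `l` or of `l'`
    have h1 : #(centralLines B e f P) ≤ #(({l, l'} : Finset Ln) ×ˢ stray B P G G) := by
      refine card_le_card_of_forall_subsingleton
        (fun m z => ∃ Z, Z ∈ m ∧ Z ∈ z.1 ∧ Z ∈ z.2) ?_ ?_
      · intro m hm
        obtain ⟨g, hg, o, ho, hZ⟩ :=
          h.2.exists_stray hw' he hf hG hGP hl hl' hne hle hle' hlB hlB' hm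
        exact ⟨(g, o), mem_product.2 ⟨hg, ho⟩, hZ⟩
      · rintro ⟨g, o⟩ hz m ⟨hm, Z, hZm, hZg, hZo⟩ m' ⟨hm', Z', hZm', hZg', hZo'⟩
        rw [mem_product] at hz
        have ho := (mem_filter.1 hz.2).2
        have hg' : G ∈ g ∧ g ≠ e ∧ g ∉ B := by
          have := hz.1
          simp only [mem_insert, mem_singleton] at this
          rcases this with rfl | rfl <;> tauto
        have hgo : g ≠ o := by rintro rfl; exact ho.2.1 hg'.1
        have hZZ := point_unique hgo hZg hZo hZg' hZo'
        subst hZZ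
        refine line_unique (x := Z) (y := P) ?_ hZm (mem_centralLines.1 hm).1 hZm'
          (mem_centralLines.1 hm').1
        rintro rfl
        exact ho.1 hZo
    rw [card_product, card_pair hne] at h1
    omega
  obtain ⟨R, hR⟩ := card_eq_one.1 hk
  have hRh := mem_holes.1 (hR ▸ mem_singleton_self R : R ∈ holes A e P)
  have heA : ∀ x ∈ e, x ∉ A → x = P ∨ x = R := by
    intro x hx hxA
    by_cases hxP : x = P
    · exact Or.inl hxP
    · have := mem_holes.2 ⟨hx, hxA, hxP⟩
      rw [hR] at this
      simpa using Or.inr this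
  obtain ⟨R', hR'e, hR'P, hR'G, hR'⟩ : ∃ R' ∈ e, R' ≠ P ∧ R' ≠ G ∧ (R = R' ∨ R = G) := by
    by_cases hRG : R = G
    · obtain ⟨R', hR'⟩ : (((pointsOn Pt e).erase P).erase G).Nonempty := by
        rw [← card_pos, card_erase_of_mem (by simp [hG, hGP]), card_erase_pointsOn he]
        omega
      simp only [mem_erase, mem_pointsOn] at hR'
      exact ⟨R', hR'.2.2, hR'.2.1, hR'.1, Or.inr hRG⟩
    · exact ⟨R, hRh.1, hRh.2.2, hRG, Or.inl rfl⟩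
  refine exists_frame_star_subset (by omega) hef he hf hG hGP hR'e hR'P hR'G ?_ hm.le hd hGB'
  intro x hx hxA
  rcases heA x hx hxA with h1 | h1
  · exact Or.inl h1
  · rcases hR' with h2 | h2
    · exact Or.inr (Or.inr (h1.trans h2))
    · exact Or.inr (Or.inl (h1.trans h2))

/-- The case of one hole on each of the two long lines. The dual of `exists_long_ne` gives a
second point `G` on almost `q` lines of `B`; it lies on a long line, since otherwise the points of
`PG` could not be separated. -/
theorem Separates.exists_frame_of_one_hole (h : Separates (A : Set Pt) (B : Set Ln))
    (hq : 23 ≤ q) (hef : e ≠ f) (he : P ∈ e) (hf : P ∈ f)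
    (hk : #(holes A e P) = 1) (hm : #(holes A f P) = 1) (hw : #(offPoints A e f) = 0)
    (hB : #B + 2 ≤ 2 * q) (hAB : #B + #A + 4 ≤ 4 * q) :
    ∃ F : Frame Pt Ln, F.star ⊆ Sum.inl '' (A : Set Pt) ∪ Sum.inr '' (B : Set Ln) := by
  have hd := h.card_missingLines_le_one hq hef he hf (by omega) (by omega)
  have hc := card_centralLines_add B hef he hf
  have hP : #(centralLines B e f P) ≤ codeg B P := by
    refine card_le_card fun m hm => ?_
    rw [mem_centralLines] at hm
    exact mem_filter.2 ⟨hm.2.2.2, hm.1⟩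
  have hord : ProjectivePlane.order (Dual Ln) (Dual Pt) = q := ProjectivePlane.Dual.order Pt Ln
  obtain ⟨G, hGP, hGB⟩ : ∃ G : Pt, G ≠ P ∧ q ≤ codeg B G + 4 := by
    have := SeparatesLines.exists_long_ne (Pt := Dual Ln) (Ln := Dual Pt) (A := B) (B := A)
      (e := P) h.2 (by rw [hord]; exact hq) (by rw [hord]; exact hB) (by rw [hord]; exact hAB)
      (by rw [hord]; change _ ≤ codeg B P + 4; omega)
    rw [hord] at this
    exact this
  set g := joinLine Ln P G with hg
  have hPg : P ∈ g := left_mem_joinLine _ _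
  have hGg : G ∈ g := right_mem_joinLine _ _
  by_cases hge : g = e
  · exact h.exists_frame_of_center hq hef he hf hk hm hw hB hGP (hge ▸ hGg) hGB
  by_cases hgf : g = f
  · exact h.exists_frame_of_center hq hef.symm hf he hm hk (by rwa [offPoints_comm]) hB hGP
      (hgf ▸ hGg) hGB
  exfalso
  have hG1 := codeg_le_card_centralLines' B g G
  have hs := card_stray_add_add (e := e) (f := f) B hGP hPg hGg
  have hcg : #(centralLines B e f P) ≤ #{m ∈ centralLines B e f P | m ≠ g} + 1 := by
    refine (card_le_card (t := insert g {m ∈ centralLines B e f P | m ≠ g}) fun m hm => ?_).trans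
      (card_insert_le _ _)
    simp only [mem_insert, mem_filter]
    tauto
  set N := ((pointsOn Pt g).erase P).erase G with hN
  have hNc : #N + 1 = q := by
    rw [hN, card_erase_of_mem (by simp [hGg, hGP]), card_erase_pointsOn hPg]
    omega
  have hNmem : ∀ Z ∈ N, Z ≠ G ∧ Z ≠ P ∧ Z ∈ g := fun Z hZ => by simpa [hN] using hZ
  have h1 : #{Z ∈ N | ∃ o ∈ stray B P G G, Z ∈ o} ≤ #(stray B P G G) := by
    refine card_le_card_of_forall_subsingleton (fun Z o => Z ∈ o)
      (fun Z hZ => (mem_filter.1 hZ).2) ?_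
    rintro o ho Z ⟨hZ, hZo⟩ Z' ⟨hZ', hZo'⟩
    refine point_unique (l := g) (m := o) ?_ (hNmem Z (mem_filter.1 hZ).1).2.2 hZo
      (hNmem Z' (mem_filter.1 hZ').1).2.2 hZo'
    intro hh
    exact (mem_filter.1 ho).2.1 (hh ▸ hPg)
  have h2 : #{Z ∈ N | ¬ ∃ o ∈ stray B P G G, Z ∈ o} ≤ 1 := by
    rw [card_le_one]
    have key : ∀ Z ∈ ({Z ∈ N | ¬ ∃ o ∈ stray B P G G, Z ∈ o} : Finset Pt),
        Z ∉ A ∧ ∀ o ∈ B, Z ∈ o ↔ o = g := by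
      intro Z hZ
      rw [mem_filter] at hZ
      obtain ⟨hZG, hZP, hZg⟩ := hNmem Z hZ.1
      constructor
      · intro hZA
        have : Z ∈ offPoints A e f := mem_offPoints.2 ⟨hZA,
          fun hh => hZP (point_unique hge hZg hh hPg he),
          fun hh => hZP (point_unique hgf hZg hh hPg hf)⟩
        rw [card_eq_zero.1 hw] at this
        simp at this
      · refine fun o ho => ⟨fun hZo => ?_, fun hh => hh ▸ hZg⟩
        by_contra hog
        refine hZ.2 ⟨o, mem_filter.2 ⟨ho, fun hh => ?_, fun hh => ?_, fun hh => ?_⟩, hZo⟩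
        · exact hog (line_unique hZP hZo hh hZg hPg)
        · exact hog (line_unique hZG hZo hh hZg hGg)
        · exact hog (line_unique hZG hZo hh hZg hGg)
    intro Z hZ Z' hZ'
    obtain ⟨k1, k2⟩ := key Z hZ
    obtain ⟨k1', k2'⟩ := key Z' hZ'
    exact h.2 Z Z' (by simpa using k1) (by simpa using k1') fun o ho =>
      (k2 o ho).trans (k2' o ho).symm
  have h3 := card_filter_add_card_filter_not (s := N) (fun Z => ∃ o ∈ stray B P G G, Z ∈ o)
  omega

/-- A separating pair of size at most `4q - 4` with at most `2q - 2` points contains the structure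
of a frame. -/
theorem Separates.exists_frame (h : Separates (A : Set Pt) (B : Set Ln))
    (hq : 23 ≤ q) (hA : #A + 2 ≤ 2 * q) (hAB : #A + #B + 4 ≤ 4 * q) :
    ∃ F : Frame Pt Ln, F.star ⊆ Sum.inl '' (A : Set Pt) ∪ Sum.inr '' (B : Set Ln) := by
  obtain ⟨e, he⟩ := h.1.exists_long hq hA hAB
  obtain ⟨f, hfe, hf⟩ := h.1.exists_long_ne hq hA hAB he
  obtain ⟨P, hPe, hPf⟩ := exists_point_on Pt e f
  have h1 := h.1.hole_inequality hfe.symm hPe hPf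
  have h2 := card_add_holes A hfe.symm hPe hPf
  have h3 := card_holes A hPe
  have h4 := card_holes A hPf
  rw [deg_eq_add A hPe] at he
  rw [deg_eq_add A hPf] at hf
  have hc1 : (if P ∈ A then 1 else 0) ≤ 1 := by split_ifs <;> simp
  obtain ⟨h5, h6⟩ := hole_numbers hq hc1 (by omega) (by omega) h2 hA hAB h1
  rcases h6 with ⟨hk, hm⟩ | ⟨hk, hm⟩ | ⟨hk, hm⟩
  · exact h.exists_frame_of_one_hole hq hfe.symm hPe hPf hk hm (by omega) (by omega) (by omega)
  · exact h.exists_frame_of_two_holes hq hfe.symm hPe hPf hk hm (by omega) (by omega)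
  · rw [offPoints_comm] at h2 h5
    exact h.exists_frame_of_two_holes hq hfe hPf hPe hm hk (by omega) (by omega)

end ExistsFrame

/-! ### Frames and their duals -/

namespace Frame

variable {Pt Ln : Type*} [Membership Pt Ln]

/-- The points of the structure `S*`. -/
def starPoints (F : Frame Pt Ln) : Set Pt :=
  {X | (X ∈ F.e ∨ X ∈ F.f) ∧ X ≠ F.P ∧ X ≠ F.Q ∧ X ≠ F.R ∧ X ≠ F.R'}

/-- The lines of the structure `S*`. -/
def starLines (F : Frame Pt Ln) : Set Ln :=
  {m | (F.P ∈ m ∨ F.R ∈ m) ∧ m ≠ F.e ∧ m ≠ F.f ∧ m ≠ F.l0 ∧ m ≠ F.l1}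

theorem star_eq (F : Frame Pt Ln) :
    F.star = Sum.inl '' F.starPoints ∪ Sum.inr '' F.starLines := rfl

/-- The notion of a frame is self-dual: the lines `e`, `f`, `l0`, `l1` change places with the points
`P`, `R`, `R'`, `Q`. -/
def dual (F : Frame Pt Ln) : Frame (Dual Ln) (Dual Pt) where
  P := F.e
  Q := F.l1
  R := F.f
  R' := F.l0
  e := F.P
  f := F.R
  l0 := F.R'
  l1 := F.Q
  e_ne_f := F.R_ne_P.symm
  P_mem_e := F.P_mem_e
  P_mem_f := F.R_mem_e
  R_mem_e := F.P_mem_f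
  R_ne_P := F.e_ne_f.symm
  R'_mem_e := F.P_mem_l0
  R'_ne_P := F.l0_ne_e
  R'_ne_R := F.l0_ne_f
  Q_mem_f := F.R_mem_l1
  Q_ne_P := F.l1_ne_e
  P_mem_l0 := F.R'_mem_e
  l0_ne_e := F.R'_ne_P
  l0_ne_f := F.R'_ne_R
  R_mem_l1 := F.Q_mem_f
  l1_ne_e := F.Q_ne_P

theorem dual_starPoints (F : Frame Pt Ln) : F.dual.starPoints = F.starLines := by
  ext m
  exact ⟨fun ⟨h1, h2, h3, h4, h5⟩ => ⟨h1, h2, h4, h5, h3⟩,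
    fun ⟨h1, h2, h3, h4, h5⟩ => ⟨h1, h2, h5, h3, h4⟩⟩

theorem dual_starLines (F : Frame Pt Ln) : F.dual.starLines = F.starPoints := by
  ext m
  exact ⟨fun ⟨h1, h2, h3, h4, h5⟩ => ⟨h1, h2, h5, h3, h4⟩,
    fun ⟨h1, h2, h3, h4, h5⟩ => ⟨h1, h2, h4, h5, h3⟩⟩

/-- The frame of the plane given by a frame of the dual plane. -/
def undual (F : Frame (Dual Ln) (Dual Pt)) : Frame Pt Ln := F.dual

theorem undual_star_subset (F : Frame (Dual Ln) (Dual Pt)) {A : Set Pt} {B : Set Ln}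
    (hP : F.starPoints ⊆ B) (hL : F.starLines ⊆ A) :
    F.undual.star ⊆ Sum.inl '' A ∪ Sum.inr '' B := by
  have h1 : F.undual.starPoints = F.starLines := F.dual_starPoints
  have h2 : F.undual.starLines = F.starPoints := F.dual_starLines
  rw [star_eq, h1, h2]
  exact Set.union_subset_union (Set.image_mono hL) (Set.image_mono hP)

variable [ProjectivePlane Pt Ln] (F : Frame Pt Ln)

theorem P_ne_T : F.P ≠ F.T := fun h =>
  F.l1_ne_e (line_unique F.R_ne_P F.R_mem_l1 (h ▸ (mkPoint_ax F.f_ne_l1).2) F.R_mem_e F.P_mem_e)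

theorem P_notMem_l1 : F.P ∉ F.l1 := fun h =>
  F.l1_ne_e (line_unique F.R_ne_P F.R_mem_l1 h F.R_mem_e F.P_mem_e)

theorem Q_notMem_e : F.Q ∉ F.e := fun h =>
  F.Q_ne_P (point_unique F.e_ne_f h F.Q_mem_f F.P_mem_e F.P_mem_f)

theorem Q_notMem_l0 : F.Q ∉ F.l0 := fun h =>
  F.Q_ne_P (point_unique F.l0_ne_f h F.Q_mem_f F.P_mem_l0 F.P_mem_f)

theorem T_mem_f : F.T ∈ F.f := (mkPoint_ax F.f_ne_l1).1
theorem T_mem_l1 : F.T ∈ F.l1 := (mkPoint_ax F.f_ne_l1).2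
theorem l0l1_mem_l0 : F.l0l1 ∈ F.l0 := (mkPoint_ax F.l0_ne_l1).1
theorem l0l1_mem_l1 : F.l0l1 ∈ F.l1 := (mkPoint_ax F.l0_ne_l1).2
theorem l0RQ_mem_l0 : F.l0RQ ∈ F.l0 := (mkPoint_ax F.l0_ne_RQ).1
theorem l0RQ_mem_RQ : F.l0RQ ∈ F.RQ := (mkPoint_ax F.l0_ne_RQ).2
theorem R_mem_RQ : F.R ∈ F.RQ := (mkLine_ax F.R_ne_Q).1
theorem Q_mem_RQ : F.Q ∈ F.RQ := (mkLine_ax F.R_ne_Q).2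
theorem R'_mem_R'Q : F.R' ∈ F.R'Q := (mkLine_ax F.R'_ne_Q).1
theorem Q_mem_R'Q : F.Q ∈ F.R'Q := (mkLine_ax F.R'_ne_Q).2
theorem R'_mem_R'T : F.R' ∈ F.R'T := (mkLine_ax F.R'_ne_T).1
theorem T_mem_R'T : F.T ∈ F.R'T := (mkLine_ax F.R'_ne_T).2
theorem l0R'Q_mem_l0 : F.l0R'Q ∈ F.l0 := (mkPoint_ax F.l0_ne_R'Q).1
theorem l0R'Q_mem_R'Q : F.l0R'Q ∈ F.R'Q := (mkPoint_ax F.l0_ne_R'Q).2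
theorem l0R'T_mem_l0 : F.l0R'T ∈ F.l0 := (mkPoint_ax F.l0_ne_R'T).1
theorem l0R'T_mem_R'T : F.l0R'T ∈ F.R'T := (mkPoint_ax F.l0_ne_R'T).2
theorem l1R'Q_mem_l1 : F.l1R'Q ∈ F.l1 := (mkPoint_ax F.l1_ne_R'Q).1
theorem l1R'Q_mem_R'Q : F.l1R'Q ∈ F.R'Q := (mkPoint_ax F.l1_ne_R'Q).2

theorem T_notMem_e : F.T ∉ F.e := fun h =>
  F.P_ne_T (point_unique F.e_ne_f F.P_mem_e F.P_mem_f h F.T_mem_f)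

theorem T_notMem_l0 : F.T ∉ F.l0 := fun h =>
  F.P_ne_T (point_unique F.l0_ne_f F.P_mem_l0 F.P_mem_f h F.T_mem_f)

theorem R'Q_ne_e : F.R'Q ≠ F.e := fun h => F.Q_notMem_e (h ▸ F.Q_mem_R'Q)
theorem R'T_ne_e : F.R'T ≠ F.e := fun h => F.T_notMem_e (h ▸ F.T_mem_R'T)
theorem R'Q_ne_f : F.R'Q ≠ F.f := fun h => F.R'_notMem_f (h ▸ F.R'_mem_R'Q)
theorem R'T_ne_f : F.R'T ≠ F.f := fun h => F.R'_notMem_f (h ▸ F.R'_mem_R'T)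
theorem l1_ne_R'T : F.l1 ≠ F.R'T := fun h => F.R'_notMem_l1 (h ▸ F.R'_mem_R'T)

theorem eq_T {x : Pt} (h1 : x ∈ F.l1) (hf : x ∈ F.f) : x = F.T :=
  point_unique F.f_ne_l1 hf h1 F.T_mem_f F.T_mem_l1

theorem T_eq_Q (h : F.Q ∈ F.l1) : F.T = F.Q := (F.eq_T h F.Q_mem_f).symm

/-! ### Pairs of lines that the structure of a frame does not separate -/

/-- The pairs of lines that `S*` does not separate. Applied to the dual frame, it gives the pairs of
points that `S*` does not separate. -/
def Conflict (a b : Ln) : Prop :=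
  a = F.l0 ∧ b = F.R'Q ∨ a = F.l1 ∧ b = F.R'T ∨ F.Q ∈ F.l1 ∧ a = F.l0 ∧ b = F.l1

theorem starPoints_of_mem_e {x : Pt} (he : x ∈ F.e) (hP : x ≠ F.P) (hR : x ≠ F.R)
    (hR' : x ≠ F.R') : x ∈ F.starPoints :=
  ⟨Or.inl he, hP, fun h => F.Q_notMem_e (h ▸ he), hR, hR'⟩

theorem starPoints_of_mem_f {x : Pt} (hf : x ∈ F.f) (hP : x ≠ F.P) (hQ : x ≠ F.Q) :
    x ∈ F.starPoints :=
  ⟨Or.inr hf, hP, hQ, fun h => F.R_notMem_f (h ▸ hf), fun h => F.R'_notMem_f (h ▸ hf)⟩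

omit [ProjectivePlane Pt Ln] in
theorem notMem_starLines {a : Ln} (ha : a ∉ F.starLines) :
    a = F.e ∨ a = F.f ∨ a = F.l0 ∨ a = F.l1 ∨ (F.P ∉ a ∧ F.R ∉ a) := by
  by_contra! h
  exact ha ⟨or_iff_not_imp_left.2 (h.2.2.2.2), h.1, h.2.1, h.2.2.1, h.2.2.2.1⟩

theorem Conflict.notMem {F : Frame Pt Ln} {a b : Ln} (h : F.Conflict a b) :
    a ∉ F.starLines ∧ b ∉ F.starLines := by
  have h0 : F.l0 ∉ F.starLines := fun h => h.2.2.2.1 rfl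
  have h1 : F.l1 ∉ F.starLines := fun h => h.2.2.2.2 rfl
  have key : ∀ m : Ln, F.R' ∈ m → m ≠ F.e → m ∉ F.starLines := fun m hm hne h =>
    h.1.elim (fun hP => hne (line_unique F.R'_ne_P hm hP F.R'_mem_e F.P_mem_e))
      (fun hR => hne (line_unique F.R'_ne_R hm hR F.R'_mem_e F.R_mem_e))
  rcases h with ⟨rfl, rfl⟩ | ⟨rfl, rfl⟩ | ⟨-, rfl, rfl⟩
  · exact ⟨h0, key _ F.R'_mem_R'Q F.R'Q_ne_e⟩
  · exact ⟨h1, key _ F.R'_mem_R'T F.R'T_ne_e⟩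
  · exact ⟨h0, h1⟩

theorem Conflict.ne {F : Frame Pt Ln} {a b : Ln} (h : F.Conflict a b) : a ≠ b := by
  rcases h with ⟨rfl, rfl⟩ | ⟨rfl, rfl⟩ | ⟨-, rfl, rfl⟩
  · exact F.l0_ne_R'Q
  · exact F.l1_ne_R'T
  · exact F.l0_ne_l1

theorem notMem_l0_of_starPoints {x : Pt} (hx : x ∈ F.starPoints) : x ∉ F.l0 := fun h =>
  hx.1.elim (fun he => hx.2.1 (point_unique F.l0_ne_e h he F.P_mem_l0 F.P_mem_e))
    (fun hf => hx.2.1 (point_unique F.l0_ne_f h hf F.P_mem_l0 F.P_mem_f))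

theorem notMem_R'Q_of_starPoints {x : Pt} (hx : x ∈ F.starPoints) : x ∉ F.R'Q := fun h =>
  hx.1.elim (fun he => hx.2.2.2.2 (point_unique F.R'Q_ne_e h he F.R'_mem_R'Q F.R'_mem_e))
    (fun hf => hx.2.2.1 (point_unique F.R'Q_ne_f h hf F.Q_mem_R'Q F.Q_mem_f))

theorem mem_l1_iff_of_starPoints {x : Pt} (hx : x ∈ F.starPoints) : x ∈ F.l1 ↔ x = F.T := by
  refine ⟨fun h => ?_, fun h => h ▸ F.T_mem_l1⟩
  exact hx.1.elim
    (fun he => (hx.2.2.2.1 (point_unique F.l1_ne_e h he F.R_mem_l1 F.R_mem_e)).elim) (F.eq_T h)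

theorem mem_R'T_iff_of_starPoints {x : Pt} (hx : x ∈ F.starPoints) : x ∈ F.R'T ↔ x = F.T := by
  refine ⟨fun h => ?_, fun h => h ▸ F.T_mem_R'T⟩
  exact hx.1.elim
    (fun he => (hx.2.2.2.2 (point_unique F.R'T_ne_e h he F.R'_mem_R'T F.R'_mem_e)).elim)
    (fun hf => point_unique F.R'T_ne_f h hf F.T_mem_R'T F.T_mem_f)

theorem Conflict.mem_iff {F : Frame Pt Ln} {a b : Ln} (h : F.Conflict a b) {x : Pt}
    (hx : x ∈ F.starPoints) : x ∈ a ↔ x ∈ b := by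
  rcases h with ⟨rfl, rfl⟩ | ⟨rfl, rfl⟩ | ⟨hQ, rfl, rfl⟩
  · simp [F.notMem_l0_of_starPoints hx, F.notMem_R'Q_of_starPoints hx]
  · rw [F.mem_l1_iff_of_starPoints hx, F.mem_R'T_iff_of_starPoints hx]
  · have : x ≠ F.T := by rw [F.T_eq_Q hQ]; exact hx.2.2.1
    simp [F.notMem_l0_of_starPoints hx, F.mem_l1_iff_of_starPoints hx, this]

/-- A line through neither `P` nor `R` meets `e` and `f` in points of `S*`, except for `R'`
and `Q`. -/
theorem exists_points_of_generic {a : Ln} (hP : F.P ∉ a) (hR : F.R ∉ a) :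
    ∃ U V : Pt, U ∈ a ∧ V ∈ a ∧ U ∈ F.e ∧ V ∈ F.f ∧ U ≠ V ∧ U ≠ F.P ∧ V ≠ F.P ∧ U ≠ F.R ∧
      (U ≠ F.R' → U ∈ F.starPoints) ∧ (V ≠ F.Q → V ∈ F.starPoints) := by
  obtain ⟨U, hUa, hUe⟩ := exists_point_on Pt a F.e
  obtain ⟨V, hVa, hVf⟩ := exists_point_on Pt a F.f
  have hUP : U ≠ F.P := by rintro rfl; exact hP hUa
  have hVP : V ≠ F.P := by rintro rfl; exact hP hVa
  have hUR : U ≠ F.R := by rintro rfl; exact hR hUa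
  refine ⟨U, V, hUa, hVa, hUe, hVf, ?_, hUP, hVP, hUR, F.starPoints_of_mem_e hUe hUP hUR,
    F.starPoints_of_mem_f hVf hVP⟩
  rintro rfl
  exact hUP (point_unique F.e_ne_f hUe hVf F.P_mem_e F.P_mem_f)

theorem eq_R'Q_of_trace {b : Ln} (hP : F.P ∉ b) (hR : F.R ∉ b)
    (h : ∀ x ∈ F.starPoints, x ∉ b) : b = F.R'Q := by
  obtain ⟨U, V, hU, hV, -, -, -, -, -, -, h1, h2⟩ := F.exists_points_of_generic hP hR
  have e1 : U = F.R' := by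
    by_contra hh; exact h U (h1 hh) hU
  have e2 : V = F.Q := by
    by_contra hh; exact h V (h2 hh) hV
  exact line_unique F.R'_ne_Q (e1 ▸ hU) (e2 ▸ hV) F.R'_mem_R'Q F.Q_mem_R'Q

theorem eq_R'T_of_trace {b : Ln} (hP : F.P ∉ b) (hR : F.R ∉ b)
    (h : ∀ x ∈ F.starPoints, x ∈ F.l1 ↔ x ∈ b) : b = F.R'T := by
  obtain ⟨U, V, hU, hV, hUe, hVf, -, -, -, hUR, h1, h2⟩ := F.exists_points_of_generic hP hR
  have e1 : U = F.R' := by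
    by_contra hh
    exact hUR (point_unique F.l1_ne_e ((h U (h1 hh)).2 hU) hUe F.R_mem_l1 F.R_mem_e)
  have e2 : V = F.T := by
    by_cases hVQ : V = F.Q
    · by_contra hh
      have hT := F.starPoints_of_mem_f F.T_mem_f F.P_ne_T.symm (fun h3 => hh (hVQ.trans h3.symm))
      have hTb := (h _ hT).1 F.T_mem_l1
      refine hP ?_
      rw [line_unique hh hV hTb hVf F.T_mem_f]
      exact F.P_mem_f
    · exact F.eq_T ((h V (h2 hVQ)).2 hV) hVf
  exact line_unique F.R'_ne_T (e1 ▸ hU) (e2 ▸ hV) F.R'_mem_R'T F.T_mem_R'T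

variable [Finite Pt] [Finite Ln]

theorem exists_starPoints_pair (hq : 4 ≤ ProjectivePlane.order Pt Ln) :
    (∃ x ∈ F.starPoints, ∃ y ∈ F.starPoints, x ≠ y ∧ x ∈ F.e ∧ y ∈ F.e) ∧
    (∃ x ∈ F.starPoints, ∃ y ∈ F.starPoints, x ≠ y ∧ x ∈ F.f ∧ y ∈ F.f) := by
  classical
  cases nonempty_fintype Pt
  cases nonempty_fintype Ln
  have he := card_erase_pointsOn F.P_mem_e
  have hf := card_erase_pointsOn F.P_mem_f
  constructor
  · have h1 := Finset.pred_card_le_card_erase (s := (pointsOn Pt F.e).erase F.P) (a := F.R)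
    have h2 := Finset.pred_card_le_card_erase (s := ((pointsOn Pt F.e).erase F.P).erase F.R)
      (a := F.R')
    obtain ⟨x, hx, y, hy, hxy⟩ := Finset.one_lt_card.1
      (show 1 < ((((pointsOn Pt F.e).erase F.P).erase F.R).erase F.R').card by omega)
    simp only [Finset.mem_erase, mem_pointsOn] at hx hy
    exact ⟨x, F.starPoints_of_mem_e hx.2.2.2 hx.2.2.1 hx.2.1 hx.1,
      y, F.starPoints_of_mem_e hy.2.2.2 hy.2.2.1 hy.2.1 hy.1, hxy, hx.2.2.2, hy.2.2.2⟩
  · have h1 := Finset.pred_card_le_card_erase (s := (pointsOn Pt F.f).erase F.P) (a := F.Q)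
    obtain ⟨x, hx, y, hy, hxy⟩ := Finset.one_lt_card.1
      (show 1 < (((pointsOn Pt F.f).erase F.P).erase F.Q).card by omega)
    simp only [Finset.mem_erase, mem_pointsOn] at hx hy
    exact ⟨x, F.starPoints_of_mem_f hx.2.2 hx.2.1 hx.1,
      y, F.starPoints_of_mem_f hy.2.2 hy.2.1 hy.1, hxy, hx.2.2, hy.2.2⟩

theorem conflict_of_trace (hq : 4 ≤ ProjectivePlane.order Pt Ln) {a b : Ln}
    (ha : a ∉ F.starLines) (hb : b ∉ F.starLines) (hab : a ≠ b)
    (h : ∀ x ∈ F.starPoints, x ∈ a ↔ x ∈ b) : F.Conflict a b ∨ F.Conflict b a := by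
  obtain ⟨⟨x, hx, y, hy, hxy, hxe, hye⟩, ⟨x', hx', y', hy', hxy', hxf, hyf⟩⟩ :=
    F.exists_starPoints_pair hq
  have two : ∀ x ∈ F.starPoints, ∀ y ∈ F.starPoints, x ≠ y → x ∈ a → y ∈ a → False :=
    fun x hx y hy hxy hxa hya => hab (line_unique hxy hxa hya ((h x hx).1 hxa) ((h y hy).1 hya))
  have two' : ∀ x ∈ F.starPoints, ∀ y ∈ F.starPoints, x ≠ y → x ∈ b → y ∈ b → False :=
    fun x hx y hy hxy hxa hya => two x hx y hy hxy ((h x hx).2 hxa) ((h y hy).2 hya)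
  have key : ∀ b : Ln, (∀ x ∈ F.starPoints, x ∈ F.l0 ↔ x ∈ b) → F.P ∉ b → F.R ∉ b →
      F.Conflict F.l0 b := fun b h hP hR =>
    Or.inl ⟨rfl, F.eq_R'Q_of_trace hP hR fun x hx hxb =>
      F.notMem_l0_of_starPoints hx ((h x hx).2 hxb)⟩
  have key' : ∀ b : Ln, (∀ x ∈ F.starPoints, x ∈ F.l1 ↔ x ∈ b) → F.P ∉ b → F.R ∉ b →
      F.Conflict F.l1 b := fun b h hP hR => Or.inr (Or.inl ⟨rfl, F.eq_R'T_of_trace hP hR h⟩)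
  have key2 : (∀ x ∈ F.starPoints, x ∈ F.l0 ↔ x ∈ F.l1) → F.Conflict F.l0 F.l1 := by
    intro h
    refine Or.inr (Or.inr ⟨?_, rfl, rfl⟩)
    by_contra hQ
    have hT := F.starPoints_of_mem_f F.T_mem_f F.P_ne_T.symm (fun h3 => hQ (h3 ▸ F.T_mem_l1))
    exact F.T_notMem_l0 ((h _ hT).2 F.T_mem_l1)
  have hs : ∀ x ∈ F.starPoints, x ∈ b ↔ x ∈ a := fun x hx => (h x hx).symm
  rcases F.notMem_starLines ha with rfl | rfl | rfl | rfl | ⟨haP, haR⟩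
  · exact (two x hx y hy hxy hxe hye).elim
  · exact (two x' hx' y' hy' hxy' hxf hyf).elim
  · rcases F.notMem_starLines hb with rfl | rfl | rfl | rfl | ⟨hbP, hbR⟩
    · exact (two' x hx y hy hxy hxe hye).elim
    · exact (two' x' hx' y' hy' hxy' hxf hyf).elim
    · exact (hab rfl).elim
    · exact Or.inl (key2 h)
    · exact Or.inl (key b h hbP hbR)
  · rcases F.notMem_starLines hb with rfl | rfl | rfl | rfl | ⟨hbP, hbR⟩
    · exact (two' x hx y hy hxy hxe hye).elim
    · exact (two' x' hx' y' hy' hxy' hxf hyf).elim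
    · exact Or.inr (key2 hs)
    · exact (hab rfl).elim
    · exact Or.inl (key' b h hbP hbR)
  · rcases F.notMem_starLines hb with rfl | rfl | rfl | rfl | ⟨hbP, hbR⟩
    · exact (two' x hx y hy hxy hxe hye).elim
    · exact (two' x' hx' y' hy' hxy' hxf hyf).elim
    · exact Or.inr (key a hs haP haR)
    · exact Or.inr (key' a hs haP haR)
    · exfalso
      obtain ⟨U, V, hU, hV, hUe, hVf, hUV, hUP, hVP, hUR, h1, h2⟩ :=
        F.exists_points_of_generic haP haR
      obtain ⟨U', V', hU', hV', hUe', hVf', hUV', hUP', hVP', hUR', h1', h2'⟩ :=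
        F.exists_points_of_generic hbP hbR
      have hae : a ≠ F.e := by rintro rfl; exact haP F.P_mem_e
      have haf : a ≠ F.f := by rintro rfl; exact haP F.P_mem_f
      have hbe : b ≠ F.e := by rintro rfl; exact hbP F.P_mem_e
      have hbf : b ≠ F.f := by rintro rfl; exact hbP F.P_mem_f
      have hUU : U = U' := by
        by_cases e1 : U = F.R'
        · by_cases e2 : U' = F.R'
          · exact e1.trans e2.symm
          · exact point_unique hae hU hUe ((h _ (h1' e2)).2 hU') hUe'
        · exact point_unique hbe ((h _ (h1 e1)).1 hU) hUe hU' hUe'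
      have hVV : V = V' := by
        by_cases e1 : V = F.Q
        · by_cases e2 : V' = F.Q
          · exact e1.trans e2.symm
          · exact point_unique haf hV hVf ((h _ (h2' e2)).2 hV') hVf'
        · exact point_unique hbf ((h _ (h2 e1)).1 hV) hVf hV' hVf'
      exact hab (line_unique hUV hU hV (hUU ▸ hU') (hVV ▸ hV'))

/-- The lines are separated once each conflict is resolved. -/
theorem separatesLines_iff (hq : 4 ≤ ProjectivePlane.order Pt Ln) (X : Set Pt) (Y : Set Ln) :
    SeparatesLines (F.starPoints ∪ X) (F.starLines ∪ Y) ↔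
      ∀ a b, F.Conflict a b → a ∈ Y ∨ b ∈ Y ∨ ∃ z ∈ X, ¬ (z ∈ a ↔ z ∈ b) := by
  constructor
  · intro h a b hab
    by_contra! hno
    refine hab.ne (h a b ?_ ?_ ?_)
    · exact fun h' => h'.elim hab.notMem.1 hno.1
    · exact fun h' => h'.elim hab.notMem.2 hno.2.1
    · rintro x (hx | hx)
      · exact hab.mem_iff hx
      · have := hno.2.2 x hx; tauto
  · intro h a b ha hb hab
    by_contra hne
    have key : ∀ a b : Ln, a ∉ F.starLines ∪ Y → b ∉ F.starLines ∪ Y →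
        (∀ x ∈ F.starPoints ∪ X, x ∈ a ↔ x ∈ b) → ¬ F.Conflict a b := by
      intro a b ha hb hab hc
      rcases h a b hc with h1 | h1 | ⟨z, hz, h1⟩
      · exact ha (Or.inr h1)
      · exact hb (Or.inr h1)
      · exact h1 (hab z (Or.inr hz))
    rcases F.conflict_of_trace hq (fun h => ha (Or.inl h)) (fun h => hb (Or.inl h)) hne
      (fun x hx => hab x (Or.inl hx)) with hc | hc
    · exact key a b ha hb hab hc
    · exact key b a hb ha (fun x hx => (hab x hx).symm) hc

theorem separatesPoints_iff (hq : 4 ≤ ProjectivePlane.order Pt Ln) (X : Set Pt) (Y : Set Ln) :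
    SeparatesPoints (F.starPoints ∪ X) (F.starLines ∪ Y) ↔
      ∀ a b : Pt, F.dual.Conflict a b → a ∈ X ∨ b ∈ X ∨ ∃ m ∈ Y, ¬ (a ∈ m ↔ b ∈ m) := by
  have := F.dual.separatesLines_iff (by rwa [ProjectivePlane.Dual.order]) Y X
  rw [dual_starPoints, dual_starLines] at this
  exact this

/-- The conflicts between lines are `l0, R'Q` and `l1, R'T`, those between points are `R', l0 ∩ l1`
and `Q, l0 ∩ RQ`; if `Q` lies on `l1`, there are also `l0, l1` and `R', Q`. -/
theorem separates_iff (hq : 4 ≤ ProjectivePlane.order Pt Ln) (X : Set Pt) (Y : Set Ln) :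
    Separates (F.starPoints ∪ X) (F.starLines ∪ Y) ↔
      ((F.l0 ∈ Y ∨ F.R'Q ∈ Y ∨ ∃ z ∈ X, ¬ (z ∈ F.l0 ↔ z ∈ F.R'Q)) ∧
      (F.l1 ∈ Y ∨ F.R'T ∈ Y ∨ ∃ z ∈ X, ¬ (z ∈ F.l1 ↔ z ∈ F.R'T)) ∧
      (F.Q ∈ F.l1 → F.l0 ∈ Y ∨ F.l1 ∈ Y ∨ ∃ z ∈ X, ¬ (z ∈ F.l0 ↔ z ∈ F.l1))) ∧
      ((F.R' ∈ X ∨ F.l0l1 ∈ X ∨ ∃ m ∈ Y, ¬ (F.R' ∈ m ↔ F.l0l1 ∈ m)) ∧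
      (F.Q ∈ X ∨ F.l0RQ ∈ X ∨ ∃ m ∈ Y, ¬ (F.Q ∈ m ↔ F.l0RQ ∈ m)) ∧
      (F.Q ∈ F.l1 → F.R' ∈ X ∨ F.Q ∈ X ∨ ∃ m ∈ Y, ¬ (F.R' ∈ m ↔ F.Q ∈ m))) := by
  rw [Separates, F.separatesLines_iff hq, F.separatesPoints_iff hq]
  refine and_congr ?_ ?_
  · constructor
    · exact fun h => ⟨h _ _ (Or.inl ⟨rfl, rfl⟩), h _ _ (Or.inr (Or.inl ⟨rfl, rfl⟩)),
        fun hQ => h _ _ (Or.inr (Or.inr ⟨hQ, rfl, rfl⟩))⟩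
    · rintro ⟨h1, h2, h3⟩ a b (⟨rfl, rfl⟩ | ⟨rfl, rfl⟩ | ⟨hQ, rfl, rfl⟩)
      · exact h1
      · exact h2
      · exact h3 hQ
  · constructor
    · exact fun h => ⟨h _ _ (Or.inl ⟨rfl, rfl⟩), h _ _ (Or.inr (Or.inl ⟨rfl, rfl⟩)),
        fun hQ => h _ _ (Or.inr (Or.inr ⟨hQ, rfl, rfl⟩))⟩
    · rintro ⟨h1, h2, h3⟩ a b (⟨rfl, rfl⟩ | ⟨rfl, rfl⟩ | ⟨hQ, rfl, rfl⟩)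
      · exact h1
      · exact h2
      · exact h3 hQ

/-! ### The size of the structure of a frame -/

theorem ncard_starPoints : F.starPoints.ncard + 3 = 2 * ProjectivePlane.order Pt Ln := by
  classical
  cases nonempty_fintype Pt
  cases nonempty_fintype Ln
  have h1 : F.starPoints = ((((pointsOn Pt F.e).erase F.P).erase F.R).erase F.R' ∪
      ((pointsOn Pt F.f).erase F.P).erase F.Q : Finset Pt) := by
    ext x
    simp only [Finset.coe_union, Finset.coe_erase, Set.mem_union, Set.mem_sdiff, Finset.mem_coe,
      mem_pointsOn, Set.mem_singleton_iff]
    constructor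
    · rintro ⟨he | hf, hP, hQ, hR, hR'⟩
      · exact Or.inl ⟨⟨⟨he, hP⟩, hR⟩, hR'⟩
      · exact Or.inr ⟨⟨hf, hP⟩, hQ⟩
    · rintro (⟨⟨⟨he, hP⟩, hR⟩, hR'⟩ | ⟨⟨hf, hP⟩, hQ⟩)
      · exact F.starPoints_of_mem_e he hP hR hR'
      · exact F.starPoints_of_mem_f hf hP hQ
  have h2 := ProjectivePlane.one_lt_order Pt Ln
  have e1 : (((pointsOn Pt F.e).erase F.P).erase F.R).card = _ :=
    Finset.card_erase_of_mem (by simp [F.R_mem_e, F.R_ne_P])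
  have e2 : ((((pointsOn Pt F.e).erase F.P).erase F.R).erase F.R').card = _ :=
    Finset.card_erase_of_mem (by simp [F.R'_mem_e, F.R'_ne_P, F.R'_ne_R])
  have e3 : (((pointsOn Pt F.f).erase F.P).erase F.Q).card = _ :=
    Finset.card_erase_of_mem (by simp [F.Q_mem_f, F.Q_ne_P])
  rw [card_erase_pointsOn F.P_mem_e] at e1
  rw [card_erase_pointsOn F.P_mem_f] at e3
  rw [h1, Set.ncard_coe_finset, Finset.card_union_of_disjoint]
  · omega
  · rw [Finset.disjoint_left]
    intro x hx hx'
    simp only [Finset.mem_erase, mem_pointsOn] at hx hx'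
    exact hx.2.2.1 (point_unique F.e_ne_f hx.2.2.2 hx'.2.2 F.P_mem_e F.P_mem_f)

theorem ncard_starLines : F.starLines.ncard + 3 = 2 * ProjectivePlane.order Pt Ln := by
  rw [← dual_starPoints, ← ProjectivePlane.Dual.order Pt Ln]
  exact F.dual.ncard_starPoints

end Frame

theorem eq_inl_union_inr {Pt Ln : Type*} (S : Set (Pt ⊕ Ln)) :
    S = Sum.inl '' pointPart S ∪ Sum.inr '' linePart S := by
  ext (x | l) <;> simp [pointPart, linePart]

theorem ncard_eq_add {Pt Ln : Type*} [Finite Pt] [Finite Ln] (S : Set (Pt ⊕ Ln)) :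
    S.ncard = (pointPart S).ncard + (linePart S).ncard := by
  conv_lhs => rw [eq_inl_union_inr S]
  rw [Set.ncard_union_eq, Set.ncard_image_of_injective _ Sum.inl_injective,
    Set.ncard_image_of_injective _ Sum.inr_injective]
  rw [Set.disjoint_left]
  rintro _ ⟨x, -, rfl⟩ ⟨l, -, hl⟩
  exact Sum.inr_ne_inl hl

/-! ### The 32 constructions -/

namespace Frame

variable {Pt Ln : Type*} [Membership Pt Ln]

theorem pointPart_star_union (F : Frame Pt Ln) (S : Set (Pt ⊕ Ln)) :
    pointPart (F.star ∪ S) = F.starPoints ∪ pointPart S := by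
  ext x; simp [pointPart, star_eq]

theorem linePart_star_union (F : Frame Pt Ln) (S : Set (Pt ⊕ Ln)) :
    linePart (F.star ∪ S) = F.starLines ∪ linePart S := by
  ext x; simp [linePart, star_eq]

omit [Membership Pt Ln] in
theorem pointPart_line_point (m : Ln) (Z : Pt) :
    pointPart ({Sum.inr m, Sum.inl Z} : Set (Pt ⊕ Ln)) = {Z} := by
  ext x; simp [pointPart]

omit [Membership Pt Ln] in
theorem linePart_line_point (m : Ln) (Z : Pt) :
    linePart ({Sum.inr m, Sum.inl Z} : Set (Pt ⊕ Ln)) = {m} := by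
  ext x; simp [linePart]

omit [Membership Pt Ln] in
theorem pointPart_line_line (m n : Ln) :
    pointPart ({Sum.inr m, Sum.inr n} : Set (Pt ⊕ Ln)) = ∅ := by
  ext x; simp [pointPart]

omit [Membership Pt Ln] in
theorem linePart_line_line (m n : Ln) :
    linePart ({Sum.inr m, Sum.inr n} : Set (Pt ⊕ Ln)) = {m, n} := by
  ext x; simp [linePart]

variable [ProjectivePlane Pt Ln] (F : Frame Pt Ln)

theorem l0l1_notMem_e : F.l0l1 ∉ F.e := fun h =>
  F.P_notMem_l1 (point_unique F.l0_ne_e F.l0l1_mem_l0 h F.P_mem_l0 F.P_mem_e ▸ F.l0l1_mem_l1)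

theorem l0l1_notMem_f : F.l0l1 ∉ F.f := fun h =>
  F.P_notMem_l1 (point_unique F.l0_ne_f F.l0l1_mem_l0 h F.P_mem_l0 F.P_mem_f ▸ F.l0l1_mem_l1)

theorem P_notMem_RQ : F.P ∉ F.RQ := fun h => F.Q_notMem_e
  (line_unique F.R_ne_P F.R_mem_RQ h F.R_mem_e F.P_mem_e ▸ F.Q_mem_RQ)

theorem R_notMem_R'Q : F.R ∉ F.R'Q := fun h => F.R'Q_ne_e
  (line_unique F.R'_ne_R F.R'_mem_R'Q h F.R'_mem_e F.R_mem_e)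

theorem l0RQ_notMem_e : F.l0RQ ∉ F.e := fun h =>
  F.P_notMem_RQ (point_unique F.l0_ne_e F.l0RQ_mem_l0 h F.P_mem_l0 F.P_mem_e ▸ F.l0RQ_mem_RQ)

theorem l0RQ_notMem_f : F.l0RQ ∉ F.f := fun h =>
  F.P_notMem_RQ (point_unique F.l0_ne_f F.l0RQ_mem_l0 h F.P_mem_l0 F.P_mem_f ▸ F.l0RQ_mem_RQ)

theorem l0l1_notMem_R'T : F.l0l1 ∉ F.R'T := fun h =>
  F.l0l1_notMem_f (point_unique F.l1_ne_R'T F.l0l1_mem_l1 h F.T_mem_l1 F.T_mem_R'T ▸ F.T_mem_f)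

theorem l0RQ_notMem_R'Q : F.l0RQ ∉ F.R'Q := fun h => F.l0RQ_notMem_f
  (point_unique (fun hh : F.RQ = F.R'Q => F.R_notMem_R'Q (hh ▸ F.R_mem_RQ)) F.l0RQ_mem_RQ h
    F.Q_mem_RQ F.Q_mem_R'Q ▸ F.Q_mem_f)

theorem l0R'T_notMem_e : F.l0R'T ∉ F.e := fun h => F.R'_notMem_l0
  (point_unique F.R'T_ne_e F.l0R'T_mem_R'T h F.R'_mem_R'T F.R'_mem_e ▸ F.l0R'T_mem_l0)

theorem l1R'Q_notMem_e : F.l1R'Q ∉ F.e := fun h => F.R'_notMem_l1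
  (point_unique F.R'Q_ne_e F.l1R'Q_mem_R'Q h F.R'_mem_R'Q F.R'_mem_e ▸ F.l1R'Q_mem_l1)

theorem R'T_eq_R'Q (h : F.Q ∈ F.l1) : F.R'T = F.R'Q :=
  line_unique F.R'_ne_Q F.R'_mem_R'T (F.T_eq_Q h ▸ F.T_mem_R'T) F.R'_mem_R'Q F.Q_mem_R'Q

theorem RQ_eq_l1 (h : F.Q ∈ F.l1) : F.RQ = F.l1 :=
  line_unique F.R_ne_Q F.R_mem_RQ F.Q_mem_RQ F.R_mem_l1 h

theorem l0RQ_eq_l0l1 (h : F.Q ∈ F.l1) : F.l0RQ = F.l0l1 :=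
  point_unique F.l0_ne_l1 F.l0RQ_mem_l0 (F.RQ_eq_l1 h ▸ F.l0RQ_mem_RQ) F.l0l1_mem_l0
    F.l0l1_mem_l1

variable {F}

theorem RQ_ne_l1 (h : F.Q ∉ F.l1) : F.RQ ≠ F.l1 := fun hh => h (hh ▸ F.Q_mem_RQ)

theorem Q_notMem_R'T (h : F.Q ∉ F.l1) : F.Q ∉ F.R'T := fun hh => h
  (point_unique F.R'T_ne_f hh F.Q_mem_f F.T_mem_R'T F.T_mem_f ▸ F.T_mem_l1)

theorem l0RQ_notMem_l1 (h : F.Q ∉ F.l1) : F.l0RQ ∉ F.l1 := fun hh => F.l0RQ_notMem_e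
  (point_unique (RQ_ne_l1 h) F.l0RQ_mem_RQ hh F.R_mem_RQ F.R_mem_l1 ▸ F.R_mem_e)

theorem l0l1_notMem_RQ (h : F.Q ∉ F.l1) : F.l0l1 ∉ F.RQ := fun hh => F.l0l1_notMem_e
  (point_unique (RQ_ne_l1 h) hh F.l0l1_mem_l1 F.R_mem_RQ F.R_mem_l1 ▸ F.R_mem_e)

theorem l0R'T_notMem_R'Q (h : F.Q ∉ F.l1) : F.l0R'T ∉ F.R'Q := fun hh => F.l0R'T_notMem_e
  (point_unique (fun hR => Q_notMem_R'T h (hR ▸ F.Q_mem_R'Q)) F.l0R'T_mem_R'T hh F.R'_mem_R'T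
    F.R'_mem_R'Q ▸ F.R'_mem_e)

theorem l1R'Q_notMem_R'T (h : F.Q ∉ F.l1) : F.l1R'Q ∉ F.R'T := fun hh => F.l1R'Q_notMem_e
  (point_unique (fun hR => Q_notMem_R'T h (hR ▸ F.Q_mem_R'Q)) hh F.l1R'Q_mem_R'Q F.R'_mem_R'T
    F.R'_mem_R'Q ▸ F.R'_mem_e)

theorem l0R'T_notMem_l1 : F.l0R'T ∉ F.l1 := fun hh => F.T_notMem_l0
  (point_unique F.l1_ne_R'T hh F.l0R'T_mem_R'T F.T_mem_l1 F.T_mem_R'T ▸ F.l0R'T_mem_l0)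

variable (F)

theorem line_point_iff [Finite Pt] [Finite Ln] (hq : 4 ≤ ProjectivePlane.order Pt Ln) (m : Ln)
    (Z : Pt) :
    Separates (pointPart (F.star ∪ {Sum.inr m, Sum.inl Z}))
        (linePart (F.star ∪ {Sum.inr m, Sum.inl Z})) ↔
      ((F.l0 = m ∨ F.R'Q = m ∨ ¬ (Z ∈ F.l0 ↔ Z ∈ F.R'Q)) ∧
      (F.l1 = m ∨ F.R'T = m ∨ ¬ (Z ∈ F.l1 ↔ Z ∈ F.R'T)) ∧
      (F.Q ∈ F.l1 → F.l0 = m ∨ F.l1 = m ∨ ¬ (Z ∈ F.l0 ↔ Z ∈ F.l1))) ∧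
      ((F.R' = Z ∨ F.l0l1 = Z ∨ ¬ (F.R' ∈ m ↔ F.l0l1 ∈ m)) ∧
      (F.Q = Z ∨ F.l0RQ = Z ∨ ¬ (F.Q ∈ m ↔ F.l0RQ ∈ m)) ∧
      (F.Q ∈ F.l1 → F.R' = Z ∨ F.Q = Z ∨ ¬ (F.R' ∈ m ↔ F.Q ∈ m))) := by
  rw [pointPart_star_union, linePart_star_union, pointPart_line_point, linePart_line_point,
    F.separates_iff hq]
  simp only [Set.mem_singleton_iff, exists_eq_left]

theorem line_line_iff [Finite Pt] [Finite Ln] (hq : 4 ≤ ProjectivePlane.order Pt Ln) (m n : Ln) :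
    Separates (pointPart (F.star ∪ {Sum.inr m, Sum.inr n}))
        (linePart (F.star ∪ {Sum.inr m, Sum.inr n})) ↔
      (((F.l0 = m ∨ F.l0 = n) ∨ (F.R'Q = m ∨ F.R'Q = n)) ∧
      ((F.l1 = m ∨ F.l1 = n) ∨ (F.R'T = m ∨ F.R'T = n)) ∧
      (F.Q ∈ F.l1 → (F.l0 = m ∨ F.l0 = n) ∨ (F.l1 = m ∨ F.l1 = n))) ∧
      ((¬ (F.R' ∈ m ↔ F.l0l1 ∈ m) ∨ ¬ (F.R' ∈ n ↔ F.l0l1 ∈ n)) ∧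
      (¬ (F.Q ∈ m ↔ F.l0RQ ∈ m) ∨ ¬ (F.Q ∈ n ↔ F.l0RQ ∈ n)) ∧
      (F.Q ∈ F.l1 → ¬ (F.R' ∈ m ↔ F.Q ∈ m) ∨ ¬ (F.R' ∈ n ↔ F.Q ∈ n))) := by
  rw [pointPart_star_union, linePart_star_union, pointPart_line_line, linePart_line_line,
    F.separates_iff hq]
  simp only [Set.mem_insert_iff, Set.mem_singleton_iff, Set.mem_empty_iff_false, false_and,
    exists_false, or_false, false_or, exists_eq_or_imp, exists_eq_left]

variable {F}

theorem notMem_of_mem_e {x y z : Pt} {m : Ln} (hx : x ∈ F.e) (hy : y ∈ F.e) (hxy : x ≠ y)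
    (hxm : x ∈ m) (hzm : z ∈ m) (hz : z ∉ F.e) : y ∉ m := fun hym =>
  hz (line_unique hxy hx hy hxm hym ▸ hzm)

theorem l0RQ_notMem_of_Q_mem {m : Ln} (hQ : F.Q ∈ m) (hR : F.R ∉ m) : F.l0RQ ∉ m := fun hB => hR
  (line_unique (fun h : F.Q = F.l0RQ => F.l0RQ_notMem_f (h ▸ F.Q_mem_f)) hQ hB F.Q_mem_RQ
    F.l0RQ_mem_RQ ▸ F.R_mem_RQ)

theorem l0l1_notMem_R'Q_of_mem {m : Ln} (hQ : F.Q ∈ m) (hA : F.l0l1 ∈ m) (hR' : F.R' ∉ m) :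
    F.l0l1 ∉ F.R'Q := fun h => hR'
  (line_unique (fun h : F.Q = F.l0l1 => F.l0l1_notMem_f (h ▸ F.Q_mem_f)) hQ hA F.Q_mem_R'Q
    h ▸ F.R'_mem_R'Q)

theorem l1R'Q_notMem_l0 (h : F.l0l1 ∉ F.R'Q) : F.l1R'Q ∉ F.l0 := fun hh => h
  (point_unique F.l0_ne_l1 hh F.l1R'Q_mem_l1 F.l0l1_mem_l0 F.l0l1_mem_l1 ▸ F.l1R'Q_mem_R'Q)

theorem l0l1_notMem_of_l0RQ_mem (h : F.Q ∉ F.l1) {m : Ln} (hB : F.l0RQ ∈ m) (hR' : F.R' ∈ m) :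
    F.l0l1 ∉ m := fun hA => F.R'_notMem_l0
  (line_unique (fun h' => l0RQ_notMem_l1 h (h' ▸ F.l0l1_mem_l1)) hB hA F.l0RQ_mem_l0 F.l0l1_mem_l0
    ▸ hR')

theorem notMem_R'T_of_mem_l1 {Z : Pt} (hZ : Z ∈ F.l1) (hZT : Z ≠ F.T) : Z ∉ F.R'T := fun h =>
  hZT (point_unique F.l1_ne_R'T hZ h F.T_mem_l1 F.T_mem_R'T)

theorem notMem_l1_of_mem_R'T {Z : Pt} (hZ : Z ∈ F.R'T) (hZT : Z ≠ F.T) : Z ∉ F.l1 := fun h =>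
  hZT (point_unique F.l1_ne_R'T h hZ F.T_mem_l1 F.T_mem_R'T)

theorem notMem_R'Q_of_mem_l0 {Z : Pt} (hZ : Z ∈ F.l0) (hZ0 : Z ≠ F.l0R'Q) : Z ∉ F.R'Q := fun h =>
  hZ0 (point_unique F.l0_ne_R'Q hZ h F.l0R'Q_mem_l0 F.l0R'Q_mem_R'Q)

theorem notMem_l0_of_mem_R'Q {Z : Pt} (hZ : Z ∈ F.R'Q) (hZ0 : Z ≠ F.l0R'Q) : Z ∉ F.l0 := fun h =>
  hZ0 (point_unique F.l0_ne_R'Q h hZ F.l0R'Q_mem_l0 F.l0R'Q_mem_R'Q)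

/-- Each of the constructions resolves all conflicts. -/
theorem Adds.separates [Finite Pt] [Finite Ln] (hq : 4 ≤ ProjectivePlane.order Pt Ln) {i : ℕ}
    {x y : Pt ⊕ Ln} (h : F.Adds i x y) :
    Separates (pointPart (F.star ∪ {x, y})) (linePart (F.star ∪ {x, y})) := by
  have a1 := F.R'_notMem_l0
  have a2 := F.R'_notMem_l1
  have a3 := F.R'_mem_R'Q
  have a4 := F.R'_mem_R'T
  have a5 := F.Q_notMem_l0
  have a6 := F.Q_mem_R'Q
  have a7 := F.Q_mem_f
  have b1 := F.l0l1_mem_l0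
  have b2 := F.l0l1_mem_l1
  have b3 := F.l0l1_notMem_R'T
  have b4 := F.l0RQ_mem_l0
  have b5 := F.l0RQ_notMem_R'Q
  have b6 := F.l0RQ_notMem_f
  have b7 : F.Q ∉ F.l1 → F.l0RQ ∉ F.l1 := l0RQ_notMem_l1
  have b8 : F.Q ∉ F.l1 → F.Q ∉ F.R'T := Q_notMem_R'T
  -- the points of `e` that a line through `U` or through `R'` misses
  have c1 : ∀ {U z : Pt} {m : Ln}, F.IsU U → U ∈ m → z ∈ m → z ∉ F.e → F.R ∉ m ∧ F.R' ∉ m :=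
    fun hU hUm hzm hz => ⟨notMem_of_mem_e hU.1 F.R_mem_e hU.2.2.1 hUm hzm hz,
      notMem_of_mem_e hU.1 F.R'_mem_e hU.2.2.2 hUm hzm hz⟩
  have c2 : ∀ {z : Pt} {m : Ln}, F.R' ∈ m → z ∈ m → z ∉ F.e → F.R ∉ m :=
    fun hR' hzm hz => notMem_of_mem_e F.R'_mem_e F.R_mem_e F.R'_ne_R hR' hzm hz
  have c3 : ∀ {m : Ln}, F.l0RQ ∈ m → F.R ∉ m → F.Q ∉ m := fun hB hR hQ =>
    l0RQ_notMem_of_Q_mem hQ hR hB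
  cases h with
  | C1 => rw [F.line_line_iff hq]; grind
  | C2 => rw [F.line_line_iff hq]; grind
  | C3 => rw [F.line_point_iff hq]; grind
  | C4 => rw [F.line_point_iff hq]; grind
  | C5 h =>
    rw [F.line_point_iff hq, F.R'T_eq_R'Q h]
    have := F.l0RQ_eq_l0l1 h
    grind
  | C6 h =>
    rw [F.line_point_iff hq, F.R'T_eq_R'Q h]
    grind
  | C7 h => rw [F.line_line_iff hq]; grind
  | C8 h => rw [F.line_line_iff hq]; grind
  | C9 h => rw [F.line_point_iff hq]; grind
  | C10 h U m hU hUm hQm =>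
    rw [F.line_point_iff hq]
    have := l0RQ_notMem_of_Q_mem hQm (c1 hU hUm hQm F.Q_notMem_e).1
    grind
  | C11 h => rw [F.line_point_iff hq]; grind
  | C12 h U m hU hUm hm =>
    rw [F.line_point_iff hq]
    have := c3 hm (c1 hU hUm hm F.l0RQ_notMem_e).1
    grind
  | C13 h h1 =>
    rw [F.line_point_iff hq]
    have := F.R'_mem_e
    have := F.l0l1_notMem_e
    grind
  | C14 h h1 => rw [F.line_point_iff hq]; grind
  | C15 h Z hZ hZT =>
    rw [F.line_point_iff hq]
    have := notMem_R'T_of_mem_l1 hZ hZT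
    grind
  | C16 h Z hZ hZT hZR' =>
    rw [F.line_point_iff hq]
    have := notMem_l1_of_mem_R'T hZ hZT
    grind
  | C17 h U V m hU hV hUm hVm h1 h2 =>
    rw [F.line_point_iff hq]
    have := (c1 hU hUm h1 F.l0l1_notMem_e).2
    grind
  | C18 h U V m hU hV hUm hVm h1 h2 =>
    rw [F.line_point_iff hq]
    have := c3 h1 (c1 hU hUm h1 F.l0RQ_notMem_e).1
    grind
  | C19 h U m hU hUm hQm h1 h2 =>
    rw [F.line_point_iff hq]
    have := l0RQ_notMem_of_Q_mem hQm (c1 hU hUm hQm F.Q_notMem_e).1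
    grind
  | C20 h U m hU hUm hQm h1 =>
    rw [F.line_point_iff hq]
    have h3 := c1 hU hUm hQm F.Q_notMem_e
    have := l0RQ_notMem_of_Q_mem hQm h3.1
    have := l0l1_notMem_R'Q_of_mem hQm h1 h3.2
    grind
  | C21 h U m hU hUm hQm h1 =>
    rw [F.line_point_iff hq]
    have h3 := c1 hU hUm hQm F.Q_notMem_e
    have := l0RQ_notMem_of_Q_mem hQm h3.1
    have := F.l0R'T_mem_l0
    have := F.l0R'T_mem_R'T
    have := l0R'T_notMem_R'Q h
    have := F.l0R'T_notMem_l1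
    grind
  | C22 h U m hU hUm hQm h1 =>
    rw [F.line_point_iff hq]
    have h3 := c1 hU hUm hQm F.Q_notMem_e
    have := l0RQ_notMem_of_Q_mem hQm h3.1
    have := l1R'Q_notMem_l0 (l0l1_notMem_R'Q_of_mem hQm h1 h3.2)
    have := F.l1R'Q_mem_l1
    have := F.l1R'Q_mem_R'Q
    have := l1R'Q_notMem_R'T h
    grind
  | C23 h h1 => rw [F.line_point_iff hq]; grind
  | C24 h V m hV hR'm hVm h1 h2 => rw [F.line_point_iff hq]; grind
  | C25 h V m hV hR'm hVm h1 =>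
    rw [F.line_point_iff hq]
    have := l0l1_notMem_of_l0RQ_mem h h1 hR'm
    have := c3 h1 (c2 hR'm h1 F.l0RQ_notMem_e)
    have := F.l0R'T_mem_l0
    have := F.l0R'T_mem_R'T
    have := l0R'T_notMem_R'Q h
    have := F.l0R'T_notMem_l1
    grind
  | C26 h V m hV hR'm hVm h1 h2 =>
    rw [F.line_point_iff hq]
    have := c3 h1 (c2 hR'm h1 F.l0RQ_notMem_e)
    grind
  | C27 h V m hV hR'm hVm h1 h2 =>
    rw [F.line_point_iff hq]
    have := l0l1_notMem_of_l0RQ_mem h h1 hR'm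
    have := c3 h1 (c2 hR'm h1 F.l0RQ_notMem_e)
    have := l1R'Q_notMem_l0 h2
    have := F.l1R'Q_mem_l1
    have := F.l1R'Q_mem_R'Q
    have := l1R'Q_notMem_R'T h
    grind
  | C28 h h1 => rw [F.line_point_iff hq]; grind
  | C29 h h1 Z hZ hZ0 =>
    rw [F.line_point_iff hq]
    have := notMem_R'Q_of_mem_l0 hZ hZ0
    grind
  | C30 h h1 Z hZ hZ0 hZR' hZQ =>
    rw [F.line_point_iff hq]
    have := notMem_l0_of_mem_R'Q hZ hZ0
    grind
  | C31 h h1 Z hZ hZT =>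
    rw [F.line_point_iff hq]
    have := notMem_R'T_of_mem_l1 hZ hZT
    grind
  | C32 h h1 Z hZ hZT hZR' =>
    rw [F.line_point_iff hq]
    have := notMem_l1_of_mem_R'T hZ hZT
    grind

theorem notMem_starLines_of_mem_e {x z : Pt} {m : Ln} (hx : x ∈ F.e) (hP : x ≠ F.P) (hR : x ≠ F.R)
    (hxm : x ∈ m) (hzm : z ∈ m) (hz : z ∉ F.e) : m ∉ F.starLines := fun h =>
  h.1.elim (notMem_of_mem_e hx F.P_mem_e hP hxm hzm hz)
    (notMem_of_mem_e hx F.R_mem_e hR hxm hzm hz)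

/-- The objects added by a construction do not belong to `S*`. They are two lines in the
constructions 1, 2, 7, 8, and a line and a point in the others. -/
theorem Adds.shape {i : ℕ} {x y : Pt ⊕ Ln} (h : F.Adds i x y) :
    1 ≤ i ∧ i ≤ 32 ∧ (((i = 1 ∨ i = 2 ∨ i = 7 ∨ i = 8) ∧ ∃ m n : Ln, x = Sum.inr m ∧ y = Sum.inr n ∧
        m ∉ F.starLines ∧ n ∉ F.starLines ∧ m ≠ n) ∨
      (¬ (i = 1 ∨ i = 2 ∨ i = 7 ∨ i = 8) ∧ ∃ (m : Ln) (Z : Pt), x = Sum.inr m ∧ y = Sum.inl Z ∧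
        m ∉ F.starLines ∧ Z ∉ F.starPoints)) := by
  have he : F.e ∉ F.starLines := fun h => h.2.1 rfl
  have hf : F.f ∉ F.starLines := fun h => h.2.2.1 rfl
  have h0 : F.l0 ∉ F.starLines := fun h => h.2.2.2.1 rfl
  have h1 : F.l1 ∉ F.starLines := fun h => h.2.2.2.2 rfl
  have hR'Q : F.R'Q ∉ F.starLines := (Conflict.notMem (Or.inl ⟨rfl, rfl⟩)).2
  have hR'T : F.R'T ∉ F.starLines := (Conflict.notMem (Or.inr (Or.inl ⟨rfl, rfl⟩))).2
  have hQ : F.Q ∉ F.starPoints := fun h => h.2.2.1 rfl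
  have hR' : F.R' ∉ F.starPoints := fun h => h.2.2.2.2 rfl
  have z0 : ∀ {Z : Pt}, Z ∈ F.l0 → Z ∉ F.starPoints := fun hZ h => F.notMem_l0_of_starPoints h hZ
  have zQ : ∀ {Z : Pt}, Z ∈ F.R'Q → Z ∉ F.starPoints := fun hZ h =>
    F.notMem_R'Q_of_starPoints h hZ
  have z1 : ∀ {Z : Pt}, Z ∈ F.l1 → Z ≠ F.T → Z ∉ F.starPoints := fun hZ hT h =>
    hT ((F.mem_l1_iff_of_starPoints h).1 hZ)
  have zT : ∀ {Z : Pt}, Z ∈ F.R'T → Z ≠ F.T → Z ∉ F.starPoints := fun hZ hT h =>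
    hT ((F.mem_R'T_iff_of_starPoints h).1 hZ)
  have mU : ∀ {U z : Pt} {m : Ln}, F.IsU U → U ∈ m → z ∈ m → z ∉ F.e → m ∉ F.starLines :=
    fun hU => notMem_starLines_of_mem_e hU.1 hU.2.1 hU.2.2.1
  have mR' : ∀ {V : Pt} {m : Ln}, V ∈ F.f → V ≠ F.P → F.R' ∈ m → V ∈ m → m ∉ F.starLines :=
    fun hV hVP hR' hVm => notMem_starLines_of_mem_e F.R'_mem_e F.R'_ne_P F.R'_ne_R hR' hVm
      fun hVe => hVP (point_unique F.e_ne_f hVe hV F.P_mem_e F.P_mem_f)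
  have two : ∀ {j : ℕ} {m n : Ln}, (j = 1 ∨ j = 2 ∨ j = 7 ∨ j = 8) → m ∉ F.starLines →
      n ∉ F.starLines → m ≠ n → 1 ≤ j ∧ j ≤ 32 ∧ (((j = 1 ∨ j = 2 ∨ j = 7 ∨ j = 8) ∧
        ∃ m' n' : Ln, (Sum.inr m : Pt ⊕ Ln) = Sum.inr m' ∧ (Sum.inr n : Pt ⊕ Ln) = Sum.inr n' ∧
        m' ∉ F.starLines ∧ n' ∉ F.starLines ∧ m' ≠ n') ∨
      (¬ (j = 1 ∨ j = 2 ∨ j = 7 ∨ j = 8) ∧ ∃ (m' : Ln) (Z : Pt),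
        (Sum.inr m : Pt ⊕ Ln) = Sum.inr m' ∧ (Sum.inr n : Pt ⊕ Ln) = Sum.inl Z ∧
        m' ∉ F.starLines ∧ Z ∉ F.starPoints)) :=
    fun hj hm hn hmn => ⟨by omega, by omega, Or.inl ⟨hj, _, _, rfl, rfl, hm, hn, hmn⟩⟩
  have one : ∀ {j : ℕ} {m : Ln} {Z : Pt}, (1 ≤ j ∧ j ≤ 32 ∧ ¬ (j = 1 ∨ j = 2 ∨ j = 7 ∨ j = 8)) →
      m ∉ F.starLines → Z ∉ F.starPoints → 1 ≤ j ∧ j ≤ 32 ∧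
      (((j = 1 ∨ j = 2 ∨ j = 7 ∨ j = 8) ∧
        ∃ m' n' : Ln, (Sum.inr m : Pt ⊕ Ln) = Sum.inr m' ∧ (Sum.inl Z : Pt ⊕ Ln) = Sum.inr n' ∧
        m' ∉ F.starLines ∧ n' ∉ F.starLines ∧ m' ≠ n') ∨
      (¬ (j = 1 ∨ j = 2 ∨ j = 7 ∨ j = 8) ∧ ∃ (m' : Ln) (Z' : Pt),
        (Sum.inr m : Pt ⊕ Ln) = Sum.inr m' ∧
        (Sum.inl Z : Pt ⊕ Ln) = Sum.inl Z' ∧ m' ∉ F.starLines ∧ Z' ∉ F.starPoints)) :=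
    fun hj hm hZ => ⟨hj.1, hj.2.1, Or.inr ⟨hj.2.2, _, _, rfl, rfl, hm, hZ⟩⟩
  cases h with
  | C1 => exact two (by norm_num) h0 h1 F.l0_ne_l1
  | C2 => exact two (by norm_num) hR'Q h1 F.l1_ne_R'Q.symm
  | C3 => exact one (by norm_num) h1 hQ
  | C4 => exact one (by norm_num) h1 (z0 F.l0RQ_mem_l0)
  | C5 h => exact one (by norm_num) hR'Q hQ
  | C6 h => exact one (by norm_num) h0 hR'
  | C7 h => exact two (by norm_num) h0 hR'T F.l0_ne_R'T
  | C8 h =>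
    exact two (by norm_num) hR'Q hR'T fun hh => Q_notMem_R'T h (hh ▸ F.Q_mem_R'Q)
  | C9 h => exact one (by norm_num) hf hR'
  | C10 h U m hU hUm hQm => exact one (by norm_num) (mU hU hUm hQm F.Q_notMem_e) hR'
  | C11 h => exact one (by norm_num) h0 hR'
  | C12 h U m hU hUm hm => exact one (by norm_num) (mU hU hUm hm F.l0RQ_notMem_e) hR'
  | C13 h h1 => exact one (by norm_num) he (z0 F.l0RQ_mem_l0)
  | C14 h h1 => exact one (by norm_num) hf (z0 F.l0l1_mem_l0)
  | C15 h Z hZ hZT => exact one (by norm_num) h0 (z1 hZ hZT)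
  | C16 h Z hZ hZT hZR' => exact one (by norm_num) h0 (zT hZ hZT)
  | C17 h U V m hU hV hUm hVm h1 h2 =>
    exact one (by norm_num) (mU hU hUm h1 F.l0l1_notMem_e) (z0 F.l0RQ_mem_l0)
  | C18 h U V m hU hV hUm hVm h1 h2 =>
    exact one (by norm_num) (mU hU hUm h1 F.l0RQ_notMem_e) (z0 F.l0l1_mem_l0)
  | C19 h U m hU hUm hQm h1 h2 =>
    exact one (by norm_num) (mU hU hUm hQm F.Q_notMem_e) (z0 F.l0l1_mem_l0)
  | C20 h U m hU hUm hQm h1 =>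
    exact one (by norm_num) (mU hU hUm hQm F.Q_notMem_e) (z0 F.l0l1_mem_l0)
  | C21 h U m hU hUm hQm h1 =>
    exact one (by norm_num) (mU hU hUm hQm F.Q_notMem_e) (z0 F.l0R'T_mem_l0)
  | C22 h U m hU hUm hQm h1 =>
    exact one (by norm_num) (mU hU hUm hQm F.Q_notMem_e) (zQ F.l1R'Q_mem_R'Q)
  | C23 h h1 => exact one (by norm_num) hR'Q (z0 F.l0l1_mem_l0)
  | C24 h V m hV hR'm hVm h1 h2 =>
    exact one (by norm_num) (mR' hV.1 hV.2.1 hR'm hVm) (z0 F.l0RQ_mem_l0)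
  | C25 h V m hV hR'm hVm h1 =>
    exact one (by norm_num) (mR' hV.1 hV.2.1 hR'm hVm) (z0 F.l0R'T_mem_l0)
  | C26 h V m hV hR'm hVm h1 h2 =>
    exact one (by norm_num) (mR' hV.1 hV.2.1 hR'm hVm) (z0 F.l0l1_mem_l0)
  | C27 h V m hV hR'm hVm h1 h2 =>
    exact one (by norm_num) (mR' hV.1 hV.2.1 hR'm hVm) (zQ F.l1R'Q_mem_R'Q)
  | C28 h h1 => exact one (by norm_num) hR'T (z0 F.l0RQ_mem_l0)
  | C29 h h1 Z hZ hZ0 => exact one (by norm_num) hR'T (z0 hZ)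
  | C30 h h1 Z hZ hZ0 hZR' hZQ => exact one (by norm_num) hR'T (zQ hZ)
  | C31 h h1 Z hZ hZT => exact one (by norm_num) hR'Q (z1 hZ hZT)
  | C32 h h1 Z hZ hZT hZR' => exact one (by norm_num) hR'Q (zT hZ hZT)

end Frame

/-! ### Completeness of the list of constructions -/

namespace Frame

variable {Pt Ln : Type*} [Membership Pt Ln]

/-- The frame with `R'` replaced by another point `U` of `e`. -/
def withR' (F : Frame Pt Ln) {U : Pt} (hU : F.IsU U) : Frame Pt Ln :=
  { F with R' := U, R'_mem_e := hU.1, R'_ne_P := hU.2.1, R'_ne_R := hU.2.2.1 }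

theorem isU_withR' (F : Frame Pt Ln) {U : Pt} (hU : F.IsU U) : (F.withR' hU).IsU F.R' :=
  ⟨F.R'_mem_e, F.R'_ne_P, F.R'_ne_R, hU.2.2.2.symm⟩

omit [Membership Pt Ln] in
theorem union_pair_inl (A : Set Pt) (B : Set Ln) (x : Pt ⊕ Ln) (z : Pt) :
    (Sum.inl '' A ∪ Sum.inr '' B ∪ {x, Sum.inl z} : Set (Pt ⊕ Ln)) =
      Sum.inl '' insert z A ∪ Sum.inr '' B ∪ {x} := by
  rw [Set.image_insert_eq]
  ext y
  simp only [Set.union_insert, Set.union_singleton, Set.mem_insert_iff, Set.mem_union,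
    Set.insert_union]

variable [ProjectivePlane Pt Ln] (F : Frame Pt Ln)

/-- The frame with `Q` replaced by `T`. -/
noncomputable def withT : Frame Pt Ln :=
  { F with Q := F.T, Q_mem_f := F.T_mem_f, Q_ne_P := F.P_ne_T.symm }

/-- Exchanging the roles of `R'` and `U`: adding `R'` to the old structure is adding `U` to the new
one. -/
theorem star_withR' {U : Pt} (hU : F.IsU U) (x : Pt ⊕ Ln) :
    F.star ∪ {x, Sum.inl F.R'} = (F.withR' hU).star ∪ {x, Sum.inl U} := by
  have h1 := F.starPoints_of_mem_e hU.1 hU.2.1 hU.2.2.1 hU.2.2.2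
  have h2 := (F.withR' hU).starPoints_of_mem_e F.R'_mem_e F.R'_ne_P F.R'_ne_R hU.2.2.2.symm
  have h3 : (F.withR' hU).starLines = F.starLines := rfl
  have h4 : insert F.R' F.starPoints = insert U (F.withR' hU).starPoints := by
    ext z
    by_cases hz : z = F.R'
    · subst hz; simpa using Or.inr h2
    by_cases hz' : z = U
    · subst hz'; simpa using Or.inr h1
    simp only [Set.mem_insert_iff, hz, hz', false_or]
    exact ⟨fun h => ⟨h.1, h.2.1, h.2.2.1, h.2.2.2.1, hz'⟩,
      fun h => ⟨h.1, h.2.1, h.2.2.1, h.2.2.2.1, hz⟩⟩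
  rw [star_eq, star_eq, h3, union_pair_inl, union_pair_inl, h4]

theorem star_withT (h : F.Q ∉ F.l1) (x : Pt ⊕ Ln) :
    F.star ∪ {x, Sum.inl F.Q} = F.withT.star ∪ {x, Sum.inl F.T} := by
  have hTQ : F.T ≠ F.Q := fun hh => h (hh ▸ F.T_mem_l1)
  have h1 := F.starPoints_of_mem_f F.T_mem_f F.P_ne_T.symm hTQ
  have h2 := F.withT.starPoints_of_mem_f F.Q_mem_f F.Q_ne_P hTQ.symm
  have h3 : F.withT.starLines = F.starLines := rfl
  have h4 : insert F.Q F.starPoints = insert F.T F.withT.starPoints := by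
    ext z
    by_cases hz : z = F.Q
    · subst hz; simpa using Or.inr h2
    by_cases hz' : z = F.T
    · subst hz'; simpa using Or.inr h1
    simp only [Set.mem_insert_iff, hz, hz', false_or]
    exact ⟨fun h => ⟨h.1, h.2.1, hz', h.2.2.2⟩, fun h => ⟨h.1, h.2.1, hz, h.2.2.2⟩⟩
  rw [star_eq, star_eq, h3, union_pair_inl, union_pair_inl, h4]

variable {F}

theorem Adds.exists_hasType {i : ℕ} {x y : Pt ⊕ Ln} (h : F.Adds i x y) :
    ∃ i : ℕ, 1 ≤ i ∧ i ≤ 32 ∧ HasType i (F.star ∪ {x, y}) :=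
  ⟨i, h.shape.1, h.shape.2.1, F, x, y, h, rfl⟩

/-- Two lines that resolve all conflicts are added by one of the constructions. -/
theorem exists_adds_of_separates_lines [Finite Pt] [Finite Ln]
    (hq : 4 ≤ ProjectivePlane.order Pt Ln) {m n : Ln}
    (h : Separates (pointPart (F.star ∪ {Sum.inr m, Sum.inr n}))
      (linePart (F.star ∪ {Sum.inr m, Sum.inr n}))) :
    ∃ i : ℕ, F.Adds i (Sum.inr m) (Sum.inr n) ∨ F.Adds i (Sum.inr n) (Sum.inr m) := by
  rw [F.line_line_iff hq] at h
  obtain ⟨⟨h1, h2, h3⟩, -, -, h6⟩ := h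
  have a1 := F.l0_ne_l1
  have a2 := F.l0_ne_R'T
  have a3 := F.l1_ne_R'Q
  by_cases hQ : F.Q ∈ F.l1
  · have e := F.R'T_eq_R'Q hQ
    specialize h3 hQ
    specialize h6 hQ
    have b1 := F.R'_notMem_l0
    have b2 := F.Q_notMem_l0
    have b3 := F.R'_mem_R'Q
    have b4 := F.Q_mem_R'Q
    have h7 : (F.l0 = m ∧ F.l1 = n ∨ F.l0 = n ∧ F.l1 = m) ∨
        (F.R'Q = m ∧ F.l1 = n ∨ F.R'Q = n ∧ F.l1 = m) := by grind
    rcases h7 with (⟨rfl, rfl⟩ | ⟨rfl, rfl⟩) | (⟨rfl, rfl⟩ | ⟨rfl, rfl⟩)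
    · exact ⟨1, Or.inl .C1⟩
    · exact ⟨1, Or.inr .C1⟩
    · exact ⟨2, Or.inl .C2⟩
    · exact ⟨2, Or.inr .C2⟩
  · have a4 : F.R'Q ≠ F.R'T := fun hh => Q_notMem_R'T hQ (hh ▸ F.Q_mem_R'Q)
    rcases h1 with (rfl | rfl) | (rfl | rfl) <;> rcases h2 with (h2 | h2) | (h2 | h2)
    -- half of the combinations identify two different lines
    all_goals first | (exact absurd h2 (by first | assumption | exact Ne.symm (by assumption))) |
      subst h2
    · exact ⟨1, Or.inl .C1⟩
    · exact ⟨7, Or.inl (.C7 hQ)⟩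
    · exact ⟨1, Or.inr .C1⟩
    · exact ⟨7, Or.inr (.C7 hQ)⟩
    · exact ⟨2, Or.inl .C2⟩
    · exact ⟨8, Or.inl (.C8 hQ)⟩
    · exact ⟨2, Or.inr .C2⟩
    · exact ⟨8, Or.inr (.C8 hQ)⟩

/-- If `Q` lies on `l1`, three lines are pairwise in conflict, and a single point cannot separate
all three, so `m` is one of them. -/
theorem exists_adds_of_Q_mem_l1 [Finite Pt] [Finite Ln] (hq : 4 ≤ ProjectivePlane.order Pt Ln)
    (hQ : F.Q ∈ F.l1) {m : Ln} {Z : Pt}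
    (h : Separates (pointPart (F.star ∪ {Sum.inr m, Sum.inl Z}))
      (linePart (F.star ∪ {Sum.inr m, Sum.inl Z}))) :
    ∃ i : ℕ, F.Adds i (Sum.inr m) (Sum.inl Z) := by
  rw [F.line_point_iff hq, F.R'T_eq_R'Q hQ] at h
  obtain ⟨⟨h1, h2, h3⟩, -, h5, h6⟩ := h
  specialize h3 hQ
  specialize h6 hQ
  have hm : F.l0 = m ∨ F.l1 = m ∨ F.R'Q = m := by grind
  rcases hm with rfl | rfl | rfl
  · have b1 := F.R'_notMem_l0
    have b2 := F.Q_notMem_l0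
    have b3 := F.l0_ne_l1
    have b4 := F.l0_ne_R'Q
    have b5 := F.Q_mem_R'Q
    have hZ : F.R' = Z := by grind
    subst hZ
    exact ⟨6, .C6 hQ⟩
  · have b1 := F.l0l1_mem_l1
    have b2 := F.l0RQ_eq_l0l1 hQ
    have hZ : F.Q = Z ∨ F.l0RQ = Z := by grind
    rcases hZ with rfl | rfl
    · exact ⟨3, .C3⟩
    · exact ⟨4, .C4⟩
  · have b1 := F.R'_notMem_l0
    have b2 := F.R'_notMem_l1
    have b3 := F.l0_ne_R'Q
    have b4 := F.l1_ne_R'Q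
    have b5 := F.Q_mem_R'Q
    have b6 := F.R'_mem_R'Q
    have hZ : F.Q = Z := by grind
    subst hZ
    exact ⟨5, .C5 hQ⟩

/-- A line through `R'` and `Q`, or through `R'` and `l0 ∩ RQ`, becomes a line through the point `U`
of the constructions when `R'` changes place with another point of `e`. -/
theorem exists_hasType_of_R'_mem [Finite Pt] [Finite Ln] (hq : 4 ≤ ProjectivePlane.order Pt Ln)
    (hQ : F.Q ∉ F.l1) {m : Ln} (hR' : F.R' ∈ m) (hm : F.Q ∈ m ∨ F.l0RQ ∈ m) :
    ∃ i : ℕ, 1 ≤ i ∧ i ≤ 32 ∧ HasType i (F.star ∪ {Sum.inr m, Sum.inl F.R'}) := by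
  obtain ⟨⟨U, hU, -, -, -, hUe, -⟩, -⟩ := F.exists_starPoints_pair hq
  have hU' : F.IsU U := ⟨hUe, hU.2.1, hU.2.2.2.1, hU.2.2.2.2⟩
  rw [F.star_withR' hU']
  rcases hm with hm | hm
  · exact (Adds.C10 (F := F.withR' hU') hQ _ m (F.isU_withR' hU') hR' hm).exists_hasType
  · exact (Adds.C12 (F := F.withR' hU') hQ _ m (F.isU_withR' hU') hR' hm).exists_hasType

/-- The case in which `m` is one of the lines `l0`, `l1`, `R'Q`, `R'T`. -/
theorem exists_hasType_of_conflict_line [Finite Pt] [Finite Ln]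
    (hq : 4 ≤ ProjectivePlane.order Pt Ln) (hQ : F.Q ∉ F.l1) {m : Ln} {Z : Pt}
    (hm : F.l0 = m ∨ F.l1 = m ∨ F.R'Q = m ∨ F.R'T = m)
    (h : Separates (pointPart (F.star ∪ {Sum.inr m, Sum.inl Z}))
      (linePart (F.star ∪ {Sum.inr m, Sum.inl Z}))) :
    ∃ i : ℕ, 1 ≤ i ∧ i ≤ 32 ∧ HasType i (F.star ∪ {Sum.inr m, Sum.inl Z}) := by
  rw [F.line_point_iff hq] at h
  obtain ⟨⟨h1, h2, -⟩, h4, h5, -⟩ := h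
  have a1 := F.l0_ne_l1
  have a2 := F.l0_ne_R'T
  have a3 := F.l1_ne_R'Q
  have a4 : F.R'Q ≠ F.R'T := fun hh => Q_notMem_R'T hQ (hh ▸ F.Q_mem_R'Q)
  have a5 := F.l1_ne_R'T
  have b1 := Q_notMem_R'T hQ
  have b2 := F.T_mem_l1
  have b3 := F.T_mem_R'T
  rcases hm with rfl | rfl | rfl | rfl
  · have hZ : Z ∈ F.l1 ∧ Z ∉ F.R'T ∨ Z ∈ F.R'T ∧ Z ∉ F.l1 := by grind
    rcases hZ with ⟨hZ, hZ'⟩ | ⟨hZ, hZ'⟩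
    · exact (Adds.C15 hQ Z hZ fun hh => hZ' (hh ▸ b3)).exists_hasType
    · by_cases hR' : Z = F.R'
      · subst hR'
        exact (Adds.C11 hQ).exists_hasType
      · exact (Adds.C16 hQ Z hZ (fun hh => hZ' (hh ▸ b2)) hR').exists_hasType
  · have b4 := l0RQ_notMem_l1 hQ
    have hZ : F.Q = Z ∨ F.l0RQ = Z := by grind
    rcases hZ with rfl | rfl
    · exact Adds.C3.exists_hasType
    · exact Adds.C4.exists_hasType
  · have hZ : Z ∈ F.l1 ∧ Z ∉ F.R'T ∨ Z ∈ F.R'T ∧ Z ∉ F.l1 := by grind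
    by_cases hR' : Z = F.R'
    · subst hR'
      exact exists_hasType_of_R'_mem hq hQ F.R'_mem_R'Q (Or.inl F.Q_mem_R'Q)
    by_cases hA : F.l0l1 ∈ F.R'Q
    · have b4 := F.R'_mem_R'Q
      have hZA : F.l0l1 = Z := by grind
      subst hZA
      exact (Adds.C23 hQ hA).exists_hasType
    rcases hZ with ⟨hZ, hZ'⟩ | ⟨hZ, hZ'⟩
    · exact (Adds.C31 hQ hA Z hZ fun hh => hZ' (hh ▸ b3)).exists_hasType
    · exact (Adds.C32 hQ hA Z hZ (fun hh => hZ' (hh ▸ b2)) hR').exists_hasType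
  · by_cases hZQ : Z = F.Q
    · subst hZQ
      rw [F.star_withT hQ]
      exact (Adds.C5 (F := F.withT) F.T_mem_l1).exists_hasType
    by_cases hB : F.l0RQ ∈ F.R'T
    · by_cases hR' : Z = F.R'
      · subst hR'
        exact exists_hasType_of_R'_mem hq hQ F.R'_mem_R'T (Or.inr hB)
      have hZ : Z ∈ F.l0 ∧ Z ∉ F.R'Q ∨ Z ∈ F.R'Q ∧ Z ∉ F.l0 := by grind
      rcases hZ with ⟨hZ, hZ'⟩ | ⟨hZ, hZ'⟩
      · exact (Adds.C29 hQ hB Z hZ fun hh => hZ' (hh ▸ F.l0R'Q_mem_R'Q)).exists_hasType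
      · exact (Adds.C30 hQ hB Z hZ (fun hh => hZ' (hh ▸ F.l0R'Q_mem_l0)) hR' hZQ).exists_hasType
    · have hZB : F.l0RQ = Z := by grind
      subst hZB
      exact (Adds.C28 hQ hB).exists_hasType

/-- The case in which `m` is none of the lines `l0`, `l1`, `R'Q`, `R'T`: then `Z` is one of their
four intersection points `l0 ∩ l1`, `l0 ∩ R'T`, `l1 ∩ R'Q`, `R'`. -/
theorem exists_hasType_of_other_line [Finite Pt] [Finite Ln]
    (hq : 4 ≤ ProjectivePlane.order Pt Ln) (hQ : F.Q ∉ F.l1) {m : Ln} {Z : Pt}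
    (hm : m ∉ F.starLines)
    (hm0 : F.l0 ≠ m) (hm1 : F.l1 ≠ m) (hmQ : F.R'Q ≠ m) (hmT : F.R'T ≠ m)
    (h : Separates (pointPart (F.star ∪ {Sum.inr m, Sum.inl Z}))
      (linePart (F.star ∪ {Sum.inr m, Sum.inl Z}))) :
    ∃ i : ℕ, 1 ≤ i ∧ i ≤ 32 ∧ HasType i (F.star ∪ {Sum.inr m, Sum.inl Z}) := by
  rw [F.line_point_iff hq] at h
  obtain ⟨⟨h1, h2, -⟩, h4, h5, -⟩ := h
  -- the position of `m` relative to the frame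
  have pos : m = F.e ∨ m = F.f ∨ (m ≠ F.e ∧ m ≠ F.f ∧
      ((∃ U, F.IsU U ∧ U ∈ m ∧ F.R' ∉ m) ∨ F.R' ∈ m) ∧ ∃ V, V ∈ F.f ∧ V ≠ F.P ∧ V ∈ m) := by
    rcases F.notMem_starLines hm with h | h | h | h | ⟨hP, hR⟩
    · exact Or.inl h
    · exact Or.inr (Or.inl h)
    · exact absurd h.symm hm0
    · exact absurd h.symm hm1
    · obtain ⟨U, V, hUm, hVm, hUe, hVf, -, hUP, hVP, hUR, -, -⟩ := F.exists_points_of_generic hP hR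
      refine Or.inr (Or.inr ⟨fun h => hP (h ▸ F.P_mem_e), fun h => hP (h ▸ F.P_mem_f), ?_,
        V, hVf, hVP, hVm⟩)
      by_cases hR' : F.R' ∈ m
      · exact Or.inr hR'
      · exact Or.inl ⟨U, ⟨hUe, hUP, hUR, fun hh => hR' (hh ▸ hUm)⟩, hUm, hR'⟩
  have noQ : F.R' ∈ m → F.Q ∉ m := fun hR' hQm =>
    hmQ (line_unique F.R'_ne_Q F.R'_mem_R'Q F.Q_mem_R'Q hR' hQm)
  have noT : F.R' ∈ m → F.T ∉ m := fun hR' hTm =>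
    hmT (line_unique F.R'_ne_T F.R'_mem_R'T F.T_mem_R'T hR' hTm)
  have noAB : F.l0l1 ∈ m → F.l0RQ ∉ m := fun hA hB => hm0
    (line_unique (fun hh : F.l0l1 = F.l0RQ => l0l1_notMem_RQ hQ (hh ▸ F.l0RQ_mem_RQ))
      F.l0l1_mem_l0 F.l0RQ_mem_l0 hA hB)
  have hZ : (Z ∈ F.l0 ∧ Z ∉ F.R'Q ∨ Z ∈ F.R'Q ∧ Z ∉ F.l0) ∧
      (Z ∈ F.l1 ∧ Z ∉ F.R'T ∨ Z ∈ F.R'T ∧ Z ∉ F.l1) := by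
    clear pos h4 h5; grind
  have nQe := F.Q_notMem_e
  have nBe := F.l0RQ_notMem_e
  have nBf := F.l0RQ_notMem_f
  have nAe := F.l0l1_notMem_e
  have nAf := F.l0l1_notMem_f
  have nR'f := F.R'_notMem_f
  obtain ⟨⟨hZ0, hZQ⟩ | ⟨hZQ, hZ0⟩, ⟨hZ1, hZT⟩ | ⟨hZT, hZ1⟩⟩ := hZ
  · have hZA : Z = F.l0l1 := point_unique F.l0_ne_l1 hZ0 hZ1 F.l0l1_mem_l0 F.l0l1_mem_l1
    subst hZA
    have h5 : ¬ (F.Q ∈ m ↔ F.l0RQ ∈ m) := by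
      rcases h5 with h | h | h
      · exact absurd (h ▸ hZ0) F.Q_notMem_l0
      · exact absurd (h ▸ F.l0RQ_mem_RQ) (l0l1_notMem_RQ hQ)
      · exact h
    rcases pos with rfl | rfl | ⟨hme, hmf, hU, V, hVf, hVP, hVm⟩
    · exact absurd (iff_of_false nQe nBe) h5
    · exact (Adds.C14 hQ hZQ).exists_hasType
    · by_cases hQm : F.Q ∈ m
      · rcases hU with ⟨U, hU, hUm, -⟩ | hR'
        · by_cases hA : F.l0l1 ∈ m
          · exact (Adds.C20 hQ U m hU hUm hQm hA).exists_hasType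
          · exact (Adds.C19 hQ U m hU hUm hQm hA hZQ).exists_hasType
        · exact absurd hQm (noQ hR')
      · have hB : F.l0RQ ∈ m := by grind
        have hVQ : V ≠ F.Q := fun hh => hQm (hh ▸ hVm)
        rcases hU with ⟨U, hU, hUm, -⟩ | hR'
        · exact (Adds.C18 hQ U V m hU ⟨hVf, hVP, hVQ⟩ hUm hVm hB hZQ).exists_hasType
        · exact (Adds.C26 hQ V m ⟨hVf, hVP, fun hh => noT hR' (hh ▸ hVm), hVQ⟩ hR' hVm hB
            hZQ).exists_hasType
  · have hZA : Z = F.l0R'T := point_unique F.l0_ne_R'T hZ0 hZT F.l0R'T_mem_l0 F.l0R'T_mem_R'T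
    have h4 : ¬ (F.R' ∈ m ↔ F.l0l1 ∈ m) := by
      rcases h4 with h | h | h
      · exact absurd (h ▸ hZ0) F.R'_notMem_l0
      · exact absurd (h ▸ F.l0l1_mem_l1) hZ1
      · exact h
    rcases h5 with h5 | h5 | h5
    · exact absurd (h5 ▸ hZ0) F.Q_notMem_l0
    · have hBT : F.l0RQ ∈ F.R'T := h5 ▸ hZT
      by_cases hR' : F.R' ∈ m
      · have hA : F.l0l1 ∉ m := by grind
        subst h5
        rcases pos with rfl | rfl | ⟨hme, hmf, hU, V, hVf, hVP, hVm⟩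
        · exact (Adds.C13 hQ hBT).exists_hasType
        · exact absurd hR' nR'f
        · exact (Adds.C24 hQ V m ⟨hVf, hVP, fun hh => noT hR' (hh ▸ hVm),
            fun hh => noQ hR' (hh ▸ hVm)⟩ hR' hVm hA hBT).exists_hasType
      · have hA : F.l0l1 ∈ m := by grind
        rcases pos with rfl | rfl | ⟨hme, hmf, ⟨U, hU, hUm, -⟩ | hR'm, V, hVf, hVP, hVm⟩
        · exact absurd hA nAe
        · exact absurd hA nAf
        · by_cases hVQ : V = F.Q
          · subst hVQ
            rw [hZA]
            exact (Adds.C21 hQ U m hU hUm hVm hA).exists_hasType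
          · subst h5
            exact (Adds.C17 hQ U V m hU ⟨hVf, hVP, hVQ⟩ hUm hVm hA hBT).exists_hasType
        · exact absurd hR'm hR'
    · rw [hZA]
      by_cases hR' : F.R' ∈ m
      · have hQm := noQ hR'
        have hB : F.l0RQ ∈ m := by grind
        rcases pos with rfl | rfl | ⟨hme, hmf, hU, V, hVf, hVP, hVm⟩
        · exact absurd hB nBe
        · exact absurd hB nBf
        · exact (Adds.C25 hQ V m ⟨hVf, hVP, fun hh => noT hR' (hh ▸ hVm),
            fun hh => hQm (hh ▸ hVm)⟩ hR' hVm hB).exists_hasType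
      · have hA : F.l0l1 ∈ m := by grind
        have hQm : F.Q ∈ m := by grind
        rcases pos with rfl | rfl | ⟨hme, hmf, ⟨U, hU, hUm, -⟩ | hR'm, V, hVf, hVP, hVm⟩
        · exact absurd hA nAe
        · exact absurd hA nAf
        · exact (Adds.C21 hQ U m hU hUm hQm hA).exists_hasType
        · exact absurd hR'm hR'
  · have hZA : Z = F.l1R'Q := point_unique F.l1_ne_R'Q hZ1 hZQ F.l1R'Q_mem_l1 F.l1R'Q_mem_R'Q
    have hAQ : F.l0l1 ∉ F.R'Q := fun hh => hZ0
      (point_unique F.l1_ne_R'Q hZ1 hZQ F.l0l1_mem_l1 hh ▸ F.l0l1_mem_l0)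
    have h4 : ¬ (F.R' ∈ m ↔ F.l0l1 ∈ m) := by
      rcases h4 with h | h | h
      · exact absurd (h ▸ hZ1) F.R'_notMem_l1
      · exact absurd (h ▸ F.l0l1_mem_l0) hZ0
      · exact h
    have h5 : ¬ (F.Q ∈ m ↔ F.l0RQ ∈ m) := by
      rcases h5 with h | h | h
      · exact absurd (h ▸ hZ1) hQ
      · exact absurd (h ▸ F.l0RQ_mem_l0) hZ0
      · exact h
    rw [hZA]
    by_cases hR' : F.R' ∈ m
    · have hQm := noQ hR'
      have hB : F.l0RQ ∈ m := by grind
      rcases pos with rfl | rfl | ⟨hme, hmf, hU, V, hVf, hVP, hVm⟩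
      · exact absurd hB nBe
      · exact absurd hB nBf
      · exact (Adds.C27 hQ V m ⟨hVf, hVP, fun hh => noT hR' (hh ▸ hVm),
          fun hh => hQm (hh ▸ hVm)⟩ hR' hVm hB hAQ).exists_hasType
    · have hA : F.l0l1 ∈ m := by grind
      have hQm : F.Q ∈ m := by grind
      rcases pos with rfl | rfl | ⟨hme, hmf, ⟨U, hU, hUm, -⟩ | hR'm, V, hVf, hVP, hVm⟩
      · exact absurd hA nAe
      · exact absurd hA nAf
      · exact (Adds.C22 hQ U m hU hUm hQm hA).exists_hasType
      · exact absurd hR'm hR'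
  · have hQT : F.R'Q ≠ F.R'T := fun hh => Q_notMem_R'T hQ (hh ▸ F.Q_mem_R'Q)
    have hZA : Z = F.R' := point_unique hQT hZQ hZT F.R'_mem_R'Q F.R'_mem_R'T
    subst hZA
    have h5 : ¬ (F.Q ∈ m ↔ F.l0RQ ∈ m) := by
      rcases h5 with h | h | h
      · exact absurd h.symm F.R'_ne_Q
      · exact absurd (h ▸ F.l0RQ_mem_l0) hZ0
      · exact h
    have hQB : F.Q ∈ m ∨ F.l0RQ ∈ m := by grind
    rcases pos with rfl | rfl | ⟨hme, hmf, ⟨U, hU, hUm, -⟩ | hR', -⟩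
    · exact absurd hQB (not_or_intro nQe nBe)
    · exact (Adds.C9 hQ).exists_hasType
    · rcases hQB with hQm | hB
      · exact (Adds.C10 hQ U m hU hUm hQm).exists_hasType
      · exact (Adds.C12 hQ U m hU hUm hB).exists_hasType
    · exact exists_hasType_of_R'_mem hq hQ hR' hQB

theorem exists_hasType_of_separates [Finite Pt] [Finite Ln]
    (hq : 4 ≤ ProjectivePlane.order Pt Ln) {m : Ln} {Z : Pt} (hm : m ∉ F.starLines)
    (h : Separates (pointPart (F.star ∪ {Sum.inr m, Sum.inl Z}))
      (linePart (F.star ∪ {Sum.inr m, Sum.inl Z}))) :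
    ∃ i : ℕ, 1 ≤ i ∧ i ≤ 32 ∧ HasType i (F.star ∪ {Sum.inr m, Sum.inl Z}) := by
  by_cases hQ : F.Q ∈ F.l1
  · obtain ⟨i, hi⟩ := exists_adds_of_Q_mem_l1 hq hQ h
    exact hi.exists_hasType
  by_cases hm' : F.l0 = m ∨ F.l1 = m ∨ F.R'Q = m ∨ F.R'T = m
  · exact exists_hasType_of_conflict_line hq hQ hm' h
  · push Not at hm'
    exact exists_hasType_of_other_line hq hQ hm hm'.1 hm'.2.1 hm'.2.2.1 hm'.2.2.2 h

end Frame

/-! ### Resolving sets of size `4q - 4` -/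

section

variable {Pt Ln : Type*} [Membership Pt Ln] [ProjectivePlane Pt Ln] [Finite Pt] [Finite Ln]

theorem Separates.exists_frame_of_ncard_le {A : Set Pt} {B : Set Ln} (h : Separates A B)
    (hq : 23 ≤ ProjectivePlane.order Pt Ln) (hA : A.ncard + 2 ≤ 2 * ProjectivePlane.order Pt Ln)
    (hAB : A.ncard + B.ncard + 4 ≤ 4 * ProjectivePlane.order Pt Ln) :
    ∃ F : Frame Pt Ln, F.star ⊆ Sum.inl '' A ∪ Sum.inr '' B := by
  classical
  cases nonempty_fintype Pt
  cases nonempty_fintype Ln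
  have hA' : (A.toFinset : Set Pt) = A := Set.coe_toFinset A
  have hB' : (B.toFinset : Set Ln) = B := Set.coe_toFinset B
  rw [Set.ncard_eq_toFinset_card'] at hA hAB
  rw [Set.ncard_eq_toFinset_card'] at hAB
  rw [← hA', ← hB'] at h
  obtain ⟨F, hF⟩ := h.exists_frame hq hA hAB
  rw [hA', hB'] at hF
  exact ⟨F, hF⟩

/-- The points and lines that the constructions add are new, which determines the numbers of points
and of lines of the resolving sets. -/
theorem HasType.separates_and_ncard (hq : 4 ≤ ProjectivePlane.order Pt Ln) {i : ℕ}
    {S : Set (Pt ⊕ Ln)} (h : HasType i S) :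
    Separates (pointPart S) (linePart S) ∧
      ((i = 1 ∨ i = 2 ∨ i = 7 ∨ i = 8) ∧
        (pointPart S).ncard + 3 = 2 * ProjectivePlane.order Pt Ln ∧
        (linePart S).ncard + 1 = 2 * ProjectivePlane.order Pt Ln ∨
      ¬ (i = 1 ∨ i = 2 ∨ i = 7 ∨ i = 8) ∧
        (pointPart S).ncard + 2 = 2 * ProjectivePlane.order Pt Ln ∧
        (linePart S).ncard + 2 = 2 * ProjectivePlane.order Pt Ln) := by
  obtain ⟨F, x, y, hF, rfl⟩ := h
  refine ⟨hF.separates hq, ?_⟩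
  have h1 := F.ncard_starPoints
  have h2 := F.ncard_starLines
  rw [F.pointPart_star_union, F.linePart_star_union]
  obtain ⟨-, -, ⟨hi, m, n, rfl, rfl, hm, hn, hmn⟩ | ⟨hi, m, Z, rfl, rfl, hm, hZ⟩⟩ := hF.shape
  · left
    have hm' : m ∉ insert n F.starLines := by simp [hm, hmn]
    rw [Frame.pointPart_line_line, Frame.linePart_line_line, Set.union_empty, Set.union_insert,
      Set.union_singleton, Set.ncard_insert_of_notMem hm', Set.ncard_insert_of_notMem hn]
    omega
  · right
    rw [Frame.pointPart_line_point, Frame.linePart_line_point, Set.union_singleton,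
      Set.union_singleton, Set.ncard_insert_of_notMem hm, Set.ncard_insert_of_notMem hZ]
    omega

/-- The two objects of `S` outside the structure of its frame have to resolve all conflicts. -/
theorem Separates.exists_hasType (hq : 23 ≤ ProjectivePlane.order Pt Ln) {S : Set (Pt ⊕ Ln)}
    (h : Separates (pointPart S) (linePart S))
    (hS : (pointPart S).ncard + (linePart S).ncard + 4 = 4 * ProjectivePlane.order Pt Ln)
    (hle : (pointPart S).ncard ≤ (linePart S).ncard) :
    ∃ i : ℕ, 1 ≤ i ∧ i ≤ 32 ∧ HasType i S := by
  have hq4 : 4 ≤ ProjectivePlane.order Pt Ln := by omega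
  obtain ⟨F, hF⟩ := h.exists_frame_of_ncard_le hq (by omega) hS.le
  rw [← eq_inl_union_inr] at hF
  have hP : F.starPoints ⊆ pointPart S := fun x hx => hF (Or.inl ⟨x, hx, rfl⟩)
  have hL : F.starLines ⊆ linePart S := fun m hm => hF (Or.inr ⟨m, hm, rfl⟩)
  have h1 := F.ncard_starPoints
  have h2 := F.ncard_starLines
  have h3 := Set.ncard_sdiff_add_ncard_of_subset hP
  have h4 := Set.ncard_sdiff_add_ncard_of_subset hL
  have key : ∀ T : Set (Pt ⊕ Ln), pointPart T = pointPart S \ F.starPoints →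
      linePart T = linePart S \ F.starLines → S = F.star ∪ T := by
    intro T hT1 hT2
    rw [eq_inl_union_inr S, eq_inl_union_inr (F.star ∪ T), F.pointPart_star_union,
      F.linePart_star_union, hT1, hT2, Set.union_sdiff_cancel hP, Set.union_sdiff_cancel hL]
  have hcases : (pointPart S \ F.starPoints).ncard = 0 ∧ (linePart S \ F.starLines).ncard = 2 ∨
      (pointPart S \ F.starPoints).ncard = 1 ∧ (linePart S \ F.starLines).ncard = 1 := by omega
  rcases hcases with ⟨c1, c2⟩ | ⟨c1, c2⟩
  · obtain ⟨m, n, -, hmn⟩ := Set.ncard_eq_two.1 c2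
    rw [Set.ncard_eq_zero] at c1
    have hS' := key {Sum.inr m, Sum.inr n} (by rw [c1, Frame.pointPart_line_line])
      (by rw [hmn, Frame.linePart_line_line])
    subst hS'
    obtain ⟨i, hi | hi⟩ := Frame.exists_adds_of_separates_lines hq4 h
    · exact hi.exists_hasType
    · rw [Set.pair_comm]
      exact hi.exists_hasType
  · obtain ⟨Z, hZ⟩ := Set.ncard_eq_one.1 c1
    obtain ⟨m, hm⟩ := Set.ncard_eq_one.1 c2
    have hm' : m ∉ F.starLines := (hm.symm ▸ Set.mem_singleton m : m ∈ linePart S \ F.starLines).2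
    have hS' := key {Sum.inr m, Sum.inl Z} (by rw [hZ, Frame.pointPart_line_point])
      (by rw [hm, Frame.linePart_line_point])
    subst hS'
    exact Frame.exists_hasType_of_separates hq4 hm' h

theorem separates_and_lt_iff (hq : 23 ≤ ProjectivePlane.order Pt Ln) (S : Set (Pt ⊕ Ln)) :
    (Separates (pointPart S) (linePart S) ∧
      (pointPart S).ncard + (linePart S).ncard + 4 = 4 * ProjectivePlane.order Pt Ln ∧
      (pointPart S).ncard < (linePart S).ncard) ↔
    ∃ i : ℕ, (i = 1 ∨ i = 2 ∨ i = 7 ∨ i = 8) ∧ HasType i S := by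
  constructor
  · rintro ⟨h, hS, hlt⟩
    obtain ⟨i, -, -, hi⟩ := h.exists_hasType hq hS hlt.le
    refine ⟨i, ?_, hi⟩
    rcases (hi.separates_and_ncard (by omega)).2 with h | h
    · exact h.1
    · omega
  · rintro ⟨i, hi, h⟩
    obtain ⟨h1, h2 | h2⟩ := h.separates_and_ncard (by omega)
    · exact ⟨h1, by omega, by omega⟩
    · exact absurd hi h2.1

/-- If `S` has more points than lines, a frame is found in the dual plane. -/
theorem exists_star_subset (hq : 23 ≤ ProjectivePlane.order Pt Ln) {S : Set (Pt ⊕ Ln)}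
    (h : Separates (pointPart S) (linePart S))
    (hS : (pointPart S).ncard + (linePart S).ncard + 4 = 4 * ProjectivePlane.order Pt Ln) :
    ∃ F : Frame Pt Ln, F.star ⊆ S := by
  rw [eq_inl_union_inr S]
  rcases le_total (pointPart S).ncard (linePart S).ncard with hle | hle
  · exact h.exists_frame_of_ncard_le hq (by omega) hS.le
  · have hd := ProjectivePlane.Dual.order Pt Ln
    obtain ⟨F, hF⟩ := Separates.exists_frame_of_ncard_le (Pt := Dual Ln) (Ln := Dual Pt) h.dual
      (by omega) (by rw [hd]; change (linePart S).ncard + 2 ≤ _; omega)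
      (by rw [hd]; change (linePart S).ncard + (pointPart S).ncard + 4 ≤ _; omega)
    refine ⟨F.undual, F.undual_star_subset ?_ ?_⟩
    · intro x hx
      obtain ⟨y, hy, hxy⟩ | ⟨y, -, hxy⟩ := hF (Or.inl ⟨x, hx, rfl⟩)
      · exact Sum.inl_injective hxy ▸ hy
      · cases hxy
    · intro x hx
      obtain ⟨y, -, hxy⟩ | ⟨y, hy, hxy⟩ := hF (Or.inr ⟨x, hx, rfl⟩)
      · cases hxy
      · exact Sum.inr_injective hxy ▸ hy

end

theorem mainTheorem2 {Pt Ln : Type*} [Membership Pt Ln] [Configuration.ProjectivePlane Pt Ln]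
    [Finite Pt] [Finite Ln] (q : ℕ) (hq : Configuration.ProjectivePlane.order Pt Ln = q)
    (hq23 : 23 ≤ q) :
    (∀ F : Frame Pt Ln, F.star.ncard = 4 * q - 6) ∧
    (∀ S : Set (Pt ⊕ Ln), IsResolvingSet (incidenceGraph Pt Ln) S → S.ncard = 4 * q - 4 →
      ∃ F : Frame Pt Ln, F.star ⊆ S) ∧
    (∀ S : Set (Pt ⊕ Ln),
      (IsResolvingSet (incidenceGraph Pt Ln) S ∧ S.ncard = 4 * q - 4 ∧
        (pointPart S).ncard ≤ (linePart S).ncard) ↔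
      ∃ i : ℕ, 1 ≤ i ∧ i ≤ 32 ∧ HasType i S) ∧
    (∀ S : Set (Pt ⊕ Ln),
      (IsResolvingSet (incidenceGraph Pt Ln) S ∧ S.ncard = 4 * q - 4 ∧
        (linePart S).ncard < (pointPart S).ncard) ↔
      ∃ i : ℕ, (i = 1 ∨ i = 2 ∨ i = 7 ∨ i = 8) ∧ HasType i (dualSet S)) := by
  subst hq
  have hsize : ∀ S : Set (Pt ⊕ Ln), S.ncard = 4 * ProjectivePlane.order Pt Ln - 4 ↔
      (pointPart S).ncard + (linePart S).ncard + 4 = 4 * ProjectivePlane.order Pt Ln := by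
    intro S
    rw [ncard_eq_add]
    omega
  refine ⟨fun F => ?_, fun S h hS => ?_, fun S => ?_, fun S => ?_⟩
  · have h1 := F.ncard_starPoints
    have h2 := F.ncard_starLines
    have h3 : pointPart F.star = F.starPoints := by ext; simp [pointPart, Frame.star_eq]
    have h4 : linePart F.star = F.starLines := by ext; simp [linePart, Frame.star_eq]
    rw [ncard_eq_add, h3, h4]
    omega
  · exact exists_star_subset hq23 ((isResolvingSet_iff S).1 h) ((hsize S).1 hS)
  · rw [isResolvingSet_iff, hsize]
    constructor
    · rintro ⟨h, hS, hle⟩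
      exact h.exists_hasType hq23 hS hle
    · rintro ⟨i, -, -, hi⟩
      obtain ⟨h1, h2⟩ := hi.separates_and_ncard (by omega)
      exact ⟨h1, by omega, by omega⟩
  · have hd := ProjectivePlane.Dual.order Pt Ln
    rw [← separates_and_lt_iff (Pt := Dual Ln) (Ln := Dual Pt) (by omega) (dualSet S),
      isResolvingSet_iff, hsize, hd]
    have h1 : Separates (pointPart S) (linePart S) ↔
        Separates (Pt := Dual Ln) (Ln := Dual Pt) (linePart S) (pointPart S) :=
      ⟨fun h => h.dual, fun h => h.dual⟩
    rw [h1, add_comm (pointPart S).ncard]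
    rfl
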